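/- All graphs are finite and simple. The square $G^2$ of a graph $G$ has the same vertices as $G$, and two distinct vertices are adjacent in $G^2$ when their distance in $G$ is at most $2$. An orientation $\vec D$ of a graph gives each edge exactly one direction. A circulation of $\vec D$ is a set of arcs of $\vec D$ (possibly empty) in which every vertex has equal indegree and outdegree; it is even or odd according to its number of arcs. The Alon–Tarsi number $\operatorname{AT}(H)$ of a graph $H$ is the least $k$ such that $H$ has an orientation in which every outdegree is at most $k-1$ and the number of even circulations differs from the number of odd circulations. A Moore graph of degree $d$ is a $d$-regular graph on $d^2+1$ vertices whose square is the complete graph. **Theorem.** Let $G$ be a connected graph with maximum degree $\Delta\ge 3$. If $G$ is not (isomorphic to) the Petersen graph, the Hoffman–Singleton graph, or a Moore graph of degree $57$, then $$\operatorname{AT}(G^2)\le \Delta^2-1.$$ That is, $G^2$ has an orientation with maximum outdegree at most $\Delta^2-2$ in which the numbers of even and odd circulations differ. -/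

import Mathlib

/-- The square of `G`: distinct vertices are adjacent when their distance in `G` is at most 2. -/
def SimpleGraph.square {V : Type*} (G : SimpleGraph V) : SimpleGraph V where
  Adj u v := u ≠ v ∧ (G.Adj u v ∨ ∃ w, G.Adj u w ∧ G.Adj w v)
  symm := ⟨fun _ _ h => ⟨h.1.symm, h.2.imp (fun h => h.symm)
    (fun ⟨w, h1, h2⟩ => ⟨w, h2.symm, h1.symm⟩)⟩⟩
  loopless := ⟨fun _ h => h.1 rfl⟩

/-- The adjacency relation of the square in terms of the distance in `G`. -/
theorem SimpleGraph.square_adj_iff_edist {V : Type*} (G : SimpleGraph V) (u v : V) :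
    G.square.Adj u v ↔ u ≠ v ∧ G.edist u v ≤ 2 := by
  refine and_congr_right fun huv => ⟨?_, fun h => ?_⟩
  · rintro (h | ⟨w, h1, h2⟩)
    · exact (SimpleGraph.edist_le (SimpleGraph.Walk.cons h .nil)).trans (by norm_num)
    · exact (SimpleGraph.edist_le (SimpleGraph.Walk.cons h1 (.cons h2 .nil))).trans (by norm_num)
  · have hne : G.edist u v ≠ ⊤ := fun h' => by rw [h'] at h; exact absurd h (by decide)
    obtain ⟨p, hp⟩ := SimpleGraph.exists_walk_of_edist_ne_top hne
    rw [← hp] at h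
    have h2 : p.length ≤ 2 := by exact_mod_cast h
    match p, h2 with
    | .nil, _ => exact absurd rfl huv
    | .cons a .nil, _ => exact Or.inl a
    | .cons a (.cons b .nil), _ => exact Or.inr ⟨_, a, b⟩
    | .cons _ (.cons _ (.cons _ _)), h2 => simp at h2

/-- `D` arises from `G` by giving each edge of `G` exactly one of its two directions. -/
def Digraph.IsOrientation {V : Type*} (D : Digraph V) (G : SimpleGraph V) : Prop :=
  (∀ u v, G.Adj u v ↔ D.Adj u v ∨ D.Adj v u) ∧ ∀ u v, D.Adj u v → ¬ D.Adj v u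

open Classical in
/-- The outdegree of the vertex `v` in the digraph `D`. -/
noncomputable def Digraph.outdegree {V : Type*} [Fintype V] (D : Digraph V) (v : V) : ℕ :=
  (Finset.univ.filter fun w => D.Adj v w).card

open Classical in
/-- The circulations (eulerian subgraphs) of `D`, each given by its set of arcs: the sets `C` of
arcs of `D` such that every vertex has equally many outgoing and incoming arcs in `C`. -/
noncomputable def Digraph.circulations {V : Type*} [Fintype V] (D : Digraph V) :
    Finset (Finset (V × V)) :=
  Finset.univ.filter fun C => (∀ a ∈ C, D.Adj a.1 a.2) ∧
    ∀ v, (C.filter fun a => a.1 = v).card = (C.filter fun a => a.2 = v).card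

/-- The circulations with an even number of arcs. -/
noncomputable def Digraph.evenCirculations {V : Type*} [Fintype V] (D : Digraph V) :
    Finset (Finset (V × V)) :=
  D.circulations.filter fun C => Even C.card

/-- The circulations with an odd number of arcs. -/
noncomputable def Digraph.oddCirculations {V : Type*} [Fintype V] (D : Digraph V) :
    Finset (Finset (V × V)) :=
  D.circulations.filter fun C => Odd C.card

/-- The Alon–Tarsi number of `G`: the least `k` such that `G` has an orientation in which every
outdegree is at most `k - 1` (i.e. less than `k`) and the numbers of even and of odd circulations
differ. It takes values in `ℕ∞`, so that the infimum of the empty set would be `⊤`. -/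
noncomputable def SimpleGraph.alonTarsiNumber {V : Type*} [Fintype V] (G : SimpleGraph V) : ℕ∞ :=
  ⨅ k ∈ {k : ℕ | ∃ D : Digraph V, D.IsOrientation G ∧ (∀ v, D.outdegree v < k) ∧
    D.evenCirculations.card ≠ D.oddCirculations.card}, (k : ℕ∞)

/-- The Petersen graph: the vertices are the 2-element subsets of a 5-element set, and two of them
are adjacent when they are disjoint. -/
def petersenGraph : SimpleGraph {s : Finset (Fin 5) // s.card = 2} where
  Adj s t := Disjoint s.1 t.1
  symm := ⟨fun _ _ h => h.symm⟩
  loopless := ⟨fun s h => by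
    have h0 : s.1 = ∅ := by simpa using h
    have h2 := s.2
    simp [h0] at h2⟩

/-- One direction of each adjacency of the Hoffman–Singleton graph in Robertson's construction:
there are five pentagons `P h` and five pentagrams `Q i`, where `Sum.inl (h, j)` is the vertex `j`
of `P h` and `Sum.inr (i, j)` is the vertex `j` of `Q i`. In `P h`, `j` is joined to `j + 1`; in
`Q i`, `j` is joined to `j + 2`; and `j` of `P h` is joined to `h * i + j` of `Q i`. -/
def hoffmanSingletonRel :
    (ZMod 5 × ZMod 5) ⊕ (ZMod 5 × ZMod 5) → (ZMod 5 × ZMod 5) ⊕ (ZMod 5 × ZMod 5) → Prop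
  | .inl (h, j), .inl (h', j') => h = h' ∧ j' = j + 1
  | .inr (i, j), .inr (i', j') => i = i' ∧ j' = j + 2
  | .inl (h, j), .inr (i, j') => j' = h * i + j
  | .inr _, .inl _ => False

/-- The Hoffman–Singleton graph (on 50 vertices). -/
def hoffmanSingletonGraph : SimpleGraph ((ZMod 5 × ZMod 5) ⊕ (ZMod 5 × ZMod 5)) :=
  SimpleGraph.fromRel hoffmanSingletonRel

/-- `G` is a Moore graph of degree `d`: it is `d`-regular on `d ^ 2 + 1` vertices, and its square
is the complete graph. -/
def SimpleGraph.IsMooreGraph {V : Type*} [Fintype V] (G : SimpleGraph V) [DecidableRel G.Adj]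
    (d : ℕ) : Prop :=
  G.IsRegularOfDegree d ∧ Fintype.card V = d ^ 2 + 1 ∧ G.square = ⊤

/-!
Let `Δ` be the maximum degree of `G`. All degrees in `G.square` are at most `Δ ^ 2`, so one has to
save just two at every vertex. The argument is by contradiction: `Bad` says that the desired
orientation does not exist, and the following tool shows that `G` is then very restricted.

*The tool.* By the theorem of Alon and Tarsi, in the form of `card_even_ne_card_odd` and
`exists_reorientation`, a nonzero coefficient of the polynomial `∏ (x_u - x_v)` over the edges of a
graph gives an orientation with the exponents as outdegrees and with different numbers of even and
odd circulations. Such an orientation is only needed for the subgraph of `G.square` induced on a set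
`H` that contains an edge of `G`, with every exponent at most the degree inside `H` minus two
(`hasATOrientation_of_coeff`): the other vertices are removed one by one in the order of decreasing
distance to `H`, and each of them still has two neighbours in the square at that moment, namely the
next two vertices of a shortest path. A vertex whose degree in the square is less than `Δ ^ 2` gives
additional slack.

*Degrees.* Taking for `H` an edge, one sees that `G` is regular and triangle-free
(`Bad.regular`, `Bad.triangle_free`).

*A 4-cycle exists.* Its vertices have slack. Small sets `H` around the 4-cycle show that its vertices
are adjacent to all others in the square, so that `G` has `Δ ^ 2` vertices and a complete square
(`Bad.eq_top_of_square`). Counting eigenvalues, no such graph exists (`not_card_eq_sq`).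

*The girth is five.* Small sets `H` around a 5-cycle show that the square is complete
(`Bad.eq_top_of_pentagon`), so that `G` is a Moore graph. By the theorem of Hoffman and Singleton
its degree is `3`, `7` or `57` (`moore_degree`), and for the degrees `3` and `7` it is the Petersen
graph (`nonempty_iso_petersen`) or the Hoffman–Singleton graph (`nonempty_iso_hoffmanSingleton`).

*The girth is at least six.* Here `H` consists of a shortest cycle and at most two vertices attached
to it, depending on the length modulo three (`Bad.exists_short_cycle`). Lengthening the cycle by
three vertices does not change the coefficient (`coeff_insert_three`), which leaves three small
computations.
-/

open MvPolynomial

/-! ### Orientations from nonzero coefficients -/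

/-- The polynomial `∏ (x_u - x_v)` over a finite set of arcs `(u, v)`. -/
noncomputable def edgePoly {V : Type*} (E : Finset (V × V)) : MvPolynomial V ℤ :=
  ∏ e ∈ E, (X e.1 - X e.2)

/-- The exponent of the monomial picked from `edgePoly E` when the arcs in `T` are reversed: it
counts the outdegrees of the resulting orientation. -/
noncomputable def flipExp {V : Type*} [DecidableEq V] (E T : Finset (V × V)) : V →₀ ℕ :=
  ∑ e ∈ T, Finsupp.single e.2 1 + ∑ e ∈ E \ T, Finsupp.single e.1 1

/-- Expanding the product: `T` is the set of arcs that contribute their head. -/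
theorem edgePoly_eq_sum {V : Type*} [DecidableEq V] (E : Finset (V × V)) :
    edgePoly E = ∑ T ∈ E.powerset, monomial (flipExp E T) ((-1 : ℤ) ^ T.card) := by
  have h : edgePoly E = ∏ e ∈ E, (-X e.2 + X e.1 : MvPolynomial V ℤ) :=
    Finset.prod_congr rfl fun e _ => by ring
  rw [h, Finset.prod_add]
  refine Finset.sum_congr rfl fun T _ => ?_
  have h1 : ∀ (s : Finset (V × V)) (f : V × V → V),
      (∏ e ∈ s, X (f e) : MvPolynomial V ℤ) = monomial (∑ e ∈ s, Finsupp.single (f e) 1) 1 := by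
    intro s f
    rw [monomial_sum_one]
    rfl
  have h2 : (∏ e ∈ T, -X e.2 : MvPolynomial V ℤ) = C ((-1 : ℤ) ^ T.card) * ∏ e ∈ T, X e.2 := by
    rw [Finset.prod_neg]; simp
  rw [h2, h1 T Prod.snd, h1 (E \ T) Prod.fst, mul_assoc, monomial_mul, C_mul_monomial]
  simp [flipExp]

theorem coeff_edgePoly {V : Type*} [DecidableEq V] (E : Finset (V × V)) (d : V →₀ ℕ) :
    coeff d (edgePoly E) = ∑ T ∈ E.powerset with flipExp E T = d, (-1 : ℤ) ^ T.card := by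
  rw [edgePoly_eq_sum, coeff_sum, Finset.sum_filter]
  refine Finset.sum_congr rfl fun T _ => ?_
  rw [coeff_monomial]

theorem sum_single_apply {V : Type*} [DecidableEq V] (s : Finset (V × V)) (f : V × V → V) (v : V) :
    (∑ e ∈ s, Finsupp.single (f e) 1 : V →₀ ℕ) v = (s.filter fun e => f e = v).card := by
  rw [Finsupp.finsetSum_apply, Finset.card_filter]
  refine Finset.sum_congr rfl fun e _ => ?_
  rw [Finsupp.single_apply]

/-- A nonzero coefficient of `edgePoly E` is, up to sign, the coefficient of the outdegree monomial
of some reorientation `E'` of `E`. -/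
theorem exists_reorientation {V : Type*} [DecidableEq V] (E : Finset (V × V))
    (hE : ∀ u v, (u, v) ∈ E → (v, u) ∉ E) (d : V →₀ ℕ) (hd : coeff d (edgePoly E) ≠ 0) :
    ∃ E' : Finset (V × V), (∀ u v, (u, v) ∈ E' → (v, u) ∉ E') ∧
      (∀ u v, ((u, v) ∈ E' ∨ (v, u) ∈ E') ↔ ((u, v) ∈ E ∨ (v, u) ∈ E)) ∧
      (∀ v, (E'.filter fun e => e.1 = v).card = d v) ∧ coeff d (edgePoly E') ≠ 0 := by
  have hne := hd
  rw [coeff_edgePoly] at hd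
  obtain ⟨T, hT, -⟩ := Finset.exists_ne_zero_of_sum_ne_zero hd
  rw [Finset.mem_filter, Finset.mem_powerset] at hT
  obtain ⟨hTE, hTd⟩ := hT
  have hmem : ∀ u v, (u, v) ∈ T.image Prod.swap ↔ (v, u) ∈ T := by
    intro u v
    simp only [Finset.mem_image, Prod.exists, Prod.swap_prod_mk, Prod.mk.injEq]
    exact ⟨fun ⟨a, b, h, h1, h2⟩ => h1 ▸ h2 ▸ h, fun h => ⟨v, u, h, rfl, rfl⟩⟩
  have hmem' : ∀ u v, (u, v) ∈ E \ T ∪ T.image Prod.swap ↔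
      ((u, v) ∈ E ∧ (u, v) ∉ T) ∨ (v, u) ∈ T := by
    intro u v
    rw [Finset.mem_union, Finset.mem_sdiff, hmem]
  have hdisj : Disjoint (E \ T) (T.image Prod.swap) := by
    rw [Finset.disjoint_left]
    rintro ⟨u, v⟩ h1 h2
    exact hE u v (Finset.mem_sdiff.1 h1).1 (hTE ((hmem u v).1 h2))
  have hinj : Set.InjOn Prod.swap (T : Set (V × V)) := Prod.swap_injective.injOn
  refine ⟨E \ T ∪ T.image Prod.swap, fun u v h h' => ?_, fun u v => ?_, fun v => ?_, ?_⟩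
  · rw [hmem'] at h h'
    have := hE u v
    have := hE v u
    have := @hTE (u, v)
    have := @hTE (v, u)
    tauto
  · rw [hmem', hmem']
    have := @hTE (u, v)
    have := @hTE (v, u)
    tauto
  · rw [← hTd, flipExp, Finsupp.add_apply, sum_single_apply, sum_single_apply,
      Finset.filter_union, Finset.card_union_of_disjoint
        (Finset.disjoint_filter_filter hdisj), add_comm]
    congr 1
    rw [Finset.filter_image, Finset.card_image_of_injective _ Prod.swap_injective]
    rfl
  · have h2 : edgePoly (E \ T ∪ T.image Prod.swap) = C ((-1 : ℤ) ^ T.card) * edgePoly E := by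
      rw [edgePoly, Finset.prod_union hdisj, Finset.prod_image hinj, edgePoly,
        ← Finset.prod_sdiff hTE]
      have h3 : (∏ x ∈ T, (X x.swap.1 - X x.swap.2) : MvPolynomial V ℤ) =
          ∏ x ∈ T, -(X x.1 - X x.2) := Finset.prod_congr rfl fun x _ => by simp
      rw [h3, Finset.prod_neg]
      simp only [C_pow, C_neg, C_1]
      ring
    rw [h2, coeff_C_mul]
    exact mul_ne_zero (pow_ne_zero _ (by norm_num)) hne

/-- The coefficient of the outdegree monomial of `E` counts the even minus the odd circulations. -/
theorem card_even_ne_card_odd {V : Type*} [DecidableEq V] (E : Finset (V × V)) (d : V →₀ ℕ)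
    (hd : ∀ v, (E.filter fun e => e.1 = v).card = d v) (h : coeff d (edgePoly E) ≠ 0)
    (K : Finset (Finset (V × V)))
    (hK : ∀ C, C ∈ K ↔ C ⊆ E ∧
      ∀ v, (C.filter fun a => a.1 = v).card = (C.filter fun a => a.2 = v).card) :
    (K.filter fun C => Even C.card).card ≠ (K.filter fun C => Odd C.card).card := by
  have hK' : E.powerset.filter (fun T => flipExp E T = d) = K := by
    ext T
    rw [Finset.mem_filter, Finset.mem_powerset, hK]
    refine and_congr_right fun hT => ?_
    rw [Finsupp.ext_iff]
    refine forall_congr' fun v => ?_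
    have h1 : (E.filter fun e => e.1 = v).card =
        (T.filter fun e => e.1 = v).card + ((E \ T).filter fun e => e.1 = v).card := by
      rw [← Finset.card_union_of_disjoint (Finset.disjoint_filter_filter
        Finset.disjoint_sdiff), ← Finset.filter_union, Finset.union_sdiff_of_subset hT]
    rw [flipExp, Finsupp.add_apply, sum_single_apply, sum_single_apply, ← hd v, h1]
    omega
  rw [coeff_edgePoly, hK'] at h
  intro heq
  apply h
  rw [← Finset.sum_filter_add_sum_filter_not K (fun C => Even C.card)]
  have e1 : ∑ x ∈ K.filter (fun C => Even C.card), (-1 : ℤ) ^ x.card =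
      (K.filter fun C => Even C.card).card := by
    rw [Finset.card_eq_sum_ones, Nat.cast_sum]
    exact Finset.sum_congr rfl fun x hx => by simp [(Finset.mem_filter.1 hx).2.neg_one_pow]
  have e2 : ∑ x ∈ K.filter (fun C => ¬ Even C.card), (-1 : ℤ) ^ x.card =
      -((K.filter fun C => Odd C.card).card : ℤ) := by
    simp only [Nat.not_even_iff_odd]
    rw [Finset.card_eq_sum_ones, Nat.cast_sum, ← Finset.sum_neg_distrib]
    exact Finset.sum_congr rfl fun x hx => by simp [(Finset.mem_filter.1 hx).2.neg_one_pow]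
  rw [e1, e2, heq]
  ring

/-! ### Extending an orientation of an induced subgraph of the square -/

open Classical in
/-- The finite set of neighbours of `v` in `G`. -/
noncomputable def nbrs {V : Type*} [Fintype V] (G : SimpleGraph V) (v : V) : Finset V :=
  Finset.univ.filter fun w => G.Adj v w

@[simp] theorem mem_nbrs {V : Type*} [Fintype V] {G : SimpleGraph V} {v w : V} :
    w ∈ nbrs G v ↔ G.Adj v w := by
  simp [nbrs]

/-- The conclusion aimed at: an orientation of `G` with outdegrees at most `m` in which the numbers
of even and odd circulations differ. -/
def HasATOrientation {V : Type*} [Fintype V] (G : SimpleGraph V) (m : ℕ) : Prop :=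
  ∃ D : Digraph V, D.IsOrientation G ∧ (∀ v, D.outdegree v ≤ m) ∧
    D.evenCirculations.card ≠ D.oddCirculations.card

theorem mem_circulations {V : Type*} [Fintype V] [DecidableEq V] (D : Digraph V)
    (C : Finset (V × V)) : C ∈ D.circulations ↔ (∀ a ∈ C, D.Adj a.1 a.2) ∧
      ∀ v, (C.filter fun a => a.1 = v).card = (C.filter fun a => a.2 = v).card := by
  classical
  unfold Digraph.circulations
  simp only [Finset.mem_filter, Finset.mem_univ, true_and]
  congr!

/-- An orientation `E` of the subgraph of `S` induced on `H` extends to `S`: the vertices of `H`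
send arcs to all their neighbours outside, and the remaining edges point upwards along `ord`. No
circulation leaves `H`. -/
theorem hasATOrientation_of_ord {V : Type*} [Fintype V] [DecidableEq V] (S : SimpleGraph V) (m : ℕ)
    (H : Finset V) (E : Finset (V × V))
    (hE : ∀ u v, ((u, v) ∈ E ∨ (v, u) ∈ E) ↔ u ∈ H ∧ v ∈ H ∧ S.Adj u v)
    (hanti : ∀ u v, (u, v) ∈ E → (v, u) ∉ E) (d : V →₀ ℕ)
    (hd : ∀ v, (E.filter fun e => e.1 = v).card = d v) (hco : coeff d (edgePoly E) ≠ 0)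
    (ord : V → ℕ) (hinj : Function.Injective ord)
    (hout : ∀ v ∉ H, ∃ a b, a ≠ b ∧ S.Adj v a ∧ S.Adj v b ∧ (a ∈ H ∨ ord a < ord v) ∧
      (b ∈ H ∨ ord b < ord v))
    (hdeg : ∀ v ∉ H, (nbrs S v).card ≤ m + 2)
    (hH : ∀ v ∈ H, d v + (nbrs S v).card ≤ m + (nbrs S v ∩ H).card) :
    HasATOrientation S m := by
  classical
  obtain ⟨D, hDadj⟩ : ∃ D : Digraph V, ∀ u v, D.Adj u v ↔ (u, v) ∈ E ∨
      (S.Adj u v ∧ v ∉ H ∧ (u ∈ H ∨ ord u < ord v)) := ⟨⟨fun u v => (u, v) ∈ E ∨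
    (S.Adj u v ∧ v ∉ H ∧ (u ∈ H ∨ ord u < ord v))⟩, fun u v => Iff.rfl⟩
  have hEH : ∀ u v, (u, v) ∈ E → u ∈ H ∧ v ∈ H ∧ S.Adj u v := fun u v h => (hE u v).1 (Or.inl h)
  refine ⟨D, ⟨fun u v => ?_, fun u v h h' => ?_⟩, fun v => ?_, ?_⟩
  · rw [hDadj, hDadj]
    constructor
    · intro h
      have h' := h.symm
      by_cases hu : u ∈ H <;> by_cases hv : v ∈ H
      · rcases (hE u v).2 ⟨hu, hv, h⟩ with h1 | h1 <;> tauto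
      · tauto
      · tauto
      · rcases lt_trichotomy (ord u) (ord v) with h1 | h1 | h1
        · tauto
        · exact absurd (hinj h1) h.ne
        · tauto
    · rintro ((h | h) | (h | h))
      · exact (hEH _ _ h).2.2
      · exact h.1
      · exact (hEH _ _ h).2.2.symm
      · exact h.1.symm
  · rw [hDadj] at h h'
    rcases h with h | ⟨h1, h2, h3⟩ <;> rcases h' with h' | ⟨h1', h2', h3'⟩
    · exact hanti _ _ h h'
    · exact h2' (hEH _ _ h).1
    · exact h2 (hEH _ _ h').1
    · rcases h3 with h3 | h3
      · exact h2' h3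
      · rcases h3' with h3' | h3'
        · exact h2 h3'
        · omega
  · rw [Digraph.outdegree]
    by_cases hv : v ∈ H
    · have hsub : (Finset.univ.filter fun w => D.Adj v w) ⊆
          (E.filter fun e => e.1 = v).image Prod.snd ∪ (nbrs S v \ H) := by
        intro w hw
        rw [Finset.mem_filter, hDadj] at hw
        rw [Finset.mem_union, Finset.mem_sdiff, mem_nbrs]
        rcases hw.2 with h | h
        · exact Or.inl (Finset.mem_image.2 ⟨(v, w), by simp [h], rfl⟩)
        · exact Or.inr ⟨h.1, h.2.1⟩
      have h1 := Finset.card_le_card hsub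
      have h2 := Finset.card_union_le ((E.filter fun e => e.1 = v).image Prod.snd) (nbrs S v \ H)
      have h3 : ((E.filter fun e => e.1 = v).image Prod.snd).card ≤ d v :=
        Finset.card_image_le.trans (hd v).le
      have h4 := Finset.card_sdiff_add_card_inter (nbrs S v) H
      have h5 := hH v hv
      omega
    · obtain ⟨a, b, hab, ha, hb, ha', hb'⟩ := hout v hv
      have key : ∀ a, (a ∈ H ∨ ord a < ord v) → ¬ D.Adj v a := by
        intro a ha h
        rw [hDadj] at h
        rcases h with h | ⟨h1, h2, h3⟩
        · exact hv (hEH _ _ h).1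
        · have : ¬ ord v < ord a := by
            rcases ha with ha | ha
            · exact absurd ha h2
            · omega
          tauto
      have hsub : (Finset.univ.filter fun w => D.Adj v w) ⊆ nbrs S v \ {a, b} := by
        intro w hw
        have hw' := (Finset.mem_filter.1 hw).2
        rw [Finset.mem_sdiff, mem_nbrs]
        refine ⟨?_, fun h => ?_⟩
        · rcases (hDadj v w).1 hw' with h | h
          · exact (hEH _ _ h).2.2
          · exact h.1
        · rw [Finset.mem_insert, Finset.mem_singleton] at h
          rcases h with rfl | rfl
          · exact key _ ha' hw'
          · exact key _ hb' hw'
      have h1 := Finset.card_le_card hsub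
      have h2 : ({a, b} : Finset V) ⊆ nbrs S v := by
        intro w hw
        rw [Finset.mem_insert, Finset.mem_singleton] at hw
        rcases hw with rfl | rfl <;> simpa
      rw [Finset.card_sdiff_of_subset h2, Finset.card_pair hab] at h1
      have := hdeg v hv
      omega
  · refine card_even_ne_card_odd E d hd hco D.circulations fun C => ?_
    rw [mem_circulations]
    constructor
    · rintro ⟨h1, h2⟩
      refine ⟨?_, h2⟩
      rintro ⟨u, v⟩ hC
      rcases (hDadj _ _).1 (h1 _ hC) with h | h
      · exact h
      exfalso
      -- Among the heads outside `H` of arcs of `C`, the one of largest `ord` has no arc of `C`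
      -- to leave by.
      set M := (C.image Prod.snd).filter fun w => w ∉ H with hM
      have hvM : v ∈ M := by
        rw [hM, Finset.mem_filter, Finset.mem_image]
        exact ⟨⟨_, hC, rfl⟩, h.2.1⟩
      obtain ⟨w, hw, hmax⟩ := M.exists_max_image ord ⟨v, hvM⟩
      rw [hM, Finset.mem_filter, Finset.mem_image] at hw
      obtain ⟨⟨⟨t, w'⟩, hC', rfl⟩, hwH⟩ := hw
      have hpos : 0 < (C.filter fun a => a.1 = w').card := by
        have : 0 < (C.filter fun a => a.2 = w').card :=
          Finset.card_pos.2 ⟨(t, w'), Finset.mem_filter.2 ⟨hC', rfl⟩⟩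
        rwa [h2 w']
      obtain ⟨⟨w1, x⟩, hx⟩ := Finset.card_pos.1 hpos
      rw [Finset.mem_filter] at hx
      obtain ⟨hxC, rfl : w1 = w'⟩ := hx
      rcases (hDadj _ _).1 (h1 _ hxC) with h3 | h3
      · exact hwH (hEH _ _ h3).1
      · have hxM : x ∈ M := by
          rw [hM, Finset.mem_filter, Finset.mem_image]
          exact ⟨⟨_, hxC, rfl⟩, h3.2.1⟩
        have := hmax x hxM
        have := h3.2.2
        simp only at *
        rcases h3.2.2 with h4 | h4
        · exact hwH h4
        · omega
    · rintro ⟨h1, h2⟩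
      exact ⟨fun a ha => (hDadj _ _).2 (Or.inl (h1 ha)), h2⟩

/-- The vertices outside `H` are ordered by their distance to one end `x` of an edge `xy` of `G`
inside `H`: each of them has two neighbours in the square that lie in `H` or are closer to `x`. -/
theorem hasATOrientation_of_coeff {V : Type*} [Fintype V] [DecidableEq V] (G : SimpleGraph V)
    (hconn : G.Connected) (m : ℕ) (H : Finset V) (x y : V) (hx : x ∈ H) (hy : y ∈ H)
    (hxy : G.Adj x y) (E : Finset (V × V))
    (hE : ∀ u v, ((u, v) ∈ E ∨ (v, u) ∈ E) ↔ u ∈ H ∧ v ∈ H ∧ G.square.Adj u v)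
    (hanti : ∀ u v, (u, v) ∈ E → (v, u) ∉ E) (d : V →₀ ℕ) (hco : coeff d (edgePoly E) ≠ 0)
    (hdeg : ∀ v, (nbrs G.square v).card ≤ m + 2)
    (hH : ∀ v ∈ H, d v + (nbrs G.square v).card ≤ m + (nbrs G.square v ∩ H).card) :
    HasATOrientation G.square m := by
  classical
  obtain ⟨E', h1, h2, h3, h4⟩ := exists_reorientation E hanti d hco
  have hlt : ∀ v : V, ((Fintype.equivFin V v : Fin _) : ℕ) < Fintype.card V := fun v => Fin.is_lt _
  have hmono : ∀ a b : V, G.dist x a < G.dist x b →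
      G.dist x a * Fintype.card V + (Fintype.equivFin V a : ℕ) <
      G.dist x b * Fintype.card V + (Fintype.equivFin V b : ℕ) := by
    intro a b h
    have := Nat.mul_le_mul_right (Fintype.card V) (Nat.succ_le_of_lt h)
    have := hlt a
    rw [Nat.succ_mul] at *
    omega
  refine hasATOrientation_of_ord G.square m H E' (fun u v => (h2 u v).trans (hE u v)) h1 d h3 h4
    (fun v => G.dist x v * Fintype.card V + (Fintype.equivFin V v : ℕ)) ?_ ?_
    (fun v _ => hdeg v) hH
  · intro a b hab
    rcases lt_trichotomy (G.dist x a) (G.dist x b) with h | h | h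
    · exact absurd hab (hmono a b h).ne
    · simp only [h] at hab
      exact (Fintype.equivFin V).injective (Fin.ext (by omega))
    · exact absurd hab (hmono b a h).ne'
  · intro v hv
    have hvx : v ≠ x := fun h => hv (h ▸ hx)
    have hvy : v ≠ y := fun h => hv (h ▸ hy)
    obtain ⟨p, hp⟩ := hconn.exists_walk_length_eq_dist v x
    cases p with
    | nil => exact absurd rfl hvx
    | @cons _ a _ hva q =>
      cases q with
      | nil => exact ⟨x, y, hxy.ne, ⟨hvx, Or.inl hva⟩, ⟨hvy, Or.inr ⟨_, hva, hxy⟩⟩, Or.inl hx,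
          Or.inl hy⟩
      | @cons _ b _ hab r =>
        have hb : G.dist x b ≤ r.length := by rw [G.dist_comm]; exact SimpleGraph.dist_le r
        have ha : G.dist x a ≤ r.length + 1 := by
          rw [G.dist_comm]; exact SimpleGraph.dist_le (SimpleGraph.Walk.cons hab r)
        have hv' : G.dist x v = r.length + 2 := by
          rw [G.dist_comm, ← hp]; rfl
        have hvb : v ≠ b := by
          rintro rfl
          omega
        exact ⟨a, b, hab.ne, ⟨hva.ne, Or.inl hva⟩, ⟨hvb, Or.inr ⟨a, hva, hab⟩⟩,
          Or.inr (hmono _ _ (by omega)), Or.inr (hmono _ _ (by omega))⟩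

/-! ### Coefficients of explicit edge polynomials -/

/-- The polynomial `∏ (x_u - x_v)` over a list of arcs `(u, v)`. -/
noncomputable def listPoly {V : Type*} (l : List (V × V)) : MvPolynomial V ℤ :=
  (l.map fun e => X e.1 - X e.2).prod

/-- The exponent given by a list of natural numbers. -/
noncomputable def listExp (n : ℕ) (d : List ℕ) : Fin n →₀ ℕ :=
  Finsupp.equivFunOnFinite.symm fun i => d.getD i 0

@[simp] theorem listExp_apply (n : ℕ) (d : List ℕ) (i : Fin n) :
    listExp n d i = d.getD i 0 := rfl

/-- The coefficient of `listPoly l` at the exponent `d`, computed by expanding one factor at a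
time. -/
def coeffAux {n : ℕ} : List (Fin n × Fin n) → List ℕ → ℤ
  | [], d => if d.all (· == 0) then 1 else 0
  | e :: l, d =>
    (match d.getD e.1 0 with
      | 0 => 0
      | k + 1 => coeffAux l (d.set e.1 k)) -
    (match d.getD e.2 0 with
      | 0 => 0
      | k + 1 => coeffAux l (d.set e.2 k))

theorem coeff_listPoly {n : ℕ} (l : List (Fin n × Fin n)) (d : List ℕ) (hd : d.length = n) :
    coeff (listExp n d) (listPoly l) = coeffAux l d := by
  induction l generalizing d with
  | nil =>
    rw [listPoly, coeffAux, List.map_nil, List.prod_nil, coeff_one]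
    congr 1
    rw [eq_iff_iff, Finsupp.ext_iff, List.all_eq_true]
    constructor
    · intro h x hx
      obtain ⟨i, hi, rfl⟩ := List.getElem_of_mem hx
      have := h ⟨i, hd ▸ hi⟩
      rw [listExp_apply, List.getD_eq_getElem _ _ hi] at this
      simpa using this.symm
    · intro h i
      have hi : (i : ℕ) < d.length := hd ▸ i.2
      have := h _ (List.getElem_mem hi)
      rw [listExp_apply, List.getD_eq_getElem _ _ hi]
      exact (by simpa using this : d[(i : ℕ)] = 0).symm
  | cons e l ih =>
    have key : ∀ a : Fin n, coeff (listExp n d) (X a * listPoly l) =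
        (match d.getD a 0 with
          | 0 => 0
          | k + 1 => coeffAux l (d.set a k)) := by
      intro a
      rw [coeff_X_mul']
      have ha : (a : ℕ) < d.length := hd ▸ a.2
      cases hk : d.getD a 0 with
      | zero =>
        rw [if_neg]
        rw [Finsupp.mem_support_iff, listExp_apply, hk]
        simp
      | succ k =>
        rw [if_pos]
        · simp only
          rw [← ih _ (by simpa using hd)]
          congr 1
          ext i
          rw [Finsupp.tsub_apply, listExp_apply, listExp_apply, Finsupp.single_apply]
          by_cases hia : a = i
          · subst hia
            rw [if_pos rfl, hk, List.getD_eq_getElem _ _ (by simpa using ha)]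
            simp
          · rw [if_neg hia]
            have : (a : ℕ) ≠ i := fun h => hia (Fin.ext h)
            simp [List.getD, this]
        · rw [Finsupp.mem_support_iff, listExp_apply, hk]
          simp
    have h1 : listPoly (e :: l) = X e.1 * listPoly l - X e.2 * listPoly l := by
      rw [← sub_mul]; rfl
    rw [h1, coeff_sub, key, key, coeffAux]

theorem listPoly_map {V W : Type*} (f : V → W) (l : List (V × V)) :
    listPoly (l.map (Prod.map f f)) = rename f (listPoly l) := by
  rw [listPoly, listPoly, map_list_prod, List.map_map, List.map_map]
  congr 1
  refine List.map_congr_left fun e _ => ?_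
  simp

theorem edgePoly_toFinset {V : Type*} [DecidableEq V] (l : List (V × V)) (hl : l.Nodup) :
    edgePoly l.toFinset = listPoly l := by
  rw [edgePoly, List.prod_toFinset _ hl]
  rfl

/-- The number of arcs of `l` at `i`. -/
def listDeg {n : ℕ} (l : List (Fin n × Fin n)) (i : Fin n) : ℕ :=
  (Finset.univ.filter fun j => (i, j) ∈ l ∨ (j, i) ∈ l).card

/-- The graph on `Fin n` with edges `l` and non-edges `nl` has a nonzero coefficient at the exponents
`d`, and `d` stays below the degrees by `2`, or by less at vertices with slack `s`. Lists that are
too short are continued by zeros. -/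
def IsGoodPattern {n : ℕ} (l nl : List (Fin n × Fin n)) (d s : List ℕ) : Prop :=
  (∀ p ∈ l, p.1 < p.2) ∧ l.Nodup ∧ (∀ i j, i < j → (i, j) ∈ l ∨ (i, j) ∈ nl) ∧ d.length = n ∧
    (∀ i : Fin n, d.getD i 0 + 2 ≤ s.getD i 0 + listDeg l i) ∧ coeffAux l d ≠ 0

instance {n : ℕ} (l nl : List (Fin n × Fin n)) (d s : List ℕ) :
    Decidable (IsGoodPattern l nl d s) := by
  unfold IsGoodPattern; infer_instance

/-- If the square of `G` induces a good pattern on a set of vertices that contains an edge of `G`,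
then the square has the desired orientation. -/
theorem hasATOrientation_of_pattern {V : Type*} [Fintype V] (G : SimpleGraph V)
    (hconn : G.Connected) (m : ℕ) (hdeg : ∀ v, (nbrs G.square v).card ≤ m + 2) {n : ℕ}
    (φ : Fin n → V) (x y : Fin n) (hxy : G.Adj (φ x) (φ y)) (l nl : List (Fin n × Fin n))
    (d s : List ℕ) (hgood : IsGoodPattern l nl d s)
    (hs : ∀ i, (nbrs G.square (φ i)).card + s.getD i 0 ≤ m + 2)
    (hl : ∀ p ∈ l, G.square.Adj (φ p.1) (φ p.2))
    (hnl : ∀ p ∈ nl, φ p.1 ≠ φ p.2 ∧ ¬ G.square.Adj (φ p.1) (φ p.2)) :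
    HasATOrientation G.square m := by
  classical
  obtain ⟨hlt, hnd, hcov, hlen, hd, hco⟩ := hgood
  have hinj : Function.Injective φ := by
    intro i j hij
    by_contra hne
    rcases lt_or_gt_of_ne hne with h | h
    · rcases hcov _ _ h with h1 | h1
      · exact (hl _ h1).ne hij
      · exact (hnl _ h1).1 hij
    · rcases hcov _ _ h with h1 | h1
      · exact (hl _ h1).ne hij.symm
      · exact (hnl _ h1).1 hij.symm
  have hadj : ∀ i j, G.square.Adj (φ i) (φ j) ↔ (i, j) ∈ l ∨ (j, i) ∈ l := by
    intro i j
    constructor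
    · intro h
      rcases lt_trichotomy i j with h1 | h1 | h1
      · rcases hcov _ _ h1 with h2 | h2
        · exact Or.inl h2
        · exact absurd h (hnl _ h2).2
      · subst h1; exact absurd rfl h.ne
      · rcases hcov _ _ h1 with h2 | h2
        · exact Or.inr h2
        · exact absurd h.symm (hnl _ h2).2
    · rintro (h | h)
      · exact hl _ h
      · exact (hl _ h).symm
  have hinj2 : Function.Injective (Prod.map φ φ) := hinj.prodMap hinj
  have hmem : ∀ u v, (u, v) ∈ (l.map (Prod.map φ φ)).toFinset ↔
      ∃ i j, (i, j) ∈ l ∧ φ i = u ∧ φ j = v := by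
    intro u v
    simp
  refine hasATOrientation_of_coeff G hconn m (Finset.univ.image φ) (φ x) (φ y)
    (Finset.mem_image_of_mem _ (Finset.mem_univ _)) (Finset.mem_image_of_mem _ (Finset.mem_univ _))
    hxy (l.map (Prod.map φ φ)).toFinset ?_ ?_ ((listExp n d).mapDomain φ) ?_ hdeg ?_
  · intro u v
    rw [hmem, hmem]
    simp only [Finset.mem_image, Finset.mem_univ, true_and]
    constructor
    · rintro (⟨i, j, h, rfl, rfl⟩ | ⟨i, j, h, rfl, rfl⟩)
      · exact ⟨⟨i, rfl⟩, ⟨j, rfl⟩, hl _ h⟩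
      · exact ⟨⟨j, rfl⟩, ⟨i, rfl⟩, (hl _ h).symm⟩
    · rintro ⟨⟨i, rfl⟩, ⟨j, rfl⟩, h⟩
      rcases (hadj i j).1 h with h | h
      · exact Or.inl ⟨i, j, h, rfl, rfl⟩
      · exact Or.inr ⟨j, i, h, rfl, rfl⟩
  · intro u v h h'
    rw [hmem] at h h'
    obtain ⟨i, j, h, rfl, rfl⟩ := h
    obtain ⟨i', j', h', h1, h2⟩ := h'
    rw [hinj h1, hinj h2] at h'
    exact lt_asymm (hlt _ h) (hlt _ h')
  · rw [edgePoly_toFinset _ (hnd.map hinj2), listPoly_map, coeff_rename_mapDomain _ hinj,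
      coeff_listPoly _ _ hlen]
    exact hco
  · intro v hv
    obtain ⟨i, -, rfl⟩ := Finset.mem_image.1 hv
    rw [Finsupp.mapDomain_apply hinj, listExp_apply]
    have h1 : listDeg l i = (nbrs G.square (φ i) ∩ Finset.univ.image φ).card := by
      rw [listDeg, ← Finset.card_image_of_injective _ hinj]
      congr 1
      ext w
      simp only [Finset.mem_image, Finset.mem_filter, Finset.mem_univ, true_and, Finset.mem_inter,
        mem_nbrs]
      constructor
      · rintro ⟨j, hj, rfl⟩
        exact ⟨(hadj i j).2 hj, j, rfl⟩
      · rintro ⟨hj, j, rfl⟩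
        exact ⟨j, (hadj i j).1 hj, rfl⟩
    have := hs i
    have := hd i
    omega

/-- The list holding `e` if `b` is true, for patterns in which some edges may be present or not. -/
def optEdge {α : Type*} (b : Bool) (e : α) : List α := if b then [e] else []

@[simp] theorem mem_optEdge {α : Type*} (b : Bool) (e f : α) :
    f ∈ optEdge b e ↔ b = true ∧ f = e := by
  cases b <;> simp [optEdge]

/-! ### Lengthening a cycle by three vertices -/

theorem coeff_mul_X_pow_add_single {V : Type*} (A : MvPolynomial V ℤ) (p : V)
    (hA : A ∈ supported ℤ ({p}ᶜ : Set V)) (d : V →₀ ℕ) (hd : d p = 0) (i j : ℕ) :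
    coeff (d + Finsupp.single p i) (A * X p ^ j) = if i = j then coeff d A else 0 := by
  classical
  rw [X_pow_eq_monomial, coeff_mul_monomial']
  split_ifs with h1 h2 h2
  · subst h2
    simp
  · rw [mul_one]
    by_contra hne
    have hs : p ∈ A.vars := by
      rw [mem_vars_iff_mem_support]
      refine ⟨_, mem_support_iff.2 hne, ?_⟩
      have := h1 p
      simp only [Finsupp.single_eq_same, Finsupp.add_apply, hd] at this
      rw [Finsupp.mem_support_iff, Finsupp.tsub_apply]
      simp only [Finsupp.single_eq_same, Finsupp.add_apply, hd]
      omega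
    exact mem_supported.1 hA hs rfl
  · subst h2
    exact absurd (fun q => by simp) h1
  · rfl

/-- The coefficient of a polynomial at `X p ^ 2`, when it is given by powers of `X p`. -/
theorem coeff_quartic {V : Type*} (A0 A1 A2 A3 A4 : MvPolynomial V ℤ) (p : V)
    (h0 : A0 ∈ supported ℤ ({p}ᶜ : Set V)) (h1 : A1 ∈ supported ℤ ({p}ᶜ : Set V))
    (h2 : A2 ∈ supported ℤ ({p}ᶜ : Set V)) (h3 : A3 ∈ supported ℤ ({p}ᶜ : Set V))
    (h4 : A4 ∈ supported ℤ ({p}ᶜ : Set V)) (d : V →₀ ℕ) (hd : d p = 0) :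
    coeff (d + Finsupp.single p 2)
      (A0 * X p ^ 0 + A1 * X p ^ 1 + A2 * X p ^ 2 + A3 * X p ^ 3 + A4 * X p ^ 4) = coeff d A2 := by
  simp only [coeff_add, coeff_mul_X_pow_add_single, h0, h1, h2, h3, h4, hd]
  simp

/-- Inserting three consecutive vertices `p, q, r` with exponent `2` between `a, b` and `c, e` does
not change the coefficient. The vertices `a, b` precede the place of insertion in a cycle, `c, e`
follow it, and the factors are the edges of the square of the cycle that are affected. -/
theorem coeff_insert_three {V : Type*} (A : MvPolynomial V ℤ) (a b c e p q r : V)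
    (hA : ∀ z ∈ ({p, q, r} : Set V), A ∈ supported ℤ ({z}ᶜ : Set V))
    (h : ∀ z ∈ ({p, q, r} : Set V), a ≠ z ∧ b ≠ z ∧ c ≠ z ∧ e ≠ z)
    (hpq : p ≠ q) (hpr : p ≠ r) (hqr : q ≠ r) (d : V →₀ ℕ) (hp : d p = 0) (hq : d q = 0)
    (hr : d r = 0) :
    coeff (d + Finsupp.single r 2 + Finsupp.single q 2 + Finsupp.single p 2)
      (A * ((X a - X p) * (X b - X p) * (X b - X q) * (X p - X q) * (X p - X r) * (X q - X r) *
        (X q - X c) * (X r - X c) * (X r - X e))) =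
    coeff d (A * ((X a - X c) * (X b - X c) * (X b - X e))) := by
  have hX : ∀ z w : V, w ≠ z → (X w : MvPolynomial V ℤ) ∈ supported ℤ ({z}ᶜ : Set V) :=
    fun z w h => Algebra.subset_adjoin ⟨w, h, rfl⟩
  obtain ⟨ap, bp, cp, ep⟩ := h p (by simp)
  obtain ⟨aq, bq, cq, eq⟩ := h q (by simp)
  obtain ⟨ar, br, cr, er⟩ := h r (by simp)
  have hAp := hA p (by simp)
  have hAq := hA q (by simp)
  have hAr := hA r (by simp)
  have xap := hX _ _ ap
  have xbp := hX _ _ bp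
  have xcp := hX _ _ cp
  have xep := hX _ _ ep
  have xqp := hX _ _ hpq.symm
  have xrp := hX _ _ hpr.symm
  have xaq := hX _ _ aq
  have xbq := hX _ _ bq
  have xcq := hX _ _ cq
  have xeq := hX _ _ eq
  have xrq := hX _ _ hqr.symm
  have xar := hX _ _ ar
  have xbr := hX _ _ br
  have xcr := hX _ _ cr
  have xer := hX _ _ er
  -- Extract the coefficient of `X p ^ 2`, then of `X q ^ 2`, then of `X r ^ 2`.
  set B : MvPolynomial V ℤ := A * ((X b - X q) * (X q - X r) * (X q - X c) * (X r - X c) *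
    (X r - X e)) with hB
  have hBp : B ∈ supported ℤ ({p}ᶜ : Set V) := by
    rw [hB]
    exact mul_mem hAp (mul_mem (mul_mem (mul_mem (mul_mem (sub_mem xbp xqp) (sub_mem xqp xrp))
      (sub_mem xqp xcp)) (sub_mem xrp xcp)) (sub_mem xrp xep))
  have e1 : A * ((X a - X p) * (X b - X p) * (X b - X q) * (X p - X q) * (X p - X r) *
        (X q - X r) * (X q - X c) * (X r - X c) * (X r - X e)) =
      (B * (X a * X b * X q * X r)) * X p ^ 0 +
      (B * -(X a * X b * X q + X a * X b * X r + X a * X q * X r + X b * X q * X r)) * X p ^ 1 +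
      (B * (X a * X b + X a * X q + X a * X r + X b * X q + X b * X r + X q * X r)) * X p ^ 2 +
      (B * -(X a + X b + X q + X r)) * X p ^ 3 + B * X p ^ 4 := by
    rw [hB]; ring
  rw [e1, coeff_quartic _ _ _ _ _ p
    (mul_mem hBp (mul_mem (mul_mem (mul_mem xap xbp) xqp) xrp))
    (mul_mem hBp (neg_mem (add_mem (add_mem (add_mem (mul_mem (mul_mem xap xbp) xqp)
      (mul_mem (mul_mem xap xbp) xrp)) (mul_mem (mul_mem xap xqp) xrp))
      (mul_mem (mul_mem xbp xqp) xrp))))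
    (mul_mem hBp (add_mem (add_mem (add_mem (add_mem (add_mem (mul_mem xap xbp) (mul_mem xap xqp))
      (mul_mem xap xrp)) (mul_mem xbp xqp)) (mul_mem xbp xrp)) (mul_mem xqp xrp)))
    (mul_mem hBp (neg_mem (add_mem (add_mem (add_mem xap xbp) xqp) xrp))) hBp _
    (by simp [hp, hpq.symm, hpr.symm])]
  set C' : MvPolynomial V ℤ := A * ((X r - X c) * (X r - X e)) with hC
  have hCq : C' ∈ supported ℤ ({q}ᶜ : Set V) := by
    rw [hC]
    exact mul_mem hAq (mul_mem (sub_mem xrq xcq) (sub_mem xrq xeq))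
  have hu : (X a * X b + (X a + X b) * X r : MvPolynomial V ℤ) ∈ supported ℤ ({q}ᶜ : Set V) :=
    add_mem (mul_mem xaq xbq) (mul_mem (add_mem xaq xbq) xrq)
  have hw : (X a + X b + X r : MvPolynomial V ℤ) ∈ supported ℤ ({q}ᶜ : Set V) :=
    add_mem (add_mem xaq xbq) xrq
  have f1 : (X b + X r + X c : MvPolynomial V ℤ) ∈ supported ℤ ({q}ᶜ : Set V) :=
    add_mem (add_mem xbq xrq) xcq
  have f2 : (X b * X r + X b * X c + X r * X c : MvPolynomial V ℤ) ∈ supported ℤ ({q}ᶜ : Set V) :=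
    add_mem (add_mem (mul_mem xbq xrq) (mul_mem xbq xcq)) (mul_mem xrq xcq)
  have f3 : (X b * X r * X c : MvPolynomial V ℤ) ∈ supported ℤ ({q}ᶜ : Set V) :=
    mul_mem (mul_mem xbq xrq) xcq
  have e2 : B * (X a * X b + X a * X q + X a * X r + X b * X q + X b * X r + X q * X r) =
      (C' * ((X a * X b + (X a + X b) * X r) * (X b * X r * X c))) * X q ^ 0 +
      (C' * ((X a + X b + X r) * (X b * X r * X c) -
        (X a * X b + (X a + X b) * X r) * (X b * X r + X b * X c + X r * X c))) * X q ^ 1 +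
      (C' * ((X a * X b + (X a + X b) * X r) * (X b + X r + X c) -
        (X a + X b + X r) * (X b * X r + X b * X c + X r * X c))) * X q ^ 2 +
      (C' * ((X a + X b + X r) * (X b + X r + X c) - (X a * X b + (X a + X b) * X r))) * X q ^ 3 +
      (C' * -(X a + X b + X r)) * X q ^ 4 := by
    rw [hB, hC]; ring
  rw [e2, coeff_quartic _ _ _ _ _ q (mul_mem hCq (mul_mem hu f3))
    (mul_mem hCq (sub_mem (mul_mem hw f3) (mul_mem hu f2)))
    (mul_mem hCq (sub_mem (mul_mem hu f1) (mul_mem hw f2)))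
    (mul_mem hCq (sub_mem (mul_mem hw f1) hu)) (mul_mem hCq (neg_mem hw)) _
    (by simp [hq, hqr.symm])]
  have g0 : (X a - X c : MvPolynomial V ℤ) ∈ supported ℤ ({r}ᶜ : Set V) := sub_mem xar xcr
  have g1 : (X c * X e : MvPolynomial V ℤ) ∈ supported ℤ ({r}ᶜ : Set V) := mul_mem xcr xer
  have g2 : (X c + X e : MvPolynomial V ℤ) ∈ supported ℤ ({r}ᶜ : Set V) := add_mem xcr xer
  have g3 : A * (X a - X c) ∈ supported ℤ ({r}ᶜ : Set V) := mul_mem hAr g0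
  have e3 : C' * ((X a * X b + (X a + X b) * X r) * (X b + X r + X c) -
        (X a + X b + X r) * (X b * X r + X b * X c + X r * X c)) =
      (A * (X a - X c) * (X b ^ 2 * (X c * X e))) * X r ^ 0 +
      (A * (X a - X c) * (X b * (X c * X e) - X b ^ 2 * (X c + X e))) * X r ^ 1 +
      (A * ((X a - X c) * (X b - X c) * (X b - X e))) * X r ^ 2 +
      (A * (X a - X c) * (X b - (X c + X e))) * X r ^ 3 +
      (A * (X a - X c)) * X r ^ 4 := by
    rw [hC]; ring
  rw [e3, coeff_quartic _ _ _ _ _ r (mul_mem g3 (mul_mem (pow_mem xbr 2) g1))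
    (mul_mem g3 (sub_mem (mul_mem xbr g1) (mul_mem (pow_mem xbr 2) g2)))
    (mul_mem hAr (mul_mem (mul_mem g0 (sub_mem xbr xcr)) (sub_mem xbr xer)))
    (mul_mem g3 (sub_mem xbr g2)) g3 _ hr]

/-! ### Degrees in the square -/

theorem square_adj {V : Type*} {G : SimpleGraph V} {u v : V} :
    G.square.Adj u v ↔ u ≠ v ∧ (G.Adj u v ∨ ∃ w, G.Adj u w ∧ G.Adj w v) := Iff.rfl

theorem square_adj_of_adj {V : Type*} {G : SimpleGraph V} {u v : V} (h : G.Adj u v) :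
    G.square.Adj u v := ⟨h.ne, Or.inl h⟩

theorem square_adj_of_common {V : Type*} {G : SimpleGraph V} {u v : V} (w : V) (hne : u ≠ v)
    (h1 : G.Adj w u) (h2 : G.Adj w v) : G.square.Adj u v := ⟨hne, Or.inr ⟨w, h1.symm, h2⟩⟩

open Classical in
/-- The number of neighbours `u` of `v` with `w = u` or `w` adjacent to `u`, i.e. the number of
ways to reach `w` from `v` in at most two steps. -/
noncomputable def reach {V : Type*} [Fintype V] (G : SimpleGraph V) (v w : V) : ℕ :=
  ((nbrs G v).filter fun u => u = w ∨ G.Adj u w).card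

/-- Counting the walks of length two from `v`; a walk that returns to `v` stands for the step to its
middle vertex. -/
theorem sum_reach {V : Type*} [Fintype V] (G : SimpleGraph V) (v : V) :
    ∑ w ∈ nbrs G.square v, reach G v w = ∑ u ∈ nbrs G v, (nbrs G u).card := by
  classical
  have h := Finset.sum_card_bipartiteAbove_eq_sum_card_bipartiteBelow
    (s := nbrs G v) (t := nbrs G.square v) (fun u w => u = w ∨ G.Adj u w)
  have h1 : ∑ w ∈ nbrs G.square v, reach G v w = ∑ b ∈ nbrs G.square v,
      ((nbrs G v).bipartiteBelow (fun u w => u = w ∨ G.Adj u w) b).card := by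
    refine Finset.sum_congr rfl fun w _ => ?_
    rw [reach, Finset.bipartiteBelow]
  rw [h1, ← h]
  refine Finset.sum_congr rfl fun u hu => ?_
  rw [mem_nbrs] at hu
  have h2 : (nbrs G.square v).bipartiteAbove (fun u w => u = w ∨ G.Adj u w) u =
      insert u ((nbrs G u).erase v) := by
    ext w
    simp only [Finset.bipartiteAbove, Finset.mem_filter, mem_nbrs, Finset.mem_insert,
      Finset.mem_erase]
    constructor
    · rintro ⟨h1, h2 | h2⟩
      · exact Or.inl h2.symm
      · exact Or.inr ⟨h1.ne', h2⟩
    · rintro (rfl | ⟨h1, h2⟩)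
      · exact ⟨square_adj_of_adj hu, Or.inl rfl⟩
      · exact ⟨square_adj_of_common u h1.symm hu.symm h2, Or.inr h2⟩
  rw [h2, Finset.card_insert_of_notMem (by simp), Finset.card_erase_of_mem (by simpa using hu.symm)]
  have : 0 < (nbrs G u).card := Finset.card_pos.2 ⟨v, by simpa using hu.symm⟩
  omega

theorem one_le_reach {V : Type*} [Fintype V] {G : SimpleGraph V} {v w : V}
    (h : G.square.Adj v w) : 1 ≤ reach G v w := by
  classical
  rw [reach, Nat.one_le_iff_ne_zero, ← Nat.pos_iff_ne_zero, Finset.card_pos]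
  rcases h with ⟨-, h | ⟨u, h1, h2⟩⟩
  · exact ⟨w, by simp [h]⟩
  · exact ⟨u, by simp [h1, h2]⟩

theorem le_reach {V : Type*} [Fintype V] {G : SimpleGraph V} {v w : V} (s : Finset V)
    (hs : ∀ u ∈ s, G.Adj v u ∧ (u = w ∨ G.Adj u w)) : s.card ≤ reach G v w := by
  classical
  refine Finset.card_le_card fun u hu => ?_
  rw [Finset.mem_filter, mem_nbrs]
  exact hs u hu

/-- Every vertex of `T` that is reached from `v` in several ways reduces the degree of `v` in the
square. -/
theorem card_nbrs_square_add {V : Type*} [Fintype V] (G : SimpleGraph V) (v : V) (T : Finset V)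
    (hT : T ⊆ nbrs G.square v) :
    (nbrs G.square v).card + ∑ w ∈ T, (reach G v w - 1) ≤ ∑ u ∈ nbrs G v, (nbrs G u).card := by
  classical
  have h1 : ∑ w ∈ T, (reach G v w - 1) ≤ ∑ w ∈ nbrs G.square v, (reach G v w - 1) :=
    Finset.sum_le_sum_of_subset hT
  have h2 : (nbrs G.square v).card + ∑ w ∈ nbrs G.square v, (reach G v w - 1) =
      ∑ w ∈ nbrs G.square v, reach G v w := by
    rw [Finset.card_eq_sum_ones, ← Finset.sum_add_distrib]
    refine Finset.sum_congr rfl fun w hw => ?_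
    have := one_le_reach (mem_nbrs.1 hw)
    omega
  rw [← sum_reach]
  omega

theorem sum_card_nbrs_le {V : Type*} [Fintype V] (G : SimpleGraph V) (Δ : ℕ)
    (hmax : ∀ v, (nbrs G v).card ≤ Δ) (v : V) :
    ∑ u ∈ nbrs G v, (nbrs G u).card ≤ (nbrs G v).card * Δ := by
  rw [← smul_eq_mul]
  exact Finset.sum_le_card_nsmul _ _ _ fun u _ => hmax u

theorem card_nbrs_square_le {V : Type*} [Fintype V] (G : SimpleGraph V) (Δ : ℕ)
    (hmax : ∀ v, (nbrs G v).card ≤ Δ) (v : V) : (nbrs G.square v).card ≤ Δ ^ 2 := by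
  have h1 := card_nbrs_square_add G v ∅ (Finset.empty_subset _)
  have h2 := sum_card_nbrs_le G Δ hmax v
  have h3 := Nat.mul_le_mul_right Δ (hmax v)
  rw [Finset.sum_empty] at h1
  nlinarith

theorem card_nbrs_square_add_le {V : Type*} [Fintype V] (G : SimpleGraph V) (Δ : ℕ)
    (hmax : ∀ v, (nbrs G v).card ≤ Δ) (v : V) (T : Finset V) (hT : T ⊆ nbrs G.square v) :
    (nbrs G.square v).card + ∑ w ∈ T, (reach G v w - 1) ≤ Δ ^ 2 := by
  have h1 := card_nbrs_square_add G v T hT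
  have h2 := sum_card_nbrs_le G Δ hmax v
  have h3 := Nat.mul_le_mul_right Δ (hmax v)
  nlinarith

theorem card_add_card_le_of_two_le_reach {V : Type*} [Fintype V] (G : SimpleGraph V) (Δ : ℕ)
    (hmax : ∀ v, (nbrs G v).card ≤ Δ) (v : V) (T : Finset V) (hT : T ⊆ nbrs G.square v)
    (h2 : ∀ w ∈ T, 2 ≤ reach G v w) : (nbrs G.square v).card + T.card ≤ Δ ^ 2 := by
  have h1 := card_nbrs_square_add_le G Δ hmax v T hT
  have h3 : T.card ≤ ∑ w ∈ T, (reach G v w - 1) := by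
    rw [Finset.card_eq_sum_ones]
    exact Finset.sum_le_sum fun w hw => by have := h2 w hw; omega
  omega

/-! ### Vertices of small degree in the square -/

/-- The standing assumptions: a connected graph of maximum degree at most `Δ` whose square has no
orientation as desired. The number `m` is `Δ ^ 2 - 2`. -/
structure Bad {V : Type*} [Fintype V] (G : SimpleGraph V) (Δ m : ℕ) : Prop where
  conn : G.Connected
  le_max : ∀ v, (nbrs G v).card ≤ Δ
  three_le : 3 ≤ Δ
  hm : m + 2 = Δ ^ 2
  not_has : ¬ HasATOrientation G.square m

theorem Bad.sq_le {V : Type*} [Fintype V] {G : SimpleGraph V} {Δ m : ℕ} (h : Bad G Δ m) (v : V) :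
    (nbrs G.square v).card ≤ m + 2 := h.hm ▸ card_nbrs_square_le G Δ h.le_max v

/-- A good pattern inside the square contradicts `Bad`. -/
theorem Bad.pattern {V : Type*} [Fintype V] {G : SimpleGraph V} {Δ m : ℕ} (h : Bad G Δ m) {n : ℕ}
    (φ : Fin n → V) (x y : Fin n) (hxy : G.Adj (φ x) (φ y)) (l nl : List (Fin n × Fin n))
    (d s : List ℕ) (hgood : IsGoodPattern l nl d s)
    (hs : ∀ i, (nbrs G.square (φ i)).card + s.getD i 0 ≤ m + 2)
    (hl : ∀ p ∈ l, G.square.Adj (φ p.1) (φ p.2))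
    (hnl : ∀ p ∈ nl, φ p.1 ≠ φ p.2 ∧ ¬ G.square.Adj (φ p.1) (φ p.2)) : False :=
  h.not_has (hasATOrientation_of_pattern G h.conn m h.sq_le φ x y hxy l nl d s hgood hs hl hnl)

/-- The case of an edge: its ends cannot both have slack, one of them at least two. -/
theorem Bad.pair {V : Type*} [Fintype V] {G : SimpleGraph V} {Δ m : ℕ} (h : Bad G Δ m) (u v : V)
    (huv : G.Adj u v) (hu : (nbrs G.square u).card + 2 ≤ m + 2)
    (hv : (nbrs G.square v).card + 1 ≤ m + 2) : False := by
  refine h.pattern (n := 2) ![u, v] 0 1 huv [(0, 1)] [] [1, 0] [2, 1] (by decide) ?_ ?_ ?_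
  · intro i
    fin_cases i
    · exact hu
    · exact hv
  · simpa using square_adj_of_adj huv
  · simp

theorem Bad.exists_adj {V : Type*} [Fintype V] {G : SimpleGraph V} {Δ m : ℕ} (h : Bad G Δ m)
    (v u : V) (hu : u ≠ v) : ∃ w, G.Adj v w := by
  obtain ⟨p⟩ := h.conn.preconnected v u
  cases p with
  | nil => exact absurd rfl hu
  | cons hvw _ => exact ⟨_, hvw⟩

/-- If the maximum degree is attained somewhere, the graph is regular. -/
theorem Bad.regular {V : Type*} [Fintype V] {G : SimpleGraph V} {Δ m : ℕ} (h : Bad G Δ m)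
    (x : V) (hx : (nbrs G x).card = Δ) (v : V) : (nbrs G v).card = Δ := by
  by_contra hv
  have hlt : (nbrs G v).card < Δ := lt_of_le_of_ne (h.le_max v) hv
  have hvx : x ≠ v := fun h' => hv (h' ▸ hx)
  obtain ⟨u, huv⟩ := h.exists_adj v x hvx
  have h3 := h.three_le
  have hm := h.hm
  refine h.pair v u huv ?_ ?_
  · have h1 := card_nbrs_square_add G v ∅ (Finset.empty_subset _)
    have h2 := sum_card_nbrs_le G Δ h.le_max v
    rw [Finset.sum_empty] at h1
    nlinarith
  · have h1 := card_nbrs_square_add G u ∅ (Finset.empty_subset _)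
    rw [Finset.sum_empty] at h1
    have h2 : ∑ w ∈ nbrs G u, (nbrs G w).card < ∑ _w ∈ nbrs G u, Δ :=
      Finset.sum_lt_sum (fun w _ => h.le_max w) ⟨v, by simpa using huv.symm, hlt⟩
    rw [Finset.sum_const, smul_eq_mul] at h2
    have := Nat.mul_le_mul_right Δ (h.le_max u)
    nlinarith

theorem Bad.triangle_sq_le {V : Type*} [Fintype V] {G : SimpleGraph V} {Δ m : ℕ} (h : Bad G Δ m)
    {a b c : V} (hab : G.Adj a b) (hbc : G.Adj b c) (hac : G.Adj a c) :
    (nbrs G.square a).card + 2 ≤ m + 2 := by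
  classical
  rw [h.hm]
  refine (Nat.add_le_add_left (Finset.card_pair hbc.ne).ge _).trans ?_
  refine card_add_card_le_of_two_le_reach G Δ h.le_max a _ ?_ ?_
  · intro w hw
    rw [Finset.mem_insert, Finset.mem_singleton] at hw
    rw [mem_nbrs]
    rcases hw with rfl | rfl
    · exact square_adj_of_adj hab
    · exact square_adj_of_adj hac
  · intro w hw
    rw [Finset.mem_insert, Finset.mem_singleton] at hw
    rw [← Finset.card_pair hbc.ne]
    refine le_reach _ fun u hu => ?_
    rw [Finset.mem_insert, Finset.mem_singleton] at hu
    rcases hw with rfl | rfl <;> rcases hu with rfl | rfl <;> simp [*, hbc.symm]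

theorem Bad.triangle_free {V : Type*} [Fintype V] {G : SimpleGraph V} {Δ m : ℕ} (h : Bad G Δ m)
    {a b c : V} (hab : G.Adj a b) (hbc : G.Adj b c) : ¬ G.Adj a c := by
  intro hac
  refine h.pair a b hab (h.triangle_sq_le hab hbc hac) ?_
  have := h.triangle_sq_le hab.symm hac hbc
  omega

/-- Two vertices on a common 4-cycle are not full in the square. -/
theorem Bad.square_sq_le {V : Type*} [Fintype V] {G : SimpleGraph V} {Δ m : ℕ} (h : Bad G Δ m)
    {a b c d : V} (hab : G.Adj a b) (hbc : G.Adj b c) (hcd : G.Adj c d) (hda : G.Adj d a)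
    (hac : a ≠ c) (hbd : b ≠ d) : (nbrs G.square a).card + 1 ≤ m + 2 := by
  classical
  rw [h.hm, ← Finset.card_singleton c]
  refine card_add_card_le_of_two_le_reach G Δ h.le_max a _ ?_ ?_
  · simpa using square_adj_of_common b hac hab.symm hbc
  · intro w hw
    rw [Finset.mem_singleton] at hw
    subst hw
    rw [← Finset.card_pair hbd]
    refine le_reach _ fun u hu => ?_
    rw [Finset.mem_insert, Finset.mem_singleton] at hu
    rcases hu with rfl | rfl
    · exact ⟨hab, Or.inr hbc⟩
    · exact ⟨hda.symm, Or.inr hcd.symm⟩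

/-- Every vertex lies on at most one 4-cycle. -/
theorem Bad.square_unique {V : Type*} [Fintype V] {G : SimpleGraph V} {Δ m : ℕ} (h : Bad G Δ m)
    {a b c d b' c' d' : V} (hab : G.Adj a b) (hbc : G.Adj b c) (hcd : G.Adj c d) (hda : G.Adj d a)
    (hac : a ≠ c) (hbd : b ≠ d) (hab' : G.Adj a b') (hbc' : G.Adj b' c') (hcd' : G.Adj c' d')
    (hda' : G.Adj d' a) (hac' : a ≠ c') (hbd' : b' ≠ d') : c' = c ∧ (b' = b ∨ b' = d) := by
  classical
  have hb1 := h.square_sq_le hab.symm hda.symm hcd.symm hbc.symm hbd hac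
  by_cases hcc : c' = c
  · refine ⟨hcc, ?_⟩
    by_contra hne
    push Not at hne
    subst hcc
    refine h.pair a b hab ?_ hb1
    rw [h.hm]
    have h1 := card_nbrs_square_add_le G Δ h.le_max a {c'}
      (by simpa using square_adj_of_common b hac hab.symm hbc)
    have h2 : ({b, d, b'} : Finset V).card ≤ reach G a c' := by
      refine le_reach _ fun u hu => ?_
      simp only [Finset.mem_insert, Finset.mem_singleton] at hu
      rcases hu with rfl | rfl | rfl
      · exact ⟨hab, Or.inr hbc⟩
      · exact ⟨hda.symm, Or.inr hcd.symm⟩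
      · exact ⟨hab', Or.inr hbc'⟩
    rw [Finset.card_eq_three.2 ⟨b, d, b', hbd, hne.1.symm, hne.2.symm, rfl⟩] at h2
    rw [Finset.sum_singleton] at h1
    omega
  · exfalso
    refine h.pair a b hab ?_ hb1
    rw [h.hm]
    refine (Nat.add_le_add_left (Finset.card_pair hcc).ge _).trans ?_
    refine card_add_card_le_of_two_le_reach G Δ h.le_max a _ ?_ ?_
    · intro w hw
      rw [Finset.mem_insert, Finset.mem_singleton] at hw
      rw [mem_nbrs]
      rcases hw with rfl | rfl
      · exact square_adj_of_common b' hac' hab'.symm hbc'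
      · exact square_adj_of_common b hac hab.symm hbc
    · intro w hw
      rw [Finset.mem_insert, Finset.mem_singleton] at hw
      rcases hw with rfl | rfl
      · rw [← Finset.card_pair hbd']
        refine le_reach _ fun u hu => ?_
        rw [Finset.mem_insert, Finset.mem_singleton] at hu
        rcases hu with rfl | rfl
        · exact ⟨hab', Or.inr hbc'⟩
        · exact ⟨hda'.symm, Or.inr hcd'.symm⟩
      · rw [← Finset.card_pair hbd]
        refine le_reach _ fun u hu => ?_
        rw [Finset.mem_insert, Finset.mem_singleton] at hu
        rcases hu with rfl | rfl
        · exact ⟨hab, Or.inr hbc⟩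
        · exact ⟨hda.symm, Or.inr hcd.symm⟩

/-! ### Graphs with a 4-cycle -/

theorem forall_mem_optEdge {α : Type*} {P : α → Prop} (b : Bool) (e : α) :
    (∀ f ∈ optEdge b e, P f) ↔ (b = true → P e) := by
  cases b <;> simp [optEdge]

/-- If some vertex has distance at least three from `a`, then one has distance exactly three. -/
theorem exists_path_three {V : Type*} {G : SimpleGraph V} (hconn : G.Connected) (a v : V)
    (hne : a ≠ v) (hv : ¬ G.square.Adj a v) :
    ∃ x y z, G.Adj a x ∧ G.Adj x y ∧ G.Adj y z ∧ a ≠ y ∧ ¬ G.Adj a y ∧ a ≠ z ∧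
      ¬ G.square.Adj a z := by
  by_contra hcon
  push Not at hcon
  have key : ∀ y z, G.Adj y z → (a = y ∨ G.square.Adj a y) → (a = z ∨ G.square.Adj a z) := by
    intro y z hyz hy
    by_contra hz
    push Not at hz
    have hay : ¬ G.Adj a y := fun h => hz.2 (square_adj_of_common y hz.1 h.symm hyz)
    rcases hy with rfl | hy
    · exact hz.2 (square_adj_of_adj hyz)
    · rcases hy.2 with h | ⟨x, h1, h2⟩
      · exact hay h
      · exact hz.2 (hcon x y z h1 h2 hyz hy.1 hay hz.1)
  have h2 : ∀ u w, G.Walk u w → (a = u ∨ G.square.Adj a u) → (a = w ∨ G.square.Adj a w) := by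
    intro u w p
    induction p with
    | nil => exact id
    | cons h _ ih => exact fun hu => ih (key _ _ h hu)
  obtain ⟨p⟩ := hconn.preconnected a v
  rcases h2 _ _ p (Or.inl rfl) with h | h
  · exact hne h
  · exact hv h

section
variable {V : Type*} [Fintype V] {G : SimpleGraph V} {Δ m : ℕ} {a b c d : V}

/-- In the square, a neighbour of a 4-cycle is adjacent to the whole cycle. -/
theorem Bad.adj_opposite (h : Bad G Δ m) (hab : G.Adj a b) (hbc : G.Adj b c) (hcd : G.Adj c d)
    (hda : G.Adj d a) (hac : a ≠ c) (hbd : b ≠ d) {x : V} (hx : G.Adj a x) (hxb : x ≠ b)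
    (hxd : x ≠ d) : G.square.Adj c x := by
  by_contra hcx
  have hac' : ¬ G.Adj a c := h.triangle_free hab hbc
  have hxc : c ≠ x := fun h' => hac' (h' ▸ hx)
  refine h.pattern (n := 5) ![a, b, d, c, x] 0 1 hab
    [(0, 1), (0, 2), (0, 3), (0, 4), (1, 2), (1, 3), (1, 4), (2, 3), (2, 4)] [(3, 4)]
    [3, 2, 1, 2, 1] [1, 1, 1, 1, 0] (by decide +kernel) ?_ ?_ ?_
  · intro i
    fin_cases i
    · exact h.square_sq_le hab hbc hcd hda hac hbd
    · exact h.square_sq_le hbc hcd hda hab hbd hac.symm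
    · exact h.square_sq_le hda hab hbc hcd hbd.symm hac
    · exact h.square_sq_le hcd hda hab hbc hac.symm hbd.symm
    · exact h.sq_le x
  · simp only [List.forall_mem_cons]
    exact ⟨square_adj_of_adj hab, square_adj_of_adj hda.symm, square_adj_of_common b hac hab.symm hbc,
      square_adj_of_adj hx, square_adj_of_common a hbd hab hda.symm, square_adj_of_adj hbc,
      square_adj_of_common a hxb.symm hab hx, square_adj_of_adj hcd.symm,
      square_adj_of_common a hxd.symm hda.symm hx, by simp⟩
  · simp only [List.forall_mem_cons]
    exact ⟨⟨hxc, hcx⟩, by simp⟩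

/-- The vertices are `a, b, c, d, x, y, z`, where `a b c d` is a 4-cycle, `x` and `y` are neighbours of
`a` and `c`, and `z` is a neighbour of `x`. It is open which of `b`, `c`, `d` are adjacent to `z`. -/
theorem isGoodPattern_square_path (m1 m2 m3 : Bool) (hm : (m1 && m2 && m3) = false) :
    IsGoodPattern (n := 7) ([(0, 6), (4, 6), (5, 6)] ++ optEdge m1 (1, 6) ++ optEdge m2 (2, 6) ++
      optEdge m3 (3, 6) ++ [(0, 1), (0, 2), (0, 3), (0, 4), (0, 5), (1, 2), (1, 3), (1, 4), (1, 5),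
        (2, 3), (2, 4), (2, 5), (3, 4), (3, 5), (4, 5)])
      (optEdge (!m1) (1, 6) ++ optEdge (!m2) (2, 6) ++ optEdge (!m3) (3, 6))
      (match m1, m2, m3 with
        | false, false, false => [5, 4, 3, 2, 2, 1, 1]
        | true, false, false => [5, 4, 3, 2, 2, 1, 2]
        | false, true, false => [5, 4, 3, 2, 2, 1, 2]
        | false, false, true => [5, 4, 3, 3, 2, 0, 2]
        | true, true, false => [5, 4, 3, 2, 2, 1, 3]
        | true, false, true => [5, 4, 3, 3, 2, 0, 3]
        | _, _, _ => [5, 4, 4, 3, 1, 0, 3]) [1, 1, 1, 1, 0, 0, 0] := by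
  revert m1 m2 m3
  decide +kernel

/-- In the square, a vertex at distance two from a 4-cycle is adjacent to the whole cycle. -/
theorem Bad.adj_of_path (h : Bad G Δ m) (hab : G.Adj a b) (hbc : G.Adj b c) (hcd : G.Adj c d)
    (hda : G.Adj d a) (hac : a ≠ c) (hbd : b ≠ d) {x : V} (hx : G.Adj a x) (hxb : x ≠ b)
    (hxd : x ≠ d) {z : V} (hz : G.Adj x z) (hza : a ≠ z) :
    G.square.Adj b z ∧ G.square.Adj c z ∧ G.square.Adj d z := by
  classical
  have hxc' : ¬ G.Adj x c := by
    intro hxc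
    rcases (h.square_unique hab hbc hcd hda hac hbd hx hxc hbc.symm hab.symm hac hxb).2 with h1 | h1
    · exact hxb h1
    · exact hxd h1
  have hac' : ¬ G.Adj a c := h.triangle_free hab hbc
  have hxc : x ≠ c := fun h' => hac' (h' ▸ hx)
  have hzb : b ≠ z := fun h' => h.triangle_free hx hz (h' ▸ hab)
  have hzd : d ≠ z := fun h' => h.triangle_free hx hz (h' ▸ hda.symm)
  have hzc : c ≠ z := fun h' => hxc' (h' ▸ hz)
  have hcx := h.adj_opposite hab hbc hcd hda hac hbd hx hxb hxd
  obtain ⟨y, hcy, hyx⟩ : ∃ y, G.Adj c y ∧ G.Adj y x := by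
    rcases hcx.2 with h1 | h1
    · exact absurd h1.symm hxc'
    · exact h1
  have hyb : y ≠ b := fun h' => h.triangle_free hx hyx.symm (h' ▸ hab)
  have hyd : y ≠ d := fun h' => h.triangle_free hx hyx.symm (h' ▸ hda.symm)
  have hay := h.adj_opposite hcd hda hab hbc hac.symm hbd.symm hcy hyd hyb
  by_cases hyz : y = z
  · subst hyz
    exact ⟨square_adj_of_common c hyb.symm hbc.symm hcy, square_adj_of_adj hcy,
      square_adj_of_common c hyd.symm hcd hcy⟩
  by_contra hcon
  refine h.pattern (n := 7) ![a, b, c, d, x, y, z] 0 1 hab _ _ _ _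
    (isGoodPattern_square_path (decide (G.square.Adj b z)) (decide (G.square.Adj c z))
      (decide (G.square.Adj d z)) ?_) ?_ ?_ ?_
  · simpa [and_assoc] using hcon
  · intro i
    fin_cases i
    · exact h.square_sq_le hab hbc hcd hda hac hbd
    · exact h.square_sq_le hbc hcd hda hab hbd hac.symm
    · exact h.square_sq_le hcd hda hab hbc hac.symm hbd.symm
    · exact h.square_sq_le hda hab hbc hcd hbd.symm hac
    · exact h.sq_le x
    · exact h.sq_le y
    · exact h.sq_le z
  · simp only [List.forall_mem_append, List.forall_mem_cons, forall_mem_optEdge, decide_eq_true_eq]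
    exact ⟨⟨⟨⟨⟨square_adj_of_common x hza hx.symm hz, square_adj_of_adj hz,
      square_adj_of_common x hyz hyx.symm hz, by simp⟩, id⟩, id⟩, id⟩,
      square_adj_of_adj hab, square_adj_of_common b hac hab.symm hbc, square_adj_of_adj hda.symm,
      square_adj_of_adj hx, hay, square_adj_of_adj hbc, square_adj_of_common a hbd hab hda.symm,
      square_adj_of_common a hxb.symm hab hx, square_adj_of_common c hyb.symm hbc.symm hcy,
      square_adj_of_adj hcd, hcx, square_adj_of_adj hcy,
      square_adj_of_common a hxd.symm hda.symm hx, square_adj_of_common c hyd.symm hcd hcy,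
      square_adj_of_adj hyx.symm, by simp⟩
  · simp only [List.forall_mem_append, forall_mem_optEdge, Bool.not_eq_true', decide_eq_false_iff_not]
    exact ⟨⟨fun h1 => ⟨hzb, h1⟩, fun h1 => ⟨hzc, h1⟩⟩, fun h1 => ⟨hzd, h1⟩⟩

/-- Two vertices that are adjacent to a whole 4-cycle in the square are adjacent in the square. -/
theorem Bad.adj_of_full (h : Bad G Δ m) (hab : G.Adj a b) (hbc : G.Adj b c) (hcd : G.Adj c d)
    (hda : G.Adj d a) (hac : a ≠ c) (hbd : b ≠ d) {x y : V}
    (hx : ∀ v ∈ [a, b, c, d], G.square.Adj v x) (hy : ∀ v ∈ [a, b, c, d], G.square.Adj v y)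
    (hxy : x ≠ y) : G.square.Adj x y := by
  by_contra hcon
  simp only [List.forall_mem_cons] at hx hy
  refine h.pattern (n := 6) ![a, b, c, d, x, y] 0 1 hab
    [(0, 1), (0, 2), (0, 3), (0, 4), (0, 5), (1, 2), (1, 3), (1, 4), (1, 5), (2, 3), (2, 4), (2, 5),
      (3, 4), (3, 5)] [(4, 5)] [4, 3, 2, 1, 2, 2] [1, 1, 1, 1, 0, 0] (by decide +kernel) ?_ ?_ ?_
  · intro i
    fin_cases i
    · exact h.square_sq_le hab hbc hcd hda hac hbd
    · exact h.square_sq_le hbc hcd hda hab hbd hac.symm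
    · exact h.square_sq_le hcd hda hab hbc hac.symm hbd.symm
    · exact h.square_sq_le hda hab hbc hcd hbd.symm hac
    · exact h.sq_le x
    · exact h.sq_le y
  · simp only [List.forall_mem_cons]
    exact ⟨square_adj_of_adj hab, square_adj_of_common b hac hab.symm hbc, square_adj_of_adj hda.symm,
      hx.1, hy.1, square_adj_of_adj hbc, square_adj_of_common a hbd hab hda.symm, hx.2.1, hy.2.1,
      square_adj_of_adj hcd, hx.2.2.1, hy.2.2.1, hx.2.2.2.1, hy.2.2.2.1, by simp⟩
  · simp only [List.forall_mem_cons]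
    exact ⟨⟨hxy, hcon⟩, by simp⟩

/-- In the square, a vertex of a 4-cycle is adjacent to all other vertices. -/
theorem Bad.universal_of_square (h : Bad G Δ m) (hreg : ∀ v, (nbrs G v).card = Δ)
    (hab : G.Adj a b) (hbc : G.Adj b c) (hcd : G.Adj c d)
    (hda : G.Adj d a) (hac : a ≠ c) (hbd : b ≠ d) (v : V) (hv : a ≠ v) : G.square.Adj a v := by
  classical
  by_contra hcon
  obtain ⟨x, y, z, hax, hxy, hyz, hay, hay', haz, hz⟩ := exists_path_three h.conn a v hv hcon
  have sab := square_adj_of_adj hab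
  have sac := square_adj_of_common b hac hab.symm hbc
  have sad := square_adj_of_adj hda.symm
  have hzC : z ≠ b ∧ z ≠ c ∧ z ≠ d := by
    refine ⟨?_, ?_, ?_⟩ <;> rintro rfl <;> contradiction
  -- No vertex of the cycle is adjacent to `y`, as it would lead to `z` in two steps.
  have hyc : y ≠ c := by
    rintro rfl
    exact hz (h.adj_opposite hcd hda hab hbc hac.symm hbd.symm hyz hzC.2.2 hzC.1)
  have hyb : y ≠ b := fun h' => hay' (h' ▸ hab)
  have hyd : y ≠ d := fun h' => hay' (h' ▸ hda.symm)
  have hby : ¬ G.Adj b y := fun h' =>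
    hz (h.adj_of_path hbc hcd hda hab hbd hac.symm h' hyc hay.symm hyz hzC.1.symm).2.2
  have hcy : ¬ G.Adj c y := fun h' =>
    hz (h.adj_of_path hcd hda hab hbc hac.symm hbd.symm h' hyd hyb hyz hzC.2.1.symm).2.1
  have hdy : ¬ G.Adj d y := fun h' =>
    hz (h.adj_of_path hda hab hbc hcd hbd.symm hac h' hay.symm hyc hyz hzC.2.2.symm).1
  have hxb : x ≠ b := by rintro rfl; exact hby hxy
  have hxd : x ≠ d := by rintro rfl; exact hdy hxy
  have hyfull := h.adj_of_path hab hbc hcd hda hac hbd hax hxb hxd hxy hay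
  -- Otherwise the neighbours of `a` other than `x` would be joined to `y` through distinct
  -- neighbours of `y` other than `x` and `z`, of which there are too few.
  obtain ⟨w, haw, hwx, hwy⟩ : ∃ w, G.Adj a w ∧ w ≠ x ∧ ¬ G.square.Adj w y := by
    by_contra hall
    push Not at hall
    have hmid : ∀ w ∈ (nbrs G a).erase x, ∃ t, G.Adj w t ∧ G.Adj t y := by
      intro w hw
      rw [Finset.mem_erase, mem_nbrs] at hw
      rcases (hall w hw.2 hw.1).2 with h1 | h1
      · exact absurd (h.square_unique hab hbc hcd hda hac hbd hax hxy h1.symm hw.2.symm hay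
          hw.1.symm).1 hyc
      · exact h1
    choose! f hf1 hf2 using hmid
    have hcard : ((nbrs G a).erase x).card ≤ (((nbrs G y).erase z).erase x).card := by
      refine Finset.card_le_card_of_injOn f (fun w hw => ?_) (fun w hw w' hw' hww => ?_)
      · have h1 := hf1 w hw
        have h2 := hf2 w hw
        rw [Finset.mem_coe, Finset.mem_erase, mem_nbrs] at hw
        rw [Finset.mem_coe, Finset.mem_erase, Finset.mem_erase, mem_nbrs]
        refine ⟨?_, ?_, h2.symm⟩
        · intro h3
          rw [h3] at h1
          exact h.triangle_free hw.2 h1 hax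
        · intro h3
          rw [h3] at h1
          exact hz (square_adj_of_common w haz hw.2.symm h1)
      · by_contra hne
        have h1 := hf1 w hw
        have h1' := hf1 w' hw'
        have h2 := hf2 w hw
        rw [Finset.mem_coe, Finset.mem_erase, mem_nbrs] at hw hw'
        have hfa : a ≠ f w := fun h3 => hay' (h3 ▸ h2)
        have := (h.square_unique hab hbc hcd hda hac hbd hw.2 h1 (hww ▸ h1'.symm) hw'.2.symm hfa
          hne).1
        exact hcy (this ▸ h2)
    have hxz : x ≠ z := by
      rintro rfl
      exact hz (square_adj_of_adj hax)
    rw [Finset.card_erase_of_mem (by simpa using hax), Finset.card_erase_of_mem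
      (by simpa [hxz] using hxy.symm), Finset.card_erase_of_mem (by simpa using hyz), hreg,
      hreg] at hcard
    have := h.three_le
    omega
  have say : G.square.Adj a y := square_adj_of_common x hay hax.symm hxy
  have hwb : w ≠ b := by rintro rfl; exact hwy hyfull.1
  have hwd : w ≠ d := by rintro rfl; exact hwy hyfull.2.2
  refine hwy (h.adj_of_full hab hbc hcd hda hac hbd ?_ ?_ ?_)
  · simp only [List.forall_mem_cons]
    exact ⟨square_adj_of_adj haw, square_adj_of_common a hwb.symm hab haw,
      h.adj_opposite hab hbc hcd hda hac hbd haw hwb hwd,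
      square_adj_of_common a hwd.symm hda.symm haw, by simp⟩
  · simp only [List.forall_mem_cons]
    exact ⟨say, hyfull.1, hyfull.2.1, hyfull.2.2, by simp⟩
  · rintro rfl
    exact hay' haw

theorem card_nbrs_lt (S : SimpleGraph V) (v : V) : (nbrs S v).card < Fintype.card V := by
  rw [← Finset.card_univ]
  exact Finset.card_lt_card (Finset.ssubset_univ_iff.2 fun h => S.loopless.irrefl v
    (by rw [← mem_nbrs, h]; exact Finset.mem_univ v))

theorem card_nbrs_of_universal (S : SimpleGraph V) (v : V) (hv : ∀ w, v ≠ w → S.Adj v w) :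
    (nbrs S v).card + 1 = Fintype.card V := by
  classical
  have : nbrs S v = Finset.univ.erase v := by
    ext w
    rw [mem_nbrs, Finset.mem_erase]
    exact ⟨fun h => ⟨h.ne', Finset.mem_univ _⟩, fun h => hv w h.1.symm⟩
  rw [this, Finset.card_erase_of_mem (Finset.mem_univ _), Finset.card_univ]
  have := Fintype.card_pos_iff.2 ⟨v⟩
  omega

/-- If there is a 4-cycle, the square is complete on `Δ ^ 2` vertices. More vertices are impossible as
vertices of the 4-cycle have slack; with fewer, or with a missing edge, there is too much slack. -/
theorem Bad.eq_top_of_square (h : Bad G Δ m) (hreg : ∀ v, (nbrs G v).card = Δ)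
    (hab : G.Adj a b) (hbc : G.Adj b c) (hcd : G.Adj c d) (hda : G.Adj d a) (hac : a ≠ c)
    (hbd : b ≠ d) : Fintype.card V = Δ ^ 2 ∧ ∀ u v, u ≠ v → G.square.Adj u v := by
  classical
  have h1 := card_nbrs_of_universal G.square a
    (h.universal_of_square hreg hab hbc hcd hda hac hbd)
  have h2 := h.square_sq_le hab hbc hcd hda hac hbd
  have hm := h.hm
  have h3 : Fintype.card V = Δ ^ 2 := by
    by_contra hne
    have ha := card_nbrs_lt G.square a
    have hb := card_nbrs_lt G.square b
    exact h.pair a b hab (by omega) (by omega)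
  refine ⟨h3, fun u v huv => ?_⟩
  by_contra hcon
  obtain ⟨w, hw⟩ := h.exists_adj u v huv.symm
  have h4 : (nbrs G.square u).card + 2 ≤ Fintype.card V := by
    have hsub : nbrs G.square u ⊆ Finset.univ \ {u, v} := by
      intro t ht
      rw [mem_nbrs] at ht
      simp only [Finset.mem_sdiff, Finset.mem_univ, true_and, Finset.mem_insert,
        Finset.mem_singleton]
      rintro (rfl | rfl)
      · exact ht.ne rfl
      · exact hcon ht
    have := Finset.card_le_card hsub
    rw [Finset.card_sdiff_of_subset (Finset.subset_univ _), Finset.card_pair huv,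
      Finset.card_univ] at this
    have h5 : ({u, v} : Finset V).card ≤ Fintype.card V := Finset.card_le_univ _
    rw [Finset.card_pair huv] at h5
    omega
  have h5 := card_nbrs_lt G.square w
  exact h.pair u w hw (by omega) (by omega)

end

/-! ### Graphs of girth five -/

/-- The vertices are `a, b, c, d, e, x, y`, where `a b c d e` is a 5-cycle, and `x` and `y` are
neighbours of `a` and `c`. At least one of the edges `d x`, `e y`, `x y` is present. -/
theorem isGoodPattern_pentagon_two (m1 m2 m3 : Bool) (hm : (m1 || m2 || m3) = true) :
    IsGoodPattern (n := 7) (optEdge m3 (5, 6) ++ optEdge m2 (4, 6) ++ optEdge m1 (3, 5) ++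
      [(1, 6), (2, 6), (3, 6), (0, 5), (1, 5), (4, 5), (0, 1), (0, 2), (0, 3), (0, 4), (1, 2), (1, 3),
        (1, 4), (2, 3), (2, 4), (3, 4)])
      ([(2, 5), (0, 6)] ++ optEdge (!m1) (3, 5) ++ optEdge (!m2) (4, 6) ++ optEdge (!m3) (5, 6))
      (match m1, m2, m3 with
        | false, false, _ => [3, 4, 3, 2, 1, 2, 2]
        | false, true, false => [3, 3, 1, 3, 4, 1, 2]
        | false, true, true => [3, 3, 0, 3, 4, 2, 3]
        | true, false, false => [1, 3, 3, 4, 3, 2, 1]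
        | true, false, true => [0, 3, 3, 4, 3, 3, 2]
        | true, true, false => [3, 3, 2, 2, 4, 2, 2]
        | true, true, true => [3, 0, 3, 3, 4, 3, 3]) [] := by
  revert m1 m2 m3
  decide +kernel

/-- The vertices are `a, b, c, d, e, x, y, z`, where `a b c d e` is a 5-cycle, and `x`, `y` and `z` are
neighbours of `a`, `c` and `d`. It is open whether `y z` is an edge. -/
theorem isGoodPattern_pentagon_three (m : Bool) :
    IsGoodPattern (n := 8) (optEdge m (6, 7) ++ [(2, 7), (3, 7), (4, 7),
      (1, 6), (2, 6), (3, 6), (0, 5), (1, 5), (4, 5), (0, 1), (0, 2), (0, 3), (0, 4), (1, 2), (1, 3),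
        (1, 4), (2, 3), (2, 4), (3, 4)])
      ([(2, 5), (3, 5), (0, 6), (4, 6), (0, 7), (1, 7), (5, 6), (5, 7)] ++ optEdge (!m) (6, 7))
      (match m with
        | false => [3, 3, 2, 4, 4, 1, 1, 1]
        | true => [0, 4, 3, 4, 4, 1, 2, 2]) [] := by
  revert m
  decide +kernel

/-- `a b c d e` is a closed walk of length five; in a triangle-free graph, it is a 5-cycle. -/
structure IsPentagon {V : Type*} (G : SimpleGraph V) (a b c d e : V) : Prop where
  ab : G.Adj a b
  bc : G.Adj b c
  cd : G.Adj c d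
  de : G.Adj d e
  ea : G.Adj e a

section
variable {V : Type*} {G : SimpleGraph V} {a b c d e : V}

theorem IsPentagon.rotate (p : IsPentagon G a b c d e) : IsPentagon G b c d e a :=
  ⟨p.bc, p.cd, p.de, p.ea, p.ab⟩

theorem IsPentagon.reverse (p : IsPentagon G a b c d e) : IsPentagon G a e d c b :=
  ⟨p.ea.symm, p.de.symm, p.cd.symm, p.bc.symm, p.ab.symm⟩

/-- A graph without triangles and 4-cycles. -/
structure GirthFive {V : Type*} (G : SimpleGraph V) : Prop where
  no_triangle : ∀ {a b c}, G.Adj a b → G.Adj b c → ¬ G.Adj a c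
  eq_of_common : ∀ {a b x y}, a ≠ b → G.Adj a x → G.Adj x b → G.Adj a y → G.Adj y b → x = y

theorem IsPentagon.ne (p : IsPentagon G a b c d e) (hG : GirthFive G) : a ≠ c := by
  rintro rfl
  exact hG.no_triangle p.cd p.de p.ea.symm

theorem IsPentagon.not_adj (p : IsPentagon G a b c d e) (hG : GirthFive G) : ¬ G.Adj a c :=
  hG.no_triangle p.ab p.bc

theorem IsPentagon.pendant_ne (p : IsPentagon G a b c d e) (hG : GirthFive G) {x : V}
    (hx : G.Adj a x) : c ≠ x := by
  rintro rfl
  exact p.not_adj hG hx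

theorem IsPentagon.forall_square (p : IsPentagon G a b c d e) (hG : GirthFive G) :
    G.square.Adj a b ∧ G.square.Adj a c ∧ G.square.Adj a d ∧ G.square.Adj a e ∧ G.square.Adj b c ∧
      G.square.Adj b d ∧ G.square.Adj b e ∧ G.square.Adj c d ∧ G.square.Adj c e ∧
      G.square.Adj d e := by
  have key : ∀ {a b c d e : V}, IsPentagon G a b c d e → G.square.Adj a c := fun p =>
    square_adj_of_common _ (p.ne hG) p.ab.symm p.bc
  exact ⟨square_adj_of_adj p.ab, key p, (key p.rotate.rotate.rotate).symm,
    square_adj_of_adj p.ea.symm, square_adj_of_adj p.bc, key p.rotate,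
    (key p.rotate.rotate.rotate.rotate).symm, square_adj_of_adj p.cd, key p.rotate.rotate,
    square_adj_of_adj p.de⟩

variable [Fintype V] {Δ m : ℕ}

/-- If `x` at the vertex `a` of a 5-cycle is not adjacent to `c` in the square, then, as the
remaining neighbours of `a` and of `c` are partially matched, some `y` at `c` is not adjacent
to `a`. -/
theorem IsPentagon.exists_unmatched (p : IsPentagon G a b c d e) (hG : GirthFive G)
    (hreg : ∀ v, (nbrs G v).card = Δ) {x : V} (hx : G.Adj a x) (hxb : x ≠ b) (hxe : x ≠ e)
    (hxc : ¬ G.square.Adj c x) : ∃ y, G.Adj c y ∧ y ≠ b ∧ y ≠ d ∧ ¬ G.square.Adj a y := by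
  classical
  by_contra hall
  push Not at hall
  have hmid : ∀ y ∈ ((nbrs G c).erase b).erase d, ∃ z, G.Adj a z ∧ G.Adj z y := by
    intro y hy
    rw [Finset.mem_erase, Finset.mem_erase, mem_nbrs] at hy
    rcases (hall y hy.2.2 hy.2.1 hy.1).2 with h1 | h1
    · exact absurd (hG.eq_of_common (p.ne hG) h1 hy.2.2.symm p.ab p.bc) hy.2.1
    · exact h1
  choose! f hf1 hf2 using hmid
  have hcard : (((nbrs G c).erase b).erase d).card ≤
      ((((nbrs G a).erase b).erase e).erase x).card := by
    refine Finset.card_le_card_of_injOn f (fun y hy => ?_) (fun y hy y' hy' hyy => ?_)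
    · have h1 := hf1 y hy
      have h2 := hf2 y hy
      rw [Finset.mem_coe, Finset.mem_erase, Finset.mem_erase, mem_nbrs] at hy
      rw [Finset.mem_coe, Finset.mem_erase, Finset.mem_erase, Finset.mem_erase, mem_nbrs]
      refine ⟨?_, ?_, ?_, h1⟩ <;> intro h3 <;> rw [h3] at h2
      · exact hxc (square_adj_of_common y (p.pendant_ne hG hx) hy.2.2.symm h2.symm)
      · exact hy.1 (hG.eq_of_common (p.rotate.rotate.ne hG) hy.2.2 h2.symm p.cd p.de)
      · exact hG.no_triangle p.bc hy.2.2 h2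
    · have h1 := hf1 y hy
      have h2 := hf2 y hy
      have h2' := hf2 y' hy'
      rw [Finset.mem_coe, Finset.mem_erase, Finset.mem_erase, mem_nbrs] at hy hy'
      refine hG.eq_of_common (a := c) (b := f y) ?_ hy.2.2 h2.symm hy'.2.2 (hyy ▸ h2'.symm)
      intro h3
      rw [← h3] at h1
      exact p.not_adj hG h1
  have hbd : d ≠ b := (p.rotate.ne hG).symm
  have hbe : e ≠ b := (p.reverse.rotate.rotate.rotate.rotate.ne hG).symm
  rw [Finset.card_erase_of_mem (by simpa [hbd] using p.cd),
    Finset.card_erase_of_mem (by simpa using p.bc.symm),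
    Finset.card_erase_of_mem (by simpa [hxb, hxe] using hx),
    Finset.card_erase_of_mem (by simpa [hbe] using p.ea.symm),
    Finset.card_erase_of_mem (by simpa using p.ab), hreg, hreg] at hcard
  have h3 : 3 ≤ Δ := by
    rw [← hreg a, ← Finset.card_eq_three.2 ⟨x, b, e, hxb, hxe, hbe.symm, rfl⟩]
    refine Finset.card_le_card fun w hw => ?_
    simp only [Finset.mem_insert, Finset.mem_singleton] at hw
    rw [mem_nbrs]
    rcases hw with rfl | rfl | rfl
    · exact hx
    · exact p.ab
    · exact p.ea.symm
  omega

/-- Vertices `x` at `a` and `y` at `c` with `x` not adjacent to `c` and `y` not adjacent to `a`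
leave no further adjacency. -/
theorem Bad.pentagon_pair (h : Bad G Δ m) (p : IsPentagon G a b c d e) (hG : GirthFive G) {x y : V}
    (hx : G.Adj a x) (hxb : x ≠ b) (hxe : x ≠ e) (hxc : ¬ G.square.Adj c x) (hy : G.Adj c y)
    (hyb : y ≠ b) (hyd : y ≠ d) (hya : ¬ G.square.Adj a y) :
    ¬ G.square.Adj d x ∧ ¬ G.square.Adj e y ∧ ¬ G.square.Adj x y := by
  classical
  by_contra hcon
  obtain ⟨ab, ac, ad, ae, bc, bd, be, cd, ce, de⟩ := p.forall_square hG
  have hcx := p.pendant_ne hG hx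
  have hdx := p.reverse.pendant_ne hG hx
  have hay := p.rotate.rotate.rotate.reverse.rotate.pendant_ne hG hy
  have hey := p.rotate.rotate.pendant_ne hG hy
  have hxy : x ≠ y := by
    rintro rfl
    exact hya (square_adj_of_adj hx)
  refine h.pattern (n := 7) ![a, b, c, d, e, x, y] 0 1 p.ab _ _ _ _
    (isGoodPattern_pentagon_two (decide (G.square.Adj d x)) (decide (G.square.Adj e y))
      (decide (G.square.Adj x y)) ?_) ?_ ?_ ?_
  · simp only [Bool.or_eq_true, decide_eq_true_eq]
    tauto
  · intro i
    rw [List.getD_nil]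
    exact h.sq_le _
  · simp only [List.forall_mem_append, List.forall_mem_cons, forall_mem_optEdge, decide_eq_true_eq]
    exact ⟨⟨⟨id, id⟩, id⟩, square_adj_of_common c hyb.symm p.bc.symm hy, square_adj_of_adj hy,
      square_adj_of_common c hyd.symm p.cd hy, square_adj_of_adj hx,
      square_adj_of_common a hxb.symm p.ab hx, square_adj_of_common a hxe.symm p.ea.symm hx,
      ab, ac, ad, ae, bc, bd, be, cd, ce, de, by simp⟩
  · simp only [List.forall_mem_append, List.forall_mem_cons, forall_mem_optEdge, Bool.not_eq_true',
      decide_eq_false_iff_not]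
    exact ⟨⟨⟨⟨⟨hcx, hxc⟩, ⟨hay, hya⟩, by simp⟩, fun h1 => ⟨hdx, h1⟩⟩, fun h1 => ⟨hey, h1⟩⟩,
      fun h1 => ⟨hxy, h1⟩⟩

/-- In the square, a neighbour of a 5-cycle is adjacent to the whole cycle. -/
theorem Bad.pentagon_adj (h : Bad G Δ m) (p : IsPentagon G a b c d e) (hG : GirthFive G)
    (hreg : ∀ v, (nbrs G v).card = Δ) {x : V} (hx : G.Adj a x) (hxb : x ≠ b) (hxe : x ≠ e) :
    G.square.Adj c x := by
  classical
  by_contra hxc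
  obtain ⟨y, hy, hyb, hyd, hya⟩ := p.exists_unmatched hG hreg hx hxb hxe hxc
  obtain ⟨hxd, hye, hxy⟩ := h.pentagon_pair p hG hx hxb hxe hxc hy hyb hyd hya
  obtain ⟨z, hz, hze, hzc, hza⟩ := p.reverse.exists_unmatched hG hreg hx hxe hxb hxd
  obtain ⟨-, hzb, hxz⟩ := h.pentagon_pair p.reverse hG hx hxe hxb hxd hz hze hzc hza
  obtain ⟨ab, ac, ad, ae, bc, bd, be, cd, ce, de⟩ := p.forall_square hG
  have hyz : y ≠ z := by
    rintro rfl
    exact hG.no_triangle hy hz.symm p.cd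
  have hxy' : x ≠ y := by
    rintro rfl
    exact hya (square_adj_of_adj hx)
  have hxz' : x ≠ z := by
    rintro rfl
    exact hza (square_adj_of_adj hx)
  refine h.pattern (n := 8) ![a, b, c, d, e, x, y, z] 0 1 p.ab _ _ _ _
    (isGoodPattern_pentagon_three (decide (G.square.Adj y z))) ?_ ?_ ?_
  · intro i
    rw [List.getD_nil]
    exact h.sq_le _
  · simp only [List.forall_mem_append, List.forall_mem_cons, forall_mem_optEdge, decide_eq_true_eq]
    exact ⟨id, square_adj_of_common d hzc.symm p.cd.symm hz, square_adj_of_adj hz,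
      square_adj_of_common d hze.symm p.de hz,
      square_adj_of_common c hyb.symm p.bc.symm hy, square_adj_of_adj hy,
      square_adj_of_common c hyd.symm p.cd hy, square_adj_of_adj hx,
      square_adj_of_common a hxb.symm p.ab hx, square_adj_of_common a hxe.symm p.ea.symm hx,
      ab, ac, ad, ae, bc, bd, be, cd, ce, de, by simp⟩
  · simp only [List.forall_mem_append, List.forall_mem_cons, forall_mem_optEdge, Bool.not_eq_true',
      decide_eq_false_iff_not]
    exact ⟨⟨⟨p.pendant_ne hG hx, hxc⟩, ⟨p.reverse.pendant_ne hG hx, hxd⟩,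
      ⟨p.rotate.rotate.rotate.reverse.rotate.pendant_ne hG hy, hya⟩,
      ⟨p.rotate.rotate.pendant_ne hG hy, hye⟩,
      ⟨p.reverse.rotate.rotate.rotate.reverse.rotate.pendant_ne hG hz, hza⟩,
      ⟨p.reverse.rotate.rotate.pendant_ne hG hz, hzb⟩, ⟨hxy', hxy⟩, ⟨hxz', hxz⟩, by simp⟩,
      fun h1 => ⟨hyz, h1⟩⟩

/-- If `a b` is an edge of a 5-cycle, then every path `a b x` lies on a 5-cycle. -/
theorem Bad.exists_pentagon (h : Bad G Δ m) (p : IsPentagon G a b c d e) (hG : GirthFive G)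
    (hreg : ∀ v, (nbrs G v).card = Δ) {x : V} (hx : G.Adj b x) (hxa : x ≠ a) :
    ∃ y z, IsPentagon G a b x y z := by
  by_cases hxc : x = c
  · exact ⟨d, e, hxc ▸ p⟩
  have h1 := h.pentagon_adj p.rotate.reverse hG hreg hx hxa hxc
  rcases h1.2 with h2 | ⟨w, h2, h3⟩
  · exact absurd (hG.eq_of_common (p.rotate.reverse.ne hG) hx h2.symm p.ab.symm p.ea.symm) hxa
  · exact ⟨w, e, p.ab, hx, h3.symm, h2.symm, p.ea⟩

/-- Every path of length two that starts on a 5-cycle lies on a 5-cycle, so a path of length three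
does not leave the neighbourhood of its first vertex in the square. -/
theorem Bad.universal_of_pentagon (h : Bad G Δ m) (p : IsPentagon G a b c d e) (hG : GirthFive G)
    (hreg : ∀ v, (nbrs G v).card = Δ) (v : V) (hv : a ≠ v) : G.square.Adj a v := by
  by_contra hcon
  obtain ⟨x, y, z, hax, hxy, hyz, hay, hay', haz, hz⟩ := exists_path_three h.conn a v hv hcon
  obtain ⟨u, w, t, q⟩ : ∃ u w t, IsPentagon G a x u w t := by
    by_cases hxe : x = e
    · exact ⟨d, c, b, hxe ▸ p.reverse⟩
    · obtain ⟨u, w, q⟩ := h.exists_pentagon p.rotate.rotate.rotate.rotate hG hreg hax hxe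
      exact ⟨u, w, e, q.rotate⟩
  obtain ⟨w, t, q⟩ := h.exists_pentagon q hG hreg hxy hay.symm
  have hzx : z ≠ x := by
    rintro rfl
    exact hz (square_adj_of_adj hax)
  have hzw : z ≠ w := by
    rintro rfl
    exact hz (square_adj_of_common t haz q.ea q.de.symm)
  exact hz (h.pentagon_adj q.rotate.rotate.reverse hG hreg hyz hzx hzw)

/-- In a graph of girth at least five, no vertex is reached twice. -/
theorem card_nbrs_square_of_girthFive (hG : GirthFive G) (hreg : ∀ v, (nbrs G v).card = Δ) (v : V) :
    (nbrs G.square v).card = Δ ^ 2 := by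
  classical
  have h1 : ∀ w ∈ nbrs G.square v, reach G v w = 1 := by
    intro w hw
    rw [mem_nbrs] at hw
    refine le_antisymm ?_ (one_le_reach hw)
    refine Finset.card_le_one.2 fun x hx y hy => ?_
    simp only [Finset.mem_filter, mem_nbrs] at hx hy
    rcases hx with ⟨hx, rfl | hxw⟩ <;> rcases hy with ⟨hy, rfl | hyw⟩
    · rfl
    · exact absurd hx (hG.no_triangle hy hyw)
    · exact absurd hy (hG.no_triangle hx hxw)
    · exact hG.eq_of_common hw.ne hx hxw hy hyw
  have h2 := sum_reach G v
  rw [Finset.sum_congr rfl h1, Finset.sum_congr rfl fun u _ => hreg u] at h2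
  simp only [Finset.sum_const, smul_eq_mul, mul_one, hreg] at h2
  rw [h2, sq]

/-- If there is a 5-cycle, then `G` is a Moore graph. -/
theorem Bad.eq_top_of_pentagon (h : Bad G Δ m) (p : IsPentagon G a b c d e) (hG : GirthFive G)
    (hreg : ∀ v, (nbrs G v).card = Δ) :
    Fintype.card V = Δ ^ 2 + 1 ∧ ∀ u v, u ≠ v → G.square.Adj u v := by
  classical
  have h1 := card_nbrs_of_universal G.square a (h.universal_of_pentagon p hG hreg)
  have h2 := card_nbrs_square_of_girthFive hG hreg
  refine ⟨by rw [← h1, h2], fun u v huv => ?_⟩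
  have h3 : nbrs G.square u = Finset.univ.erase u := by
    refine Finset.eq_of_subset_of_card_le (fun w hw => ?_) ?_
    · exact Finset.mem_erase.2 ⟨(mem_nbrs.1 hw).ne', Finset.mem_univ _⟩
    · rw [Finset.card_erase_of_mem (Finset.mem_univ _), Finset.card_univ, ← h1, h2, h2]
      rfl
  rw [← mem_nbrs, h3]
  exact Finset.mem_erase.2 ⟨huv.symm, Finset.mem_univ _⟩

end

/-! ### The square of a long cycle -/

/-- The edges of the square of the cycle `v 0, …, v (n + 1)`, each with a direction. For `n ≤ 2` some
of them are repeated or occur in both directions; such cycles only serve as a basis for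
induction. -/
def cycleSq {V : Type*} (v : ℕ → V) (n : ℕ) : List (V × V) :=
  (List.range (n + 1)).map (fun i => (v i, v (i + 1))) ++
    (List.range n).map (fun i => (v i, v (i + 2))) ++ [(v n, v 0), (v (n + 1), v 0), (v (n + 1), v 1)]

theorem listPoly_append {V : Type*} (l l' : List (V × V)) :
    listPoly (l ++ l') = listPoly l * listPoly l' := by
  simp [listPoly]

theorem listPoly_mem_supported {V : Type*} (l : List (V × V)) (s : Set V)
    (h : ∀ e ∈ l, e.1 ∈ s ∧ e.2 ∈ s) : listPoly l ∈ supported ℤ s := by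
  refine list_prod_mem fun q hq => ?_
  obtain ⟨e, he, rfl⟩ := List.mem_map.1 hq
  exact sub_mem (Algebra.subset_adjoin ⟨_, (h e he).1, rfl⟩)
    (Algebra.subset_adjoin ⟨_, (h e he).2, rfl⟩)

/-- The three vertices `v (n + 2)`, `v (n + 3)`, `v (n + 4)` are inserted between `v (n + 1)` and `v 0`.
The factor `R` takes care of vertices attached to the cycle elsewhere. -/
theorem coeff_cycleSq_add_three {V : Type*} (v : ℕ → V) (n : ℕ)
    (hv : ∀ i j, i < n + 5 → j < n + 5 → v i = v j → i = j) (R : MvPolynomial V ℤ)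
    (hR : ∀ j ∈ ({n + 2, n + 3, n + 4} : Set ℕ), R ∈ supported ℤ ({v j}ᶜ : Set V)) (d : V →₀ ℕ)
    (hd : ∀ j ∈ ({n + 2, n + 3, n + 4} : Set ℕ), d (v j) = 0) :
    coeff (d + Finsupp.single (v (n + 4)) 2 + Finsupp.single (v (n + 3)) 2 +
      Finsupp.single (v (n + 2)) 2) (listPoly (cycleSq v (n + 3)) * R) =
    coeff d (listPoly (cycleSq v n) * R) := by
  set A := listPoly ((List.range (n + 1)).map (fun i => (v i, v (i + 1))) ++
    (List.range n).map (fun i => (v i, v (i + 2)))) * R with hA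
  have hne : ∀ i j, i < n + 5 → j < n + 5 → i ≠ j → v i ≠ v j := fun i j hi hj hij h =>
    hij (hv i j hi hj h)
  have hAs : ∀ j ∈ ({n + 2, n + 3, n + 4} : Set ℕ), A ∈ supported ℤ ({v j}ᶜ : Set V) := by
    intro j hj
    refine mul_mem (listPoly_mem_supported _ _ fun e he => ?_) (hR j hj)
    simp only [Set.mem_insert_iff, Set.mem_singleton_iff] at hj
    simp only [List.mem_append, List.mem_map, List.mem_range] at he
    rcases he with ⟨i, hi, rfl⟩ | ⟨i, hi, rfl⟩
    · exact ⟨hne _ _ (by omega) (by omega) (by omega), hne _ _ (by omega) (by omega) (by omega)⟩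
    · exact ⟨hne _ _ (by omega) (by omega) (by omega), hne _ _ (by omega) (by omega) (by omega)⟩
  have e1 : listPoly (cycleSq v (n + 3)) * R = A * ((X (v n) - X (v (n + 2))) *
      (X (v (n + 1)) - X (v (n + 2))) * (X (v (n + 1)) - X (v (n + 3))) *
      (X (v (n + 2)) - X (v (n + 3))) * (X (v (n + 2)) - X (v (n + 4))) *
      (X (v (n + 3)) - X (v (n + 4))) * (X (v (n + 3)) - X (v 0)) * (X (v (n + 4)) - X (v 0)) *
      (X (v (n + 4)) - X (v 1))) := by
    rw [hA, cycleSq]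
    simp only [listPoly, List.range_succ, List.map_append, List.prod_append, List.map_cons,
      List.map_nil, List.prod_cons, List.prod_nil, mul_one]
    ring
  have e2 : listPoly (cycleSq v n) * R = A * ((X (v n) - X (v 0)) * (X (v (n + 1)) - X (v 0)) *
      (X (v (n + 1)) - X (v 1))) := by
    rw [hA, cycleSq]
    simp only [listPoly, List.map_append, List.prod_append, List.map_cons,
      List.map_nil, List.prod_cons, List.prod_nil, mul_one]
    ring
  rw [e1, e2]
  clear_value A
  refine coeff_insert_three A _ _ _ _ _ _ _ ?_ ?_ (hne _ _ (by omega) (by omega) (by omega))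
    (hne _ _ (by omega) (by omega) (by omega)) (hne _ _ (by omega) (by omega) (by omega)) d
    (hd _ (by simp)) (hd _ (by simp)) (hd _ (by simp))
  · rintro z (rfl | rfl | rfl)
    · exact hAs _ (by simp)
    · exact hAs _ (by simp)
    · exact hAs _ (by simp)
  · rintro z (rfl | rfl | rfl) <;>
      exact ⟨hne _ _ (by omega) (by omega) (by omega), hne _ _ (by omega) (by omega) (by omega),
        hne _ _ (by omega) (by omega) (by omega), hne _ _ (by omega) (by omega) (by omega)⟩

/-- The exponents `δ i` at the vertices `v i` of a cycle of length `k`. -/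
noncomputable def cycleExp {V : Type*} (v : ℕ → V) (δ : ℕ → ℕ) (k : ℕ) : V →₀ ℕ :=
  ∑ i ∈ Finset.range k, Finsupp.single (v i) (δ i)

theorem cycleExp_apply {V : Type*} (v : ℕ → V) (δ : ℕ → ℕ) (k : ℕ)
    (hv : ∀ i j, i < k → j < k → v i = v j → i = j) (i : ℕ) (hi : i < k) :
    cycleExp v δ k (v i) = δ i := by
  classical
  rw [cycleExp, Finsupp.finsetSum_apply, Finset.sum_eq_single i]
  · simp
  · intro j hj hji
    rw [Finsupp.single_eq_of_ne]
    intro h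
    exact hji (hv _ _ (Finset.mem_range.1 hj) hi h.symm)
  · intro h
    exact absurd (Finset.mem_range.2 hi) h

theorem cycleExp_apply_of_ne {V : Type*} (v : ℕ → V) (δ : ℕ → ℕ) (k : ℕ) (x : V)
    (hx : ∀ i < k, x ≠ v i) : cycleExp v δ k x = 0 := by
  classical
  rw [cycleExp, Finsupp.finsetSum_apply]
  exact Finset.sum_eq_zero fun j hj => Finsupp.single_eq_of_ne (hx j (Finset.mem_range.1 hj))

/-- The coefficient does not change when a cycle is lengthened by a multiple of three. The vertices in
`P` are attached to the cycle, and `R` is the product over the edges between `P` and the cycle. -/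
theorem coeff_cycleSq {V : Type*} (v : ℕ → V) (n : ℕ) (δ : ℕ → ℕ) (hδ : ∀ i, n + 2 ≤ i → δ i = 2)
    (P : Set V) (R : MvPolynomial V ℤ) (dP : V →₀ ℕ) (hdP : ∀ x ∉ P, dP x = 0)
    (hR : R ∈ supported ℤ (P ∪ v '' {i | i < n + 2})) (j : ℕ)
    (hv : ∀ i j', i < n + 2 + 3 * j → j' < n + 2 + 3 * j → v i = v j' → i = j')
    (hP : ∀ x ∈ P, ∀ i < n + 2 + 3 * j, x ≠ v i) :
    coeff (cycleExp v δ (n + 2 + 3 * j) + dP) (listPoly (cycleSq v (n + 3 * j)) * R) =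
      coeff (cycleExp v δ (n + 2) + dP) (listPoly (cycleSq v n) * R) := by
  induction j with
  | zero => simp
  | succ j ih =>
    rw [← ih (fun i j' hi hj' => hv i j' (by omega) (by omega))
      (fun x hx i hi => hP x hx i (by omega))]
    have h1 := coeff_cycleSq_add_three v (n + 3 * j)
      (fun i j' hi hj' => hv i j' (by omega) (by omega)) R ?_
      (cycleExp v δ (n + 2 + 3 * j) + dP) ?_
    · rw [← h1]
      congr 1
      have e : n + 2 + 3 * (j + 1) = n + 2 + 3 * j + 1 + 1 + 1 := by ring
      rw [e, cycleExp, cycleExp, Finset.sum_range_succ, Finset.sum_range_succ,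
        Finset.sum_range_succ, hδ _ (by omega), hδ _ (by omega), hδ _ (by omega),
        show n + 3 * j + 4 = n + 2 + 3 * j + 1 + 1 by ring,
        show n + 3 * j + 3 = n + 2 + 3 * j + 1 by ring, show n + 3 * j + 2 = n + 2 + 3 * j by ring]
      abel
    · intro i hi
      simp only [Set.mem_insert_iff, Set.mem_singleton_iff] at hi
      refine supported_mono ?_ hR
      rintro x (hx | ⟨i', hi', rfl⟩)
      · exact hP x hx i (by omega)
      · intro h
        have hi' : i' < n + 2 := hi'
        have := hv i' i (by omega) (by omega) h
        omega
    · intro i hi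
      simp only [Set.mem_insert_iff, Set.mem_singleton_iff] at hi
      rw [Finsupp.add_apply, cycleExp_apply_of_ne, hdP]
      · intro h
        exact hP _ h i (by omega) rfl
      · intro i' hi' h
        have := hv i i' (by omega) (by omega) h
        omega

/-- The coefficient of a concrete list of arcs, transported along `φ`. -/
theorem coeff_listPoly_map {V : Type*} {n : ℕ} (φ : Fin n → V) (hφ : Function.Injective φ)
    (l : List (Fin n × Fin n)) (d : List ℕ) (hd : d.length = n) :
    coeff (∑ i, Finsupp.single (φ i) (d.getD i 0)) (listPoly (l.map (Prod.map φ φ))) =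
      coeffAux l d := by
  have h : (∑ i, Finsupp.single (φ i) (d.getD i 0) : V →₀ ℕ) = (listExp n d).mapDomain φ := by
    rw [Finsupp.mapDomain, Finsupp.sum_fintype _ _ (by simp)]
    rfl
  rw [h, listPoly_map, coeff_rename_mapDomain _ hφ, coeff_listPoly _ _ hd]

theorem coeff_cycleSq_three {V : Type*} (v : ℕ → V)
    (hv : ∀ i j, i < 3 → j < 3 → v i = v j → i = j) :
    coeff (cycleExp v (fun _ => 2) 3) (listPoly (cycleSq v 1)) ≠ 0 := by
  have hφ : Function.Injective (fun i : Fin 3 => v i) := fun i j h =>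
    Fin.ext (hv _ _ i.2 j.2 h)
  have h := coeff_listPoly_map _ hφ [(0, 1), (1, 2), (0, 2), (1, 0), (2, 0), (2, 1)] [2, 2, 2] rfl
  have h1 : cycleExp v (fun _ => 2) 3 =
      ∑ i : Fin 3, Finsupp.single (v i) (([2, 2, 2] : List ℕ).getD i 0) := by
    rw [cycleExp, Finset.sum_range]
    exact Finset.sum_congr rfl fun i _ => by fin_cases i <;> rfl
  rw [h1]
  refine ne_of_eq_of_ne h ?_
  decide +kernel

/-- A cycle with a vertex `x` attached at `v 1`. -/
theorem coeff_cycleSq_four {V : Type*} (v : ℕ → V) (x : V)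
    (hv : ∀ i j, i < 4 → j < 4 → v i = v j → i = j) (hx : ∀ i < 4, x ≠ v i) :
    coeff (cycleExp v (fun i => ([2, 3, 3, 2] : List ℕ).getD i 2) 4 + Finsupp.single x 1)
      (listPoly (cycleSq v 2) * listPoly [(x, v 0), (x, v 1), (x, v 2)]) ≠ 0 := by
  set φ : Fin 5 → V := Fin.cons x fun i : Fin 4 => v i with hφ'
  have hφ : Function.Injective φ := by
    refine Fin.cons_injective_iff.2 ⟨?_, fun i j hij => Fin.ext (hv _ _ i.2 j.2 hij)⟩
    rintro ⟨i, hi⟩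
    exact hx _ i.2 hi.symm
  have h := coeff_listPoly_map φ hφ ([(0, 1), (0, 2), (0, 3), (1, 2), (2, 3), (3, 4), (1, 3), (2, 4),
    (3, 1), (4, 1), (4, 2)]) [1, 2, 3, 3, 2] rfl
  rw [mul_comm, ← listPoly_append]
  have h1 : cycleExp v (fun i => ([2, 3, 3, 2] : List ℕ).getD i 2) 4 + Finsupp.single x 1 =
      ∑ i : Fin 5, Finsupp.single (φ i) (([1, 2, 3, 3, 2] : List ℕ).getD i 0) := by
    rw [cycleExp, Finset.sum_range, Fin.sum_univ_succ (n := 4), add_comm]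
    congr 1
  rw [h1]
  refine ne_of_eq_of_ne h ?_
  decide +kernel

/-- A cycle with vertices `x` and `y` attached at `v 1` and `v 2`. -/
theorem coeff_cycleSq_eight {V : Type*} (v : ℕ → V) (x y : V)
    (hv : ∀ i j, i < 8 → j < 8 → v i = v j → i = j) (hx : ∀ i < 8, x ≠ v i) (hy : ∀ i < 8, y ≠ v i)
    (hxy : x ≠ y) :
    coeff (cycleExp v (fun i => ([3, 4, 3, 3, 2, 1] : List ℕ).getD i 2) 8 +
      (Finsupp.single x 1 + Finsupp.single y 1))
      (listPoly (cycleSq v 6) * listPoly [(x, v 0), (x, v 1), (x, v 2), (y, v 1), (y, v 2),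
        (y, v 3)]) ≠ 0 := by
  set φ : Fin 10 → V := Fin.cons x (Fin.cons y fun i : Fin 8 => v i) with hφ'
  have hφ : Function.Injective φ := by
    refine Fin.cons_injective_iff.2 ⟨?_, Fin.cons_injective_iff.2 ⟨?_,
      fun i j hij => Fin.ext (hv _ _ i.2 j.2 hij)⟩⟩
    · rintro ⟨i, hi⟩
      refine Fin.cases (fun h0 => hxy h0.symm) (fun j hj => hx _ j.2 hj.symm) i hi
    · rintro ⟨i, hi⟩
      exact hy _ i.2 hi.symm
  -- The order of the arcs keeps the expansion of the product short.
  have h := coeff_listPoly_map φ hφ ([(5, 7), (7, 9), (5, 6), (6, 7), (7, 8), (8, 9), (6, 8), (8, 2),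
    (9, 2), (1, 5), (1, 4), (4, 5), (2, 4), (4, 6), (0, 2), (0, 4), (0, 3), (1, 3), (2, 3), (3, 4),
    (3, 5), (9, 3)]) [1, 1, 3, 4, 3, 3, 2, 1, 2, 2] rfl
  have hp : ([(0, 2), (0, 3), (0, 4), (1, 3), (1, 4), (1, 5), (2, 3), (3, 4), (4, 5), (5, 6),
      (6, 7), (7, 8), (8, 9), (2, 4), (3, 5), (4, 6), (5, 7), (6, 8), (7, 9), (8, 2), (9, 2),
      (9, 3)] : List (Fin 10 × Fin 10)).Perm [(5, 7), (7, 9), (5, 6), (6, 7), (7, 8), (8, 9),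
      (6, 8), (8, 2), (9, 2), (1, 5), (1, 4), (4, 5), (2, 4), (4, 6), (0, 2), (0, 4), (0, 3), (1, 3),
      (2, 3), (3, 4), (3, 5), (9, 3)] := by decide +kernel
  have hp2 := ((hp.map (Prod.map φ φ)).map
    (fun e => (X e.1 - X e.2 : MvPolynomial V ℤ))).prod_eq
  have h := (congrArg _ hp2).trans h
  rw [mul_comm, ← listPoly_append]
  have h1 : cycleExp v (fun i => ([3, 4, 3, 3, 2, 1] : List ℕ).getD i 2) 8 +
      (Finsupp.single x 1 + Finsupp.single y 1) =
      ∑ i : Fin 10, Finsupp.single (φ i) (([1, 1, 3, 4, 3, 3, 2, 1, 2, 2] : List ℕ).getD i 0) := by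
    rw [cycleExp, Finset.sum_range, Fin.sum_univ_succ (n := 9), Fin.sum_univ_succ (n := 8),
      add_comm, add_assoc]
    congr 2
  rw [h1]
  refine ne_of_eq_of_ne h ?_
  decide +kernel

/-! ### Shortest cycles -/

/-- `g 0, …, g (n - 1)` are the vertices of a cycle of `G`, in this order. -/
structure IsCyc {V : Type*} (G : SimpleGraph V) (n : ℕ) (g : ℕ → V) : Prop where
  three_le : 3 ≤ n
  adj : ∀ i, i + 1 < n → G.Adj (g i) (g (i + 1))
  close : G.Adj (g (n - 1)) (g 0)
  inj : ∀ i j, i < n → j < n → g i = g j → i = j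

/-- `v` runs periodically through a cycle of `G` of the least possible length `k`. -/
structure IsGirthCycle {V : Type*} (G : SimpleGraph V) (k : ℕ) (v : ℕ → V) : Prop where
  three_le : 3 ≤ k
  adj : ∀ i, G.Adj (v i) (v (i + 1))
  per : ∀ i, v (i + k) = v i
  inj : ∀ i j, i < k → j < k → v i = v j → i = j
  le : ∀ n g, IsCyc G n g → k ≤ n

theorem exists_isCyc {V : Type*} [Fintype V] (G : SimpleGraph V) (hconn : G.Connected)
    (hdeg : ∀ v, 3 ≤ (nbrs G v).card) : ∃ n g, IsCyc G n g := by
  classical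
  have hac : ¬ G.IsAcyclic := by
    intro hac
    have h1 := (SimpleGraph.IsTree.mk hconn hac).card_edgeFinset
    have h2 := G.sum_degrees_eq_twice_card_edges
    have h3 : Fintype.card V * 3 ≤ ∑ v, G.degree v := by
      rw [← smul_eq_mul, ← Finset.card_univ]
      refine Finset.card_nsmul_le_sum _ _ _ fun v _ => (hdeg v).trans_eq ?_
      rw [← SimpleGraph.card_neighborFinset_eq_degree]
      congr 1
      ext w
      simp
    omega
  rw [SimpleGraph.IsAcyclic] at hac
  push Not at hac
  obtain ⟨u, c, hc⟩ := hac
  refine ⟨c.length, c.getVert, hc.three_le_length, fun i hi => c.adj_getVert_succ (by omega), ?_, ?_⟩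
  · have h := c.adj_getVert_succ (i := c.length - 1) (by have := hc.three_le_length; omega)
    rw [Nat.sub_add_cancel (by have := hc.three_le_length; omega), c.getVert_length] at h
    rwa [c.getVert_zero]
  · intro i j hi hj h
    exact hc.getVert_injOn' (by simp; omega) (by simp; omega) h

theorem exists_isGirthCycle {V : Type*} [Fintype V] (G : SimpleGraph V) (hconn : G.Connected)
    (hdeg : ∀ v, 3 ≤ (nbrs G v).card) : ∃ k v, IsGirthCycle G k v := by
  classical
  have hex := exists_isCyc G hconn hdeg
  obtain ⟨g, hg⟩ := Nat.find_spec hex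
  set k := Nat.find hex with hk
  have h3 := hg.three_le
  refine ⟨k, fun i => g (i % k), h3, fun i => ?_, fun i => by simp, fun i j hi hj h => ?_,
    fun n g' hg' => Nat.find_min' hex ⟨g', hg'⟩⟩
  · have hi : i % k < k := Nat.mod_lt _ (by omega)
    rcases Nat.lt_or_ge (i % k + 1) k with h | h
    · have : (i + 1) % k = i % k + 1 := by
        rw [Nat.add_mod, Nat.mod_eq_of_lt (a := 1) (by omega), Nat.mod_eq_of_lt h]
      simpa only [this] using hg.adj _ h
    · have h0 : i % k = k - 1 := by omega
      have : (i + 1) % k = 0 := by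
        rw [Nat.add_mod, Nat.mod_eq_of_lt (a := 1) (by omega), h0, Nat.sub_add_cancel (by omega),
          Nat.mod_self]
      simpa only [this, h0] using hg.close
  · simp only [Nat.mod_eq_of_lt hi, Nat.mod_eq_of_lt hj] at h
    exact hg.inj _ _ hi hj h

section
variable {V : Type*} {G : SimpleGraph V} {k : ℕ} {v : ℕ → V}

theorem IsGirthCycle.mod (C : IsGirthCycle G k v) (i : ℕ) : v (i % k) = v i :=
  Function.Periodic.map_mod_nat C.per i

/-- Any `k` consecutive positions are distinct vertices. -/
theorem IsGirthCycle.window (C : IsGirthCycle G k v) (s i j : ℕ) (hi : i < k) (hj : j < k)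
    (h : v (s + i) = v (s + j)) : i = j := by
  have hk : 0 < k := by omega
  rw [← C.mod, ← C.mod (s + j)] at h
  have h1 : (s + i) ≡ (s + j) [MOD k] := C.inj _ _ (Nat.mod_lt _ hk) (Nat.mod_lt _ hk) h
  exact Nat.ModEq.eq_of_lt_of_lt (Nat.ModEq.add_left_cancel' s h1) hi hj

/-- A chord between vertices at distance `t` along the cycle would close a shorter cycle. -/
theorem IsGirthCycle.chord (C : IsGirthCycle G k v) (s t : ℕ) (ht : 2 ≤ t) (htk : t < k)
    (h : G.Adj (v s) (v (s + t))) : k ≤ t + 1 :=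
  C.le _ (fun i => v (s + i)) ⟨by omega, fun i _ => C.adj _, h.symm,
    fun i j hi hj => C.window s i j (by omega) (by omega)⟩

/-- A path of length two outside of the cycle cannot be a shortcut. -/
theorem IsGirthCycle.detour_one (C : IsGirthCycle G k v) (s t : ℕ) (ht : 1 ≤ t) (htk : t < k) (z : V)
    (hz : ∀ i, z ≠ v i) (h1 : G.Adj z (v s)) (h2 : G.Adj z (v (s + t))) : k ≤ t + 2 := by
  refine C.le _ (fun i => if i ≤ t then v (s + i) else z) ⟨by omega, fun i hi => ?_, ?_,
    fun i j hi hj h => ?_⟩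
  · rcases Nat.lt_or_ge i t with h | h
    · simp only [show i ≤ t by omega, show i + 1 ≤ t by omega, if_true]
      exact C.adj _
    · have : i = t := by omega
      subst this
      simpa using h2.symm
  · simpa using h1
  · split_ifs at h with h3 h4 h4
    · exact C.window s i j (by omega) (by omega) h
    · exact absurd h.symm (hz _)
    · exact absurd h (hz _)
    · omega

/-- A path of length three outside of the cycle cannot be a shortcut. -/
theorem IsGirthCycle.detour_two (C : IsGirthCycle G k v) (s t : ℕ) (htk : t < k) (y z : V)
    (hy : ∀ i, y ≠ v i) (hz : ∀ i, z ≠ v i) (hyz : G.Adj y z) (h1 : G.Adj z (v s))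
    (h2 : G.Adj y (v (s + t))) : k ≤ t + 3 := by
  refine C.le _ (fun i => if i ≤ t then v (s + i) else if i = t + 1 then y else z)
    ⟨by omega, fun i hi => ?_, ?_, fun i j hi hj h => ?_⟩
  · rcases Nat.lt_trichotomy i t with h | h | h
    · simp only [show i ≤ t by omega, show i + 1 ≤ t by omega, if_true]
      exact C.adj _
    · subst h
      simpa using h2.symm
    · have : i = t + 1 := by omega
      subst this
      simpa using hyz
  · simpa using h1
  · split_ifs at h with h3 h4 h4 h5 h5 h6 h6
    all_goals first
      | omega
      | exact C.window s i j (by omega) (by omega) h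
      | exact absurd h.symm (hy _)
      | exact absurd h.symm (hz _)
      | exact absurd h (hy _)
      | exact absurd h (hz _)
      | exact absurd h hyz.ne
      | exact absurd h.symm hyz.ne

theorem IsGirthCycle.adj_imp (C : IsGirthCycle G k v) {i j : ℕ} (hij : i < j)
    (hj : j < k) (h : G.Adj (v i) (v j)) : j = i + 1 ∨ j + 1 = i + k := by
  by_contra hcon
  obtain ⟨t, rfl⟩ := Nat.exists_eq_add_of_lt hij
  have := C.chord i (t + 1) (by omega) (by omega) h
  omega

theorem IsGirthCycle.ne_of_forall_lt (C : IsGirthCycle G k v) {z : V} (hz : ∀ i < k, z ≠ v i)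
    (i : ℕ) : z ≠ v i := by
  rw [← C.mod]
  exact hz _ (Nat.mod_lt _ (by have := C.three_le; omega))

/-- The positions `i < j` of a cycle of length `k` have cyclic distance `1` or `2`. -/
def CycNear (k i j : ℕ) : Prop := j = i + 1 ∨ j = i + 2 ∨ j + 1 = i + k ∨ j + 2 = i + k

theorem IsGirthCycle.square_adj_imp (C : IsGirthCycle G k v) (h5 : 5 ≤ k) {i j : ℕ} (hij : i < j)
    (hj : j < k) (h : G.square.Adj (v i) (v j)) : CycNear k i j := by
  obtain ⟨hne, h | ⟨w, h1, h2⟩⟩ := square_adj.1 h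
  · rcases C.adj_imp hij hj h with h | h <;> simp [CycNear, h]
  by_cases hw : ∃ l < k, w = v l
  · obtain ⟨l, hl, rfl⟩ := hw
    have hil : l = i + 1 ∨ l + 1 = i + k ∨ i = l + 1 ∨ i + 1 = l + k := by
      rcases Nat.lt_trichotomy i l with h | h | h
      · have := C.adj_imp h hl h1
        omega
      · exact absurd h1 (h ▸ G.irrefl)
      · have := C.adj_imp h (by omega) h1.symm
        omega
    have hjl : l = j + 1 ∨ l + 1 = j + k ∨ j = l + 1 ∨ j + 1 = l + k := by
      rcases Nat.lt_trichotomy j l with h | h | h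
      · have := C.adj_imp h hl h2.symm
        omega
      · exact absurd h2 (h ▸ G.irrefl)
      · have := C.adj_imp h (by omega) h2
        omega
    unfold CycNear
    omega
  · push Not at hw
    obtain ⟨t, rfl⟩ := Nat.exists_eq_add_of_lt hij
    have ho := C.ne_of_forall_lt hw
    have h3 := C.detour_one i (t + 1) (by omega) (by omega) w ho h1.symm h2
    have h4 := C.detour_one (i + t + 1) (k - (t + 1)) (by omega) (by omega) w ho h2 (by
      rw [show i + t + 1 + (k - (t + 1)) = i + k by omega, C.per]
      exact h1.symm)
    omega

theorem IsGirthCycle.square_adj_add_two (C : IsGirthCycle G k v) (i : ℕ) :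
    G.square.Adj (v i) (v (i + 2)) := by
  refine square_adj_of_common (v (i + 1)) ?_ (C.adj i).symm (C.adj (i + 1))
  intro h
  have h3 := C.three_le
  exact absurd (C.window i 0 2 (by omega) (by omega) h) (by norm_num)

theorem IsGirthCycle.square_adj_iff (C : IsGirthCycle G k v) (h5 : 5 ≤ k) {i j : ℕ} (hij : i < j)
    (hj : j < k) : G.square.Adj (v i) (v j) ↔ CycNear k i j := by
  refine ⟨C.square_adj_imp h5 hij hj, ?_⟩
  rintro (rfl | rfl | h | h)
  · exact square_adj_of_adj (C.adj i)
  · exact C.square_adj_add_two i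
  · rw [← C.per i, ← h]
    exact (square_adj_of_adj (C.adj j)).symm
  · rw [← C.per i, ← h]
    exact (C.square_adj_add_two j).symm

/-- A neighbour of `v s` outside the cycle is adjacent in the square only to `v s` and its two
neighbours on the cycle. -/
theorem IsGirthCycle.pendant (C : IsGirthCycle G k v) (h7 : 7 ≤ k) (s : ℕ) (hs : s ≤ k) (z : V)
    (hz : ∀ i, z ≠ v i) (hzs : G.Adj z (v s)) (j : ℕ) (hsj : s ≤ j) (hj : j < s + k)
    (h : G.square.Adj z (v j)) : j = s ∨ j = s + 1 ∨ j + 1 = s + k := by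
  have key : ∀ j, s < j → j < s + k → ¬ G.Adj z (v j) := by
    intro j h1 h2 h3
    obtain ⟨t, rfl⟩ := Nat.exists_eq_add_of_lt h1
    have h4 := C.detour_one s (t + 1) (by omega) (by omega) z hz hzs h3
    have h5 := C.detour_one (s + t + 1) (k - (t + 1)) (by omega) (by omega) z hz h3 (by
      rwa [show s + t + 1 + (k - (t + 1)) = s + k by omega, C.per])
    omega
  by_contra hcon
  obtain ⟨hne, h | ⟨w, h1, h2⟩⟩ := square_adj.1 h
  · exact key j (by omega) hj h
  by_cases hw : ∃ l < k, w = v l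
  · obtain ⟨l, hl, rfl⟩ := hw
    have hls : v l = v s := by
      have hl' : ∃ l', s ≤ l' ∧ l' < s + k ∧ v l' = v l := by
        by_cases hls : s ≤ l
        · exact ⟨l, hls, by omega, rfl⟩
        · exact ⟨l + k, by omega, by omega, C.per l⟩
      obtain ⟨l', h3, h4, h5⟩ := hl'
      rcases h3.lt_or_eq with h3 | h3
      · exact absurd (h5 ▸ h1) (key l' h3 h4)
      · rw [h3, h5]
    rw [hls] at h2
    obtain ⟨t, rfl⟩ := Nat.exists_eq_add_of_le hsj
    have := C.chord s t (by omega) (by omega) h2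
    omega
  · push Not at hw
    have ho := C.ne_of_forall_lt hw
    obtain ⟨t, rfl⟩ := Nat.exists_eq_add_of_le hsj
    have h3 := C.detour_two s t (by omega) w z ho hz h1.symm hzs h2
    have h4 := C.detour_two (s + t) (k - t) (by omega) z w hz ho h1 h2 (by
      rwa [show s + t + (k - t) = s + k by omega, C.per])
    omega
end

/-! ### Graphs of girth at least six -/

/-- The pairs of positions of the arcs in `cycleSq v n`. -/
def CycArc (n i j : ℕ) : Prop :=
  (i ≤ n ∧ j = i + 1) ∨ (i < n ∧ j = i + 2) ∨ (i = n ∧ j = 0) ∨ (i = n + 1 ∧ j = 0) ∨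
    (i = n + 1 ∧ j = 1)

theorem mem_cycleSq {V : Type*} (v : ℕ → V) (n : ℕ) (e : V × V) :
    e ∈ cycleSq v n ↔ ∃ i j, CycArc n i j ∧ i < n + 2 ∧ j < n + 2 ∧ e = (v i, v j) := by
  simp only [cycleSq, List.mem_append, List.mem_map, List.mem_range, List.mem_cons,
    List.not_mem_nil, or_false]
  constructor
  · rintro ((⟨i, hi, rfl⟩ | ⟨i, hi, rfl⟩) | rfl | rfl | rfl)
    · exact ⟨i, i + 1, by unfold CycArc; omega, by omega, by omega, rfl⟩
    · exact ⟨i, i + 2, by unfold CycArc; omega, by omega, by omega, rfl⟩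
    · exact ⟨n, 0, by unfold CycArc; omega, by omega, by omega, rfl⟩
    · exact ⟨n + 1, 0, by unfold CycArc; omega, by omega, by omega, rfl⟩
    · exact ⟨n + 1, 1, by unfold CycArc; omega, by omega, by omega, rfl⟩
  · rintro ⟨i, j, h | h | h | h | h, -, -, rfl⟩
    · exact Or.inl (Or.inl ⟨i, by omega, by rw [h.2]⟩)
    · exact Or.inl (Or.inr ⟨i, h.1, by rw [h.2]⟩)
    · simp [h.1, h.2]
    · simp [h.1, h.2]
    · simp [h.1, h.2]

theorem nodup_cycleSq {V : Type*} (v : ℕ → V) (n : ℕ) (hn : 3 ≤ n)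
    (hv : ∀ i j, i < n + 2 → j < n + 2 → v i = v j → i = j) : (cycleSq v n).Nodup := by
  have hne : ∀ i j, i < n + 2 → j < n + 2 → i ≠ j → v i ≠ v j := fun i j hi hj hij h =>
    hij (hv i j hi hj h)
  simp only [cycleSq, List.nodup_append', List.disjoint_left, List.mem_append, List.mem_map,
    List.mem_range]
  refine ⟨⟨?_, ?_, ?_⟩, ?_, ?_⟩
  · refine List.Nodup.map_on ?_ List.nodup_range
    intro i hi j hj h
    exact hv _ _ (by simp at hi; omega) (by simp at hj; omega) (Prod.ext_iff.1 h).1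
  · refine List.Nodup.map_on ?_ List.nodup_range
    intro i hi j hj h
    exact hv _ _ (by simp at hi; omega) (by simp at hj; omega) (Prod.ext_iff.1 h).1
  · rintro _ ⟨i, hi, rfl⟩ ⟨j, hj, h⟩
    have h1 := hv _ _ (by omega) (by omega) (Prod.ext_iff.1 h).1
    have h2 := hv _ _ (by omega) (by omega) (Prod.ext_iff.1 h).2
    omega
  · simp [hne n (n + 1) (by omega) (by omega) (by omega), hne 0 1 (by omega) (by omega) (by omega)]
  · rintro _ (⟨i, hi, rfl⟩ | ⟨i, hi, rfl⟩) h
    all_goals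
      simp only [List.mem_cons, List.not_mem_nil, or_false, Prod.mk.injEq] at h
      rcases h with ⟨-, h⟩ | ⟨-, h⟩ | ⟨h', h⟩
      · have := hv _ _ (by omega) (by omega) h
        omega
      · have := hv _ _ (by omega) (by omega) h
        omega
      · have := hv _ _ (by omega) (by omega) h
        have := hv _ _ (by omega) (by omega) h'
        omega

/-- A nonzero coefficient for the subgraph of the square that is induced by a shortest cycle
together with a set `P` of vertices outside of it contradicts `Bad`, if the exponents are small
enough. Every vertex of the cycle has four neighbours in the square that lie on the cycle. The list
`l` contains the edges between `P` and the cycle. -/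
theorem Bad.cycle {V : Type*} [Fintype V] {G : SimpleGraph V} {Δ m n : ℕ} (h : Bad G Δ m)
    {v : ℕ → V} (C : IsGirthCycle G (n + 2) v) (hn : 4 ≤ n) (P : Finset V)
    (hP : ∀ z ∈ P, ∀ i, z ≠ v i) (hPS : ∀ y ∈ P, ∀ z ∈ P, ¬ G.square.Adj y z)
    (l : List (V × V)) (hl : l.Nodup) (hlP : ∀ e ∈ l, e.1 ∈ P ∧ ∃ i < n + 2, e.2 = v i)
    (hlS : ∀ z ∈ P, ∀ i < n + 2, (z, v i) ∈ l ↔ G.square.Adj z (v i)) (d : V →₀ ℕ)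
    (hco : coeff d (listPoly (cycleSq v n) * listPoly l) ≠ 0)
    (hdP : ∀ z ∈ P, d z = 1 ∧ ∃ i, G.square.Adj z (v i) ∧ G.square.Adj z (v (i + 1)) ∧
      G.square.Adj z (v (i + 2)))
    (hd : ∀ i < n + 2, ∃ T ⊆ P, d (v i) ≤ 2 + T.card ∧ ∀ z ∈ T, G.square.Adj z (v i)) : False := by
  classical
  have hc : ∀ i j, i < n + 2 → j < n + 2 →
      ((v i, v j) ∈ cycleSq v n ↔ CycArc n i j) := by
    intro i j hi hj
    rw [mem_cycleSq]
    constructor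
    · rintro ⟨i', j', h1, h2, h3, h4⟩
      rwa [C.inj _ _ hi h2 (Prod.ext_iff.1 h4).1, C.inj _ _ hj h3 (Prod.ext_iff.1 h4).2]
    · exact fun h => ⟨i, j, h, hi, hj, rfl⟩
  have hcl : ∀ e ∈ cycleSq v n, ∃ i < n + 2, ∃ j < n + 2, CycArc n i j ∧ e = (v i, v j) := by
    intro e he
    obtain ⟨i, j, h1, h2, h3, h4⟩ := (mem_cycleSq v n e).1 he
    exact ⟨i, h2, j, h3, h1, h4⟩
  have hnd : (cycleSq v n ++ l).Nodup := by
    rw [List.nodup_append']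
    refine ⟨nodup_cycleSq v n (by omega) C.inj, hl, ?_⟩
    intro e he he'
    obtain ⟨i, -, j, -, -, rfl⟩ := hcl e he
    exact hP _ (hlP _ he').1 i rfl
  set H : Finset V := P ∪ (Finset.range (n + 2)).image v with hHdef
  have hvH : ∀ i, v i ∈ H := fun i => Finset.mem_union_right _ (Finset.mem_image.2
    ⟨i % (n + 2), Finset.mem_range.2 (Nat.mod_lt _ (by omega)), C.mod i⟩)
  have hmem : ∀ x ∈ H, x ∈ P ∨ ∃ i < n + 2, x = v i := by
    intro x hx
    rcases Finset.mem_union.1 hx with hx | hx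
    · exact Or.inl hx
    · obtain ⟨i, hi, rfl⟩ := Finset.mem_image.1 hx
      exact Or.inr ⟨i, Finset.mem_range.1 hi, rfl⟩
  have hvl : ∀ i x, (v i, x) ∉ l := fun i x hx => hP _ (hlP _ hx).1 i rfl
  have hzc : ∀ z ∈ P, ∀ x, (z, x) ∉ cycleSq v n ∧ (x, z) ∉ cycleSq v n := by
    intro z hz x
    constructor
    all_goals
      intro hx
      obtain ⟨i, -, j, -, -, h4⟩ := hcl _ hx
    · exact hP z hz i (Prod.ext_iff.1 h4).1
    · exact hP z hz j (Prod.ext_iff.1 h4).2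
  have hzl : ∀ z ∈ P, ∀ x, (x, z) ∉ l := by
    intro z hz x hx
    obtain ⟨i, -, h1⟩ := (hlP _ hx).2
    exact hP z hz i h1
  have hcc : ∀ i < n + 2, ∀ j < n + 2, ((v i, v j) ∈ cycleSq v n ∨ (v j, v i) ∈ cycleSq v n) ↔
      G.square.Adj (v i) (v j) := by
    intro i hi j hj
    rw [hc i j hi hj, hc j i hj hi]
    rcases Nat.lt_trichotomy i j with hij | rfl | hij
    · rw [C.square_adj_iff (by omega) hij hj]
      unfold CycArc CycNear
      omega
    · refine ⟨fun h => ?_, fun h => absurd h (G.square.irrefl)⟩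
      unfold CycArc at h
      omega
    · rw [SimpleGraph.adj_comm, C.square_adj_iff (by omega) hij hi]
      unfold CycArc CycNear
      omega
  refine h.not_has (hasATOrientation_of_coeff G h.conn m H (v 0) (v 1) (hvH 0) (hvH 1) (C.adj 0)
    (cycleSq v n ++ l).toFinset ?_ ?_ d ?_ h.sq_le ?_)
  · intro x y
    simp only [List.mem_toFinset, List.mem_append]
    constructor
    · have key : ∀ x y, ((x, y) ∈ cycleSq v n ∨ (x, y) ∈ l) →
          x ∈ H ∧ y ∈ H ∧ G.square.Adj x y := by
        rintro x y (hx | hx)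
        · obtain ⟨i, hi, j, hj, -, h4⟩ := hcl _ hx
          obtain ⟨rfl, rfl⟩ := Prod.ext_iff.1 h4
          exact ⟨hvH i, hvH j, (hcc i hi j hj).1 (Or.inl hx)⟩
        · obtain ⟨h1, i, hi, h2⟩ := hlP _ hx
          simp only at h1 h2
          subst h2
          exact ⟨Finset.mem_union_left _ h1, hvH i, (hlS x h1 i hi).1 hx⟩
      rintro (hx | hx)
      · exact key _ _ hx
      · obtain ⟨h1, h2, h3⟩ := key _ _ hx
        exact ⟨h2, h1, h3.symm⟩
    · rintro ⟨hx, hy, hxy⟩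
      rcases hmem x hx with hx | ⟨i, hi, rfl⟩ <;> rcases hmem y hy with hy | ⟨j, hj, rfl⟩
      · exact absurd hxy (hPS x hx y hy)
      · exact Or.inl (Or.inr ((hlS x hx j hj).2 hxy))
      · exact Or.inr (Or.inr ((hlS y hy i hi).2 hxy.symm))
      · exact ((hcc i hi j hj).2 hxy).imp Or.inl Or.inl
  · intro x y hx hy
    simp only [List.mem_toFinset, List.mem_append] at hx hy
    rcases hx with hx | hx
    · obtain ⟨i, hi, j, hj, h3, h4⟩ := hcl _ hx
      obtain ⟨rfl, rfl⟩ := Prod.ext_iff.1 h4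
      rcases hy with hy | hy
      · have h5 := (hc _ _ hj hi).1 hy
        unfold CycArc at h3 h5
        omega
      · exact hvl _ _ hy
    · have hxP : x ∈ P := (hlP _ hx).1
      rcases hy with hy | hy
      · exact (hzc x hxP y).2 hy
      · exact hzl x hxP _ hy
  · rwa [edgePoly_toFinset _ hnd, listPoly_append]
  · intro x hx
    have hle := h.sq_le x
    suffices d x + 2 ≤ (nbrs G.square x ∩ H).card by omega
    rcases hmem x hx with hx | ⟨i, hi, rfl⟩
    · obtain ⟨h1, i, h2, h3, h4⟩ := hdP x hx
      have hsub : ({0, 1, 2} : Finset ℕ).image (fun a => v (i + a)) ⊆ nbrs G.square x ∩ H := by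
        intro y hy
        simp only [Finset.image_insert, Finset.image_singleton, Finset.mem_insert,
          Finset.mem_singleton] at hy
        rw [Finset.mem_inter, mem_nbrs]
        rcases hy with rfl | rfl | rfl
        · exact ⟨h2, hvH _⟩
        · exact ⟨h3, hvH _⟩
        · exact ⟨h4, hvH _⟩
      have := Finset.card_le_card hsub
      rw [Finset.card_image_of_injOn] at this
      · simpa [h1] using this
      · intro a ha b hb hab
        simp only [Finset.coe_insert, Finset.coe_singleton, Set.mem_insert_iff,
          Set.mem_singleton_iff] at ha hb
        exact C.window i a b (by omega) (by omega) hab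
    · obtain ⟨T, hT, hd2, hTS⟩ := hd i hi
      have hsub : ({1, 2, n + 1, n} : Finset ℕ).image (fun a => v (i + a)) ∪ T ⊆
          nbrs G.square (v i) ∩ H := by
        intro y hy
        simp only [Finset.image_insert, Finset.image_singleton, Finset.mem_insert,
          Finset.mem_singleton, Finset.mem_union] at hy
        rw [Finset.mem_inter, mem_nbrs]
        rcases hy with (rfl | rfl | rfl | rfl) | hy
        · exact ⟨square_adj_of_adj (C.adj i), hvH _⟩
        · exact ⟨C.square_adj_add_two i, hvH _⟩
        · refine ⟨?_, hvH _⟩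
          have := square_adj_of_adj (C.adj (i + (n + 1)))
          rw [add_assoc, add_assoc, C.per] at this
          exact this.symm
        · refine ⟨?_, hvH _⟩
          have := C.square_adj_add_two (i + n)
          rw [add_assoc, C.per] at this
          exact this.symm
        · exact ⟨(hTS y hy).symm, Finset.mem_union_left _ (hT hy)⟩
      have := Finset.card_le_card hsub
      rw [Finset.card_union_of_disjoint, Finset.card_image_of_injOn] at this
      · have h4 : ({1, 2, n + 1, n} : Finset ℕ).card = 4 := by
          rw [Finset.card_insert_of_notMem, Finset.card_insert_of_notMem,
            Finset.card_insert_of_notMem, Finset.card_singleton]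
          all_goals
            simp only [Finset.mem_insert, Finset.mem_singleton]
            omega
        omega
      · intro a ha b hb hab
        simp only [Finset.coe_insert, Finset.coe_singleton, Set.mem_insert_iff,
          Set.mem_singleton_iff] at ha hb
        exact C.window i a b (by omega) (by omega) hab
      · rw [Finset.disjoint_left]
        intro y hy hyT
        obtain ⟨a, -, rfl⟩ := Finset.mem_image.1 hy
        exact hP _ (hT hyT) _ rfl

section
variable {V : Type*} {G : SimpleGraph V} {k : ℕ} {v : ℕ → V}

/-- In the square, a vertex attached to a long shortest cycle is adjacent to three consecutive
vertices of the cycle only. -/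
theorem IsGirthCycle.pendant_iff (C : IsGirthCycle G k v) (h7 : 7 ≤ k) {s : ℕ} (hs : s + 2 < k)
    {z : V} (hz : ∀ i, z ≠ v i) (hzs : G.Adj z (v (s + 1))) {i : ℕ} (hi : i < k) :
    G.square.Adj z (v i) ↔ i = s ∨ i = s + 1 ∨ i = s + 2 := by
  constructor
  · intro h
    by_cases his : s + 1 ≤ i
    · have := C.pendant h7 (s + 1) (by omega) z hz hzs i his (by omega) h
      omega
    · rw [← C.per] at h
      have := C.pendant h7 (s + 1) (by omega) z hz hzs (i + k) (by omega) (by omega) h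
      omega
  · rintro (rfl | rfl | rfl)
    · exact square_adj_of_common _ (hz _) hzs.symm (C.adj _).symm
    · exact square_adj_of_adj hzs
    · exact square_adj_of_common _ (hz _) hzs.symm (C.adj _)

theorem IsGirthCycle.six_le (C : IsGirthCycle G k v) (hG : GirthFive G)
    (hp : ∀ a b c d e, ¬ IsPentagon G a b c d e) : 6 ≤ k := by
  have h3 := C.three_le
  by_contra h6
  have hk : k = 3 ∨ k = 4 ∨ k = 5 := by omega
  have hper := C.per 0
  rcases hk with rfl | rfl | rfl
  · have := C.adj 2
    rw [hper] at this
    exact hG.no_triangle (C.adj 0) (C.adj 1) this.symm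
  · have := C.adj 3
    rw [hper] at this
    have h1 := hG.eq_of_common (fun h => absurd (C.inj 0 2 (by omega) (by omega) h) (by norm_num))
      (C.adj 0) (C.adj 1) this.symm (C.adj 2).symm
    exact absurd (C.inj 1 3 (by omega) (by omega) h1) (by norm_num)
  · have := C.adj 4
    rw [hper] at this
    exact hp _ _ _ _ _ ⟨C.adj 0, C.adj 1, C.adj 2, C.adj 3, this⟩

end

section
variable {V : Type*} [Fintype V] {G : SimpleGraph V} {Δ m k : ℕ} {v : ℕ → V}

theorem IsGirthCycle.exists_pendant (C : IsGirthCycle G k v) (hdeg : ∀ v, 3 ≤ (nbrs G v).card)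
    (s : ℕ) (hs : s + 2 < k) : ∃ z, G.Adj z (v (s + 1)) ∧ ∀ i, z ≠ v i := by
  classical
  obtain ⟨z, hz, hz'⟩ : ∃ z ∈ nbrs G (v (s + 1)), z ∉ ({v s, v (s + 2)} : Finset V) := by
    by_contra hcon
    push Not at hcon
    have := Finset.card_le_card (show nbrs G (v (s + 1)) ⊆ {v s, v (s + 2)} from hcon)
    have h2 := Finset.card_le_two (a := v s) (b := v (s + 2))
    have := hdeg (v (s + 1))
    omega
  rw [mem_nbrs] at hz
  simp only [Finset.mem_insert, Finset.mem_singleton, not_or] at hz'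
  refine ⟨z, hz.symm, C.ne_of_forall_lt ?_⟩
  rintro i hi rfl
  rcases Nat.lt_trichotomy (s + 1) i with h | h | h
  · rcases C.adj_imp h hi hz with h | h
    · exact hz'.2 (by rw [h])
    · exact hz'.1 (by rw [← C.per s]; congr 1; omega)
  · exact absurd hz (h ▸ G.irrefl)
  · rcases C.adj_imp h (by omega) hz.symm with h | h
    · exact hz'.1 (by congr 1; omega)
    · omega

theorem listPoly_pendant_mem_supported {V : Type*} (l : List (V × V)) (v : ℕ → V) (P : Set V)
    (k : ℕ) (h : ∀ e ∈ l, e.1 ∈ P ∧ ∃ i < k, e.2 = v i) :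
    listPoly l ∈ supported ℤ (P ∪ v '' {i | i < k}) := by
  refine listPoly_mem_supported _ _ fun e he => ?_
  obtain ⟨h1, i, hi, h2⟩ := h e he
  exact ⟨Or.inl h1, Or.inr ⟨i, hi, h2.symm⟩⟩

/-- Length divisible by three: all exponents on the cycle are `2`. -/
theorem Bad.no_cycle_of_mod_zero (h : Bad G Δ m) (j : ℕ) (hj : 1 ≤ j)
    (C : IsGirthCycle G (1 + 3 * j + 2) v) : False := by
  classical
  have h1 := coeff_cycleSq v 1 (fun _ => 2) (fun _ _ => rfl) ∅ 1 0 (by simp) (one_mem _) j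
    (by rw [show 1 + 2 + 3 * j = 1 + 3 * j + 2 by ring]; exact C.inj) (by simp)
  refine h.cycle C (by omega) ∅ (by simp) (by simp) [] (by simp) (by simp) (by simp)
    (cycleExp v (fun _ => 2) (1 + 2 + 3 * j)) ?_ (by simp) ?_
  · have h2 := coeff_cycleSq_three v (fun a b ha hb => C.inj a b (by omega) (by omega))
    rw [add_zero, add_zero, mul_one, mul_one] at h1
    simpa [listPoly] using h1.trans_ne h2
  · intro i hi
    refine ⟨∅, by simp, ?_, by simp⟩
    rw [cycleExp_apply v _ _ (by rw [show 1 + 2 + 3 * j = 1 + 3 * j + 2 by ring]; exact C.inj) i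
      (by omega)]
    simp

/-- Length `1` modulo three: one pendant vertex is added. -/
theorem Bad.no_cycle_of_mod_one (h : Bad G Δ m) (hdeg : ∀ v, 3 ≤ (nbrs G v).card) (j : ℕ) (hj : 1 ≤ j)
    (C : IsGirthCycle G (2 + 3 * j + 2) v) : False := by
  classical
  obtain ⟨x, hx1, hxv⟩ := C.exists_pendant hdeg 0 (by omega)
  have hxS : ∀ i < 2 + 3 * j + 2, G.square.Adj x (v i) ↔ i = 0 ∨ i = 1 ∨ i = 2 := fun i hi =>
    C.pendant_iff (by omega) (s := 0) (by omega) hxv hx1 hi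
  have hinj : ∀ a b, a < 2 + 2 + 3 * j → b < 2 + 2 + 3 * j → v a = v b → a = b := fun a b ha hb =>
    C.inj a b (by omega) (by omega)
  set δ : ℕ → ℕ := fun i => ([2, 3, 3, 2] : List ℕ).getD i 2 with hδ
  set l := [(x, v 0), (x, v 1), (x, v 2)] with hl
  have hδ2 : ∀ i, 3 ≤ i → δ i = 2 := by
    intro i hi
    obtain ⟨i, rfl⟩ := Nat.exists_eq_add_of_le' hi
    rcases i with _ | i <;> rfl
  have hvne : ∀ a b, a < 4 → b < 4 → a ≠ b → v a ≠ v b := fun a b ha hb hab h =>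
    hab (C.inj a b (by omega) (by omega) h)
  have hlP : ∀ e ∈ l, e.1 ∈ ({x} : Finset V) ∧ ∃ i < 4, e.2 = v i := by
    intro e he
    simp only [hl, List.mem_cons, List.not_mem_nil, or_false] at he
    rcases he with rfl | rfl | rfl
    · exact ⟨by simp, 0, by omega, rfl⟩
    · exact ⟨by simp, 1, by omega, rfl⟩
    · exact ⟨by simp, 2, by omega, rfl⟩
  have h1 := coeff_cycleSq v 2 δ (fun i hi => hδ2 i (by omega)) (({x} : Finset V) : Set V)
    (listPoly l) (Finsupp.single x 1) (fun y hy => Finsupp.single_eq_of_ne (by simpa using hy))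
    (listPoly_pendant_mem_supported _ _ _ _ hlP) j hinj (by
      intro y hy i hi
      rw [Finset.mem_coe, Finset.mem_singleton] at hy
      exact hy ▸ hxv i)
  refine h.cycle C (by omega) {x} (by simpa using hxv) (by simp) l ?_ ?_ ?_
    (cycleExp v δ (2 + 2 + 3 * j) + Finsupp.single x 1) ?_ ?_ ?_
  · simp [hl, hvne]
  · intro e he
    obtain ⟨h2, i, hi, h3⟩ := hlP e he
    exact ⟨h2, i, by omega, h3⟩
  · intro z hz i hi
    rw [Finset.mem_singleton] at hz
    subst hz
    rw [hxS i hi]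
    simp only [hl, List.mem_cons, List.not_mem_nil, or_false, Prod.mk.injEq, true_and]
    refine or_congr ?_ (or_congr ?_ ?_)
    all_goals exact ⟨fun h => C.inj _ _ hi (by omega) h, fun h => by rw [h]⟩
  · exact h1.trans_ne (coeff_cycleSq_four v x (fun a b ha hb => hinj a b (by omega) (by omega))
      (fun i _ => hxv i))
  · intro z hz
    rw [Finset.mem_singleton] at hz
    subst hz
    refine ⟨?_, 0, (hxS _ (by omega)).2 (by simp), (hxS _ (by omega)).2 (by simp),
      (hxS _ (by omega)).2 (by simp)⟩
    rw [Finsupp.add_apply, cycleExp_apply_of_ne _ _ _ _ (fun i _ => hxv i), Finsupp.single_eq_same]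
  · intro i hi
    have h3 : (cycleExp v δ (2 + 2 + 3 * j) + Finsupp.single x 1 : V →₀ ℕ) (v i) = δ i := by
      rw [Finsupp.add_apply, cycleExp_apply _ _ _ hinj _ (by omega),
        Finsupp.single_eq_of_ne (hxv i).symm, add_zero]
    rw [h3]
    by_cases hi3 : i ≤ 2
    · refine ⟨{x}, le_rfl, ?_, by simpa using (hxS i hi).2 (by omega)⟩
      interval_cases i <;> simp [hδ]
    · exact ⟨∅, by simp, by rw [hδ2 i (by omega)]; simp, by simp⟩

/-- Length `2` modulo three: pendant vertices at two consecutive vertices are added. -/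
theorem Bad.no_cycle_of_mod_two (h : Bad G Δ m) (hdeg : ∀ v, 3 ≤ (nbrs G v).card) (hG : GirthFive G)
    (hp : ∀ a b c d e, ¬ IsPentagon G a b c d e) (j : ℕ)
    (C : IsGirthCycle G (6 + 3 * j + 2) v) : False := by
  classical
  obtain ⟨x, hx1, hxv⟩ := C.exists_pendant hdeg 0 (by omega)
  obtain ⟨y, hy1, hyv⟩ := C.exists_pendant hdeg 1 (by omega)
  have hxS : ∀ i < 6 + 3 * j + 2, G.square.Adj x (v i) ↔ i = 0 ∨ i = 1 ∨ i = 2 := fun i hi =>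
    C.pendant_iff (by omega) (s := 0) (by omega) hxv hx1 hi
  have hyS : ∀ i < 6 + 3 * j + 2, G.square.Adj y (v i) ↔ i = 1 ∨ i = 2 ∨ i = 3 := fun i hi =>
    C.pendant_iff (by omega) (s := 1) (by omega) hyv hy1 hi
  have hxyS : ¬ G.square.Adj x y := by
    intro hS
    obtain ⟨hne, hS | ⟨w, h1, h2⟩⟩ := square_adj.1 hS
    · exact hxv 2 (hG.eq_of_common (a := v 1) (b := y)
        (fun h' => hyv _ h'.symm) hx1.symm hS (C.adj 1) hy1.symm)
    · exact hp _ _ _ _ _ ⟨hx1.symm, h1, h2, hy1, (C.adj 1).symm⟩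
  have hxy : x ≠ y := by
    rintro rfl
    have := (hxS 3 (by omega)).1 ((hyS 3 (by omega)).2 (by simp))
    omega
  have hinj : ∀ a b, a < 6 + 2 + 3 * j → b < 6 + 2 + 3 * j → v a = v b → a = b := fun a b ha hb =>
    C.inj a b (by omega) (by omega)
  set δ : ℕ → ℕ := fun i => ([3, 4, 3, 3, 2, 1] : List ℕ).getD i 2 with hδ
  set l := [(x, v 0), (x, v 1), (x, v 2), (y, v 1), (y, v 2), (y, v 3)] with hl
  have hδ2 : ∀ i, 4 ≤ i → δ i ≤ 2 := by
    intro i hi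
    obtain ⟨i, rfl⟩ := Nat.exists_eq_add_of_le' hi
    rcases i with _ | _ | i <;> simp [hδ]
  have hvne : ∀ a b, a < 4 → b < 4 → a ≠ b → v a ≠ v b := fun a b ha hb hab h =>
    hab (C.inj a b (by omega) (by omega) h)
  have hlP : ∀ e ∈ l, e.1 ∈ ({x, y} : Finset V) ∧ ∃ i < 8, e.2 = v i := by
    intro e he
    simp only [hl, List.mem_cons, List.not_mem_nil, or_false] at he
    rcases he with rfl | rfl | rfl | rfl | rfl | rfl
    · exact ⟨by simp, 0, by omega, rfl⟩
    · exact ⟨by simp, 1, by omega, rfl⟩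
    · exact ⟨by simp, 2, by omega, rfl⟩
    · exact ⟨by simp, 1, by omega, rfl⟩
    · exact ⟨by simp, 2, by omega, rfl⟩
    · exact ⟨by simp, 3, by omega, rfl⟩
  have hP : ∀ z ∈ ({x, y} : Finset V), ∀ i, z ≠ v i := by
    intro z hz i
    rcases Finset.mem_insert.1 hz with rfl | hz
    · exact hxv i
    · rw [Finset.mem_singleton.1 hz]
      exact hyv i
  have h1 := coeff_cycleSq v 6 δ (fun i hi => by
      obtain ⟨i, rfl⟩ := Nat.exists_eq_add_of_le' hi
      rfl) (({x, y} : Finset V) : Set V)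
    (listPoly l) (Finsupp.single x 1 + Finsupp.single y 1) (fun z hz => by
      simp only [Finset.coe_insert, Finset.coe_singleton, Set.mem_insert_iff,
        Set.mem_singleton_iff, not_or] at hz
      rw [Finsupp.add_apply, Finsupp.single_eq_of_ne hz.1, Finsupp.single_eq_of_ne hz.2,
        add_zero])
    (listPoly_pendant_mem_supported _ _ _ _ hlP) j hinj (fun z hz i _ => hP z hz i)
  refine h.cycle C (by omega) {x, y} hP ?_ l ?_ ?_ ?_
    (cycleExp v δ (6 + 2 + 3 * j) + (Finsupp.single x 1 + Finsupp.single y 1)) ?_ ?_ ?_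
  · intro a ha b hb
    simp only [Finset.mem_insert, Finset.mem_singleton] at ha hb
    rcases ha with rfl | rfl <;> rcases hb with rfl | rfl
    · exact G.square.irrefl
    · exact hxyS
    · exact fun h => hxyS h.symm
    · exact G.square.irrefl
  · simp [hl, hvne, hxy]
  · intro e he
    obtain ⟨h2, i, hi, h3⟩ := hlP e he
    exact ⟨h2, i, by omega, h3⟩
  · intro z hz i hi
    have hvi : ∀ a, a < 4 → (v i = v a ↔ i = a) := fun a ha =>
      ⟨fun h => C.inj _ _ hi (by omega) h, fun h => by rw [h]⟩
    rcases Finset.mem_insert.1 hz with rfl | hz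
    · rw [hxS i hi]
      simp [hl, hxy, hvi]
    · rw [Finset.mem_singleton.1 hz, hyS i hi]
      simp [hl, hxy.symm, hvi]
  · exact h1.trans_ne (coeff_cycleSq_eight v x y (fun a b ha hb => hinj a b (by omega) (by omega))
      (fun i _ => hxv i) (fun i _ => hyv i) hxy)
  · intro z hz
    rw [Finsupp.add_apply, cycleExp_apply_of_ne _ _ _ _ (fun i _ => hP z hz i)]
    rcases Finset.mem_insert.1 hz with rfl | hz
    · exact ⟨by simp [hxy], 0, (hxS _ (by omega)).2 (by simp), (hxS _ (by omega)).2 (by simp),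
        (hxS _ (by omega)).2 (by simp)⟩
    · rw [Finset.mem_singleton.1 hz]
      exact ⟨by simp [hxy.symm], 1, (hyS _ (by omega)).2 (by simp), (hyS _ (by omega)).2 (by simp),
        (hyS _ (by omega)).2 (by simp)⟩
  · intro i hi
    have h3 : (cycleExp v δ (6 + 2 + 3 * j) + (Finsupp.single x 1 + Finsupp.single y 1) :
        V →₀ ℕ) (v i) =
        δ i := by
      rw [Finsupp.add_apply, cycleExp_apply _ _ _ hinj _ (by omega), Finsupp.add_apply,
        Finsupp.single_eq_of_ne (hxv i).symm, Finsupp.single_eq_of_ne (hyv i).symm, add_zero,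
        add_zero]
    rw [h3]
    rcases Nat.lt_or_ge i 4 with hi4 | hi4
    · interval_cases i
      · exact ⟨{x}, by simp, by simp [hδ], by simpa using (hxS 0 hi).2 (by simp)⟩
      · exact ⟨{x, y}, le_rfl, by simp [hδ, hxy], by
          simpa using ⟨(hxS 1 hi).2 (by simp), (hyS 1 hi).2 (by simp)⟩⟩
      · exact ⟨{x, y}, le_rfl, by simp [hδ, hxy], by
          simpa using ⟨(hxS 2 hi).2 (by simp), (hyS 2 hi).2 (by simp)⟩⟩
      · exact ⟨{y}, by simp, by simp [hδ], by simpa using (hyS 3 hi).2 (by simp)⟩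
    · exact ⟨∅, by simp, by simpa using hδ2 i hi4, by simp⟩

/-- A regular graph that satisfies `Bad` contains a cycle of length at most `5`. -/
theorem Bad.exists_short_cycle (h : Bad G Δ m) (hreg : ∀ v, (nbrs G v).card = Δ)
    (hG : GirthFive G) : ∃ a b c d e, IsPentagon G a b c d e := by
  by_contra hp
  push Not at hp
  have hdeg : ∀ v, 3 ≤ (nbrs G v).card := fun v => (hreg v).symm ▸ h.three_le
  obtain ⟨k, v, C⟩ := exists_isGirthCycle G h.conn hdeg
  have h6 := C.six_le hG hp
  have hk : ∃ j, (k = 1 + 3 * j + 2 ∧ 1 ≤ j) ∨ (k = 2 + 3 * j + 2 ∧ 1 ≤ j) ∨ k = 6 + 3 * j + 2 := by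
    rcases Nat.lt_or_ge (k % 3) 1 with h0 | h0
    · exact ⟨k / 3 - 1, by omega⟩
    rcases Nat.lt_or_ge (k % 3) 2 with h1 | h1
    · exact ⟨k / 3 - 1, by omega⟩
    · exact ⟨k / 3 - 2, by omega⟩
  obtain ⟨j, ⟨rfl, hj⟩ | ⟨rfl, hj⟩ | rfl⟩ := hk
  · exact h.no_cycle_of_mod_zero j hj C
  · exact h.no_cycle_of_mod_one hdeg j hj C
  · exact h.no_cycle_of_mod_two hdeg hG hp j C

end

/-! ### Eigenvalue multiplicities -/

/-- The trace of an idempotent matrix is its rank. -/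
theorem exists_nat_trace_of_idempotent {V : Type*} [Fintype V] (M : Matrix V V ℝ)
    (hM : M * M = M) : ∃ b : ℕ, M.trace = b := by
  classical
  have h : IsIdempotentElem (Matrix.toLin' M) := by
    rw [IsIdempotentElem, Module.End.mul_eq_comp, ← Matrix.toLin'_mul, hM]
  have h2 := (LinearMap.IsIdempotentElem.isProj_range _ h).trace
  exact ⟨_, (Matrix.trace_toLin'_eq M).symm.trans h2⟩

/-- If `A` satisfies `A ^ 2 + A = c` on the image of an idempotent `E` commuting with it, then its
eigenvalues there are `(- 1 ± r) / 2` with `r ^ 2 = 1 + 4 c`, and `E * (A - (- 1 - r) / 2) / r` is the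
projection to the eigenspace for the larger one. Its trace `b` is a natural number. -/
theorem exists_nat_eq_of_quadratic {V : Type*} [Fintype V] [DecidableEq V] (A E : Matrix V V ℝ)
    (c r : ℝ) (hr : r ^ 2 = 1 + 4 * c) (hr0 : r ≠ 0) (hE : E * E = E) (hAE : A * E = E * A)
    (hA : E * A * A = c • E - E * A) :
    ∃ b : ℕ, 2 * b * r = 2 * (E * A).trace + (1 + r) * E.trace := by
  have h1 : (E * A) * E = E * A := by rw [mul_assoc, hAE, ← mul_assoc, hE]
  have h2 : (E * A) * (E * A) = c • E - E * A := by rw [← mul_assoc, h1, hA]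
  have h3 : E * (E * A) = E * A := by rw [← mul_assoc, hE]
  obtain ⟨b, hb⟩ := exists_nat_trace_of_idempotent (r⁻¹ • (E * A) + ((1 + r) / 2 * r⁻¹) • E) (by
    simp only [add_mul, mul_add, smul_mul_smul_comm, h1, h2, h3, hE]
    ext i j
    simp only [Matrix.add_apply, Matrix.smul_apply, Matrix.sub_apply, smul_eq_mul]
    have hc : c = (r ^ 2 - 1) / 4 := by linarith
    rw [hc]
    field_simp
    ring)
  refine ⟨b, ?_⟩
  rw [Matrix.trace_add, Matrix.trace_smul, Matrix.trace_smul, smul_eq_mul, smul_eq_mul] at hb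
  rw [← hb]
  field_simp

/-- A square root that is rational is an integer. -/
theorem exists_eq_sq_of_mul_sqrt {D : ℕ} {r : ℝ} (hr : r ^ 2 = D) {z w : ℤ} (hw : w ≠ 0)
    (h : r * z = w) : ∃ t : ℕ, D = t ^ 2 ∧ (t : ℤ) ∣ w := by
  have h1 : (D : ℤ) * z ^ 2 = w ^ 2 := by
    have : ((D : ℝ)) * (z : ℝ) ^ 2 = (w : ℝ) ^ 2 := by rw [← hr, ← h]; ring
    exact_mod_cast this
  obtain ⟨t, ht⟩ := (Int.pow_dvd_pow_iff two_ne_zero).1 (Dvd.intro_left _ h1)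
  have hz : z ≠ 0 := by
    rintro rfl
    simp at ht
    exact hw ht
  refine ⟨t.natAbs, ?_, ?_⟩
  · have h2 : (D : ℤ) = t ^ 2 := by
      have : (D : ℤ) * z ^ 2 = t ^ 2 * z ^ 2 := by rw [h1, ht]; ring
      exact mul_right_cancel₀ (pow_ne_zero 2 hz) this
    zify
    rw [h2, sq_abs]
  · rw [Int.natAbs_dvd]
    exact Dvd.intro_left _ ht.symm

open Classical in
/-- The matrix `A ^ 2 + A - (d - 1) - J`, where `A` is the adjacency matrix and `J` is the all-ones
matrix. -/
noncomputable def defect {V : Type*} [Fintype V] (G : SimpleGraph V) (d : ℕ) : Matrix V V ℝ :=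
  G.adjMatrix ℝ * G.adjMatrix ℝ + G.adjMatrix ℝ - ((d : ℝ) - 1) • 1 - Matrix.of fun _ _ => 1

section
variable {V : Type*} [Fintype V] {G : SimpleGraph V} {d : ℕ}

open Classical in
theorem adjMatrix_mul_ones (hreg : ∀ v, (nbrs G v).card = d) :
    G.adjMatrix ℝ * Matrix.of (fun _ _ => 1) = (d : ℝ) • Matrix.of fun _ _ => 1 := by
  ext u v
  simp only [Matrix.mul_apply, SimpleGraph.adjMatrix_apply, Matrix.of_apply, mul_one,
    Finset.sum_boole, Matrix.smul_apply, smul_eq_mul, ← hreg u]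
  congr 2

open Classical in
theorem ones_mul_adjMatrix (hreg : ∀ v, (nbrs G v).card = d) :
    Matrix.of (fun _ _ => 1) * G.adjMatrix ℝ = (d : ℝ) • Matrix.of fun _ _ => 1 := by
  have h := congrArg Matrix.transpose (adjMatrix_mul_ones hreg)
  rw [Matrix.transpose_mul, SimpleGraph.transpose_adjMatrix, Matrix.transpose_smul] at h
  exact h

theorem ones_mul_ones : (Matrix.of fun _ _ => 1 : Matrix V V ℝ) * (Matrix.of fun _ _ => 1) =
    (Fintype.card V : ℝ) • Matrix.of fun _ _ => 1 := by
  ext u v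
  simp [Matrix.mul_apply]

open Classical in
theorem defect_apply_self (hreg : ∀ v, (nbrs G v).card = d) (u : V) : defect G d u u = 0 := by
  have h : (G.adjMatrix ℝ * G.adjMatrix ℝ) u u = d := by
    rw [← hreg u]
    simp only [Matrix.mul_apply, SimpleGraph.adjMatrix_apply, mul_ite, mul_one, mul_zero,
      ← ite_and, Finset.sum_boole]
    congr 2
    ext w
    simp [G.adj_comm w u]
  simp [defect, Matrix.sub_apply, h]

open Classical in
theorem defect_apply_of_ne {u v : V} (huv : u ≠ v) : defect G d u v =
    (nbrs G u ∩ nbrs G v).card + (if G.Adj u v then 1 else 0) - 1 := by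
  have h : (G.adjMatrix ℝ * G.adjMatrix ℝ) u v = (nbrs G u ∩ nbrs G v).card := by
    simp only [Matrix.mul_apply, SimpleGraph.adjMatrix_apply, mul_ite, mul_one, mul_zero,
      ← ite_and, Finset.sum_boole]
    congr 2
    ext w
    simp [G.adj_comm w v, and_comm]
  simp [defect, Matrix.sub_apply, h, Matrix.one_apply_ne huv]

/-- If the square of a regular graph is complete, the entries of `defect` are natural numbers. -/
theorem exists_nat_defect (hreg : ∀ v, (nbrs G v).card = d)
    (hS : ∀ u v, u ≠ v → G.square.Adj u v) (u v : V) : ∃ q : ℕ, defect G d u v = q := by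
  classical
  by_cases huv : u = v
  · exact ⟨0, by rw [huv, defect_apply_self hreg]; simp⟩
  rw [defect_apply_of_ne huv]
  obtain ⟨-, h | ⟨w, h1, h2⟩⟩ := square_adj.1 (hS u v huv)
  · exact ⟨(nbrs G u ∩ nbrs G v).card, by simp [h]⟩
  · have h0 : 0 < (nbrs G u ∩ nbrs G v).card :=
      Finset.card_pos.2 ⟨w, by simp [h1, h2.symm]⟩
    refine ⟨(nbrs G u ∩ nbrs G v).card - 1 + if G.Adj u v then 1 else 0, ?_⟩
    push_cast [Nat.cast_sub h0]
    ring

open Classical in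
theorem defect_mul_ones (hreg : ∀ v, (nbrs G v).card = d) :
    defect G d * Matrix.of (fun _ _ => 1) =
      ((d : ℝ) ^ 2 + 1 - Fintype.card V) • Matrix.of fun _ _ => 1 := by
  rw [defect, sub_mul, sub_mul, add_mul, mul_assoc, adjMatrix_mul_ones hreg, Matrix.mul_smul,
    adjMatrix_mul_ones hreg, Matrix.smul_mul, one_mul, ones_mul_ones]
  ext i j
  simp only [Matrix.sub_apply, Matrix.add_apply, Matrix.smul_apply, Matrix.of_apply, smul_eq_mul]
  ring

theorem sum_defect (hreg : ∀ v, (nbrs G v).card = d) (u : V) :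
    ∑ v, defect G d u v = (d : ℝ) ^ 2 + 1 - Fintype.card V := by
  have h := congrFun (congrFun (defect_mul_ones hreg) u) u
  simpa [Matrix.mul_apply] using h

open Classical in
theorem transpose_defect : (defect G d).transpose = defect G d := by
  rw [defect]
  simp only [Matrix.transpose_sub, Matrix.transpose_add, Matrix.transpose_mul,
    SimpleGraph.transpose_adjMatrix, Matrix.transpose_smul, Matrix.transpose_one]
  rfl

open Classical in
theorem adjMatrix_mul_defect (hreg : ∀ v, (nbrs G v).card = d) :
    G.adjMatrix ℝ * defect G d = defect G d * G.adjMatrix ℝ := by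
  rw [defect]
  simp only [sub_mul, mul_sub, add_mul, mul_add, adjMatrix_mul_ones hreg, ones_mul_adjMatrix hreg,
    Matrix.smul_mul, Matrix.mul_smul, one_mul, mul_one, mul_assoc]

open Classical in
theorem adjMatrix_sq (G : SimpleGraph V) (d : ℕ) : G.adjMatrix ℝ * G.adjMatrix ℝ =
    defect G d - G.adjMatrix ℝ + ((d : ℝ) - 1) • 1 + Matrix.of fun _ _ => 1 := by
  rw [defect]
  abel

/-- The degree of a Moore graph, by the theorem of Hoffman and Singleton. As the entries of `defect` are
nonnegative with sum zero, it vanishes, so that `A ^ 2 + A = d - 1` on the complement of the constant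
vectors, where `A` has trace `-d`. The multiplicities of the eigenvalues can only be integers if
`4 d - 3` is the square of a divisor of `15`. -/
theorem moore_degree (hreg : ∀ v, (nbrs G v).card = d) (hd : 3 ≤ d)
    (hcard : Fintype.card V = d ^ 2 + 1) (hS : ∀ u v, u ≠ v → G.square.Adj u v) :
    d = 3 ∨ d = 7 ∨ d = 57 := by
  classical
  have hQ : defect G d = 0 := by
    ext u v
    have h1 := sum_defect hreg u
    rw [hcard] at h1
    push_cast at h1
    rw [sub_self, Finset.sum_eq_zero_iff_of_nonneg] at h1
    · exact h1 v (Finset.mem_univ v)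
    · intro w _
      obtain ⟨q, hq⟩ := exists_nat_defect hreg hS u w
      exact hq ▸ Nat.cast_nonneg q
  set A := G.adjMatrix ℝ with hA
  set J : Matrix V V ℝ := Matrix.of fun _ _ => 1 with hJ
  have hAJ : A * J = (d : ℝ) • J := adjMatrix_mul_ones hreg
  have hJA : J * A = (d : ℝ) • J := ones_mul_adjMatrix hreg
  have hJJ : J * J = (Fintype.card V : ℝ) • J := ones_mul_ones
  have hAA : A * A = 0 - A + ((d : ℝ) - 1) • 1 + J := hQ ▸ adjMatrix_sq G d
  have hn : (Fintype.card V : ℝ) = d ^ 2 + 1 := by rw [hcard]; push_cast; ring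
  have hn0 : (d : ℝ) ^ 2 + 1 ≠ 0 := by positivity
  rw [hn] at hJJ
  have hd' : (3 : ℝ) ≤ d := by exact_mod_cast hd
  set r := √(4 * (d : ℝ) - 3) with hr
  have hr2 : r ^ 2 = 4 * (d : ℝ) - 3 := Real.sq_sqrt (by linarith)
  have hr0 : r ≠ 0 := (Real.sqrt_pos.2 (by linarith)).ne'
  have htJA : (J * A).trace = d * (d ^ 2 + 1) := by
    rw [hJA, Matrix.trace_smul, Matrix.trace]
    simp [hJ, hn]
  have htJ : J.trace = d ^ 2 + 1 := by
    rw [Matrix.trace]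
    simp [hJ, hn]
  have htA : A.trace = 0 := by simp [hA]
  obtain ⟨b, hb⟩ := exists_nat_eq_of_quadratic A (1 - ((d : ℝ) ^ 2 + 1)⁻¹ • J) (d - 1) r
    (by rw [hr2]; ring) hr0
    (by
      simp only [sub_mul, mul_sub, Matrix.smul_mul, Matrix.mul_smul, one_mul, mul_one, hJJ, smul_smul,
        inv_mul_cancel₀ hn0]
      simp)
    (by
      simp only [sub_mul, mul_sub, Matrix.smul_mul, Matrix.mul_smul, one_mul, mul_one, hAJ, hJA])
    (by
      simp only [sub_mul, Matrix.smul_mul, one_mul, hJA, smul_smul, hAA]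
      ext i j
      simp only [hJ, Matrix.sub_apply, Matrix.add_apply, Matrix.smul_apply, Matrix.of_apply,
        smul_eq_mul, Matrix.zero_apply]
      field_simp
      ring)
  simp only [sub_mul, Matrix.smul_mul, one_mul, Matrix.trace_sub, Matrix.trace_smul, htJA, htJ, htA,
    Matrix.trace_one, hn, smul_eq_mul] at hb
  have hb2 : r * ((2 * b - d ^ 2 : ℤ) : ℝ) = ((d ^ 2 - 2 * d : ℤ) : ℝ) := by
    push_cast
    field_simp at hb
    linarith
  obtain ⟨t, ht, htd⟩ := exists_eq_sq_of_mul_sqrt (D := 4 * d - 3) (by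
    rw [hr2, Nat.cast_sub (by omega)]
    push_cast
    ring) (by nlinarith) hb2
  have h16 : (16 : ℤ) * (d ^ 2 - 2 * d) = t ^ 4 - 2 * t ^ 2 - 15 := by
    have : (4 * d : ℤ) = t ^ 2 + 3 := by
      have h : 4 * d = t ^ 2 + 3 := by omega
      exact_mod_cast h
    have e : (16 : ℤ) * (d ^ 2 - 2 * d) = (4 * d) ^ 2 - 8 * (4 * d) := by ring
    rw [e, this]
    ring
  have h15 : t ∣ 15 := by
    have h1 : (t : ℤ) ∣ 15 := by
      have h2 : (15 : ℤ) = t * (t ^ 3 - 2 * t) - 16 * (d ^ 2 - 2 * d) := by rw [h16]; ring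
      rw [h2]
      exact dvd_sub (dvd_mul_right _ _) (htd.mul_left _)
    exact_mod_cast h1
  have ht15 : t ≤ 15 := Nat.le_of_dvd (by norm_num) h15
  interval_cases t <;> omega
/-- If the square is complete on `d ^ 2` vertices, then `defect` is a symmetric matrix of natural
numbers with row sums `1`, which is the matrix of an involution. -/
theorem defect_mul_self [DecidableEq V] (hreg : ∀ v, (nbrs G v).card = d)
    (hcard : Fintype.card V = d ^ 2) (hS : ∀ u v, u ≠ v → G.square.Adj u v) :
    defect G d * defect G d = 1 := by
  classical
  choose q hq using exists_nat_defect hreg hS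
  have hsum : ∀ u, ∑ v, q u v = 1 := by
    intro u
    have h := sum_defect hreg u
    simp only [hq, hcard] at h
    push_cast at h
    rw [add_sub_cancel_left] at h
    exact_mod_cast h
  have hsymm : ∀ u v, q u v = q v u := by
    intro u v
    have h := congrFun (congrFun (transpose_defect (G := G) (d := d)) v) u
    rw [Matrix.transpose_apply, hq, hq] at h
    exact_mod_cast h
  ext u w
  have h1 : (defect G d * defect G d) u w = ((∑ v, q u v * q v w : ℕ) : ℝ) := by
    rw [Matrix.mul_apply]
    push_cast
    simp only [hq]
  rw [h1]
  by_cases huw : u = w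
  · subst huw
    rw [Matrix.one_apply_eq]
    have h2 : ∑ v, q u v * q v u = 1 := by
      rw [← hsum u]
      refine Finset.sum_congr rfl fun v _ => ?_
      have h3 : q u v ≤ 1 := (hsum u) ▸ Finset.single_le_sum (f := q u) (by simp) (Finset.mem_univ v)
      rw [hsymm v u]
      interval_cases q u v <;> rfl
    rw [h2, Nat.cast_one]
  · rw [Matrix.one_apply_ne huw, Nat.cast_eq_zero]
    refine Finset.sum_eq_zero fun v _ => ?_
    have h3 : q v u + q v w ≤ 1 := by
      rw [← hsum v, ← Finset.sum_pair huw]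
      exact Finset.sum_le_sum_of_subset (by simp)
    rw [hsymm u v]
    rcases Nat.eq_zero_or_pos (q v u) with h4 | h4
    · rw [h4, zero_mul]
    · rw [show q v w = 0 by omega, mul_zero]

/-- No triangle-free regular graph of degree `d ≥ 3` on `d ^ 2` vertices has a complete square. Here
`defect` is an involution `Q` that commutes with `A`, and the multiplicities of the eigenvalues of
`A` on the eigenspaces of `Q` make both `4 d - 7` and `4 d + 1` perfect squares. -/
theorem not_card_eq_sq (hreg : ∀ v, (nbrs G v).card = d) (hd : 3 ≤ d)
    (hcard : Fintype.card V = d ^ 2) (hS : ∀ u v, u ≠ v → G.square.Adj u v)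
    (htri : ∀ a b c, G.Adj a b → G.Adj b c → ¬ G.Adj a c) : False := by
  classical
  have hQQ := defect_mul_self hreg hcard hS
  have hn : (Fintype.card V : ℝ) = d ^ 2 := by rw [hcard]; push_cast; ring
  have hQJ := defect_mul_ones hreg
  rw [hn, add_sub_cancel_left, one_smul] at hQJ
  have hJQ := congrArg Matrix.transpose hQJ
  rw [Matrix.transpose_mul, transpose_defect] at hJQ
  have htQ : (defect G d).trace = 0 := Finset.sum_eq_zero fun u _ => defect_apply_self hreg u
  have htQA : (defect G d * G.adjMatrix ℝ).trace = 0 := by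
    refine Finset.sum_eq_zero fun u _ => ?_
    rw [Matrix.diag_apply, Matrix.mul_apply]
    refine Finset.sum_eq_zero fun v _ => ?_
    rw [SimpleGraph.adjMatrix_apply]
    split_ifs with huv
    · rw [mul_one, defect_apply_of_ne huv.ne', if_pos huv.symm]
      have h0 : nbrs G u ∩ nbrs G v = ∅ := by
        ext w
        simp only [Finset.mem_inter, mem_nbrs, Finset.notMem_empty, iff_false, not_and]
        exact fun h1 h2 => htri v u w huv h1 h2
      simp [h0]
    · rw [mul_zero]
  have hAQ := adjMatrix_mul_defect hreg
  set Q := defect G d with hQ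
  set A := G.adjMatrix ℝ with hA
  set J : Matrix V V ℝ := Matrix.of fun _ _ => 1 with hJ
  have hJQ : J * Q = J := hJQ
  have hAJ : A * J = (d : ℝ) • J := adjMatrix_mul_ones hreg
  have hJA : J * A = (d : ℝ) • J := ones_mul_adjMatrix hreg
  have hJJ : J * J = (Fintype.card V : ℝ) • J := ones_mul_ones
  have hAA : A * A = Q - A + ((d : ℝ) - 1) • 1 + J := adjMatrix_sq G d
  have hd' : (3 : ℝ) ≤ d := by exact_mod_cast hd
  have hn0 : (d : ℝ) ^ 2 ≠ 0 := by positivity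
  rw [hn] at hJJ
  have htJA : (J * A).trace = d * d ^ 2 := by
    rw [hJA, Matrix.trace_smul, Matrix.trace]
    simp [hJ, hn]
  have htJ : J.trace = d ^ 2 := by
    rw [Matrix.trace]
    simp [hJ, hn]
  have htA : A.trace = 0 := by simp [hA]
  have hJij : ∀ i j, J i j = 1 := fun _ _ => rfl
  clear_value Q A J
  -- On the eigenspace of `Q` for `-1` the eigenvalues of `A` have discriminant `4 d - 7`.
  obtain ⟨x, hx⟩ : ∃ x : ℕ, 4 * d - 7 = x ^ 2 := by
    set r := √(4 * (d : ℝ) - 7) with hr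
    have hr2 : r ^ 2 = 4 * (d : ℝ) - 7 := Real.sq_sqrt (by linarith)
    have hr0 : r ≠ 0 := (Real.sqrt_pos.2 (by linarith)).ne'
    obtain ⟨b, hb⟩ := exists_nat_eq_of_quadratic A ((1 / 2 : ℝ) • (1 - Q)) (d - 2) r
      (by rw [hr2]; ring) hr0
      (by
        simp only [sub_mul, mul_sub, Matrix.smul_mul, Matrix.mul_smul, one_mul, mul_one, hQQ]
        ext i j
        simp only [Matrix.sub_apply, Matrix.smul_apply, smul_eq_mul]
        ring)
      (by
        simp only [sub_mul, mul_sub, Matrix.smul_mul, Matrix.mul_smul, one_mul, mul_one, hAQ])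
      (by
        simp only [sub_mul, Matrix.smul_mul, one_mul, mul_assoc, hAA, mul_add, mul_sub,
          Matrix.mul_smul, mul_one, hQQ, hQJ]
        ext i j
        simp only [Matrix.sub_apply, Matrix.add_apply, Matrix.smul_apply, smul_eq_mul]
        ring)
    simp only [sub_mul, Matrix.smul_mul, one_mul, Matrix.trace_sub, Matrix.trace_smul, htQ, htQA,
      htA, Matrix.trace_one, hn, smul_eq_mul] at hb
    obtain ⟨x, hx, -⟩ := exists_eq_sq_of_mul_sqrt (D := 4 * d - 7) (r := r) (z := 4 * b - d ^ 2)
      (w := d ^ 2) (by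
        rw [hr2, Nat.cast_sub (by omega)]
        push_cast
        ring) (by positivity) (by
        push_cast
        linarith)
    exact ⟨x, hx⟩
  -- On the eigenspace of `Q` for `1`, apart from the constants, it is `4 d + 1`.
  obtain ⟨y, hy⟩ : ∃ y : ℕ, 4 * d + 1 = y ^ 2 := by
    set r := √(4 * (d : ℝ) + 1) with hr
    have hr2 : r ^ 2 = 4 * (d : ℝ) + 1 := Real.sq_sqrt (by linarith)
    have hr0 : r ≠ 0 := (Real.sqrt_pos.2 (by linarith)).ne'
    obtain ⟨b, hb⟩ := exists_nat_eq_of_quadratic A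
      ((1 / 2 : ℝ) • (1 + Q) - ((d : ℝ) ^ 2)⁻¹ • J) d r (by rw [hr2]; ring) hr0
      (by
        simp only [sub_mul, mul_sub, add_mul, mul_add, Matrix.smul_mul, Matrix.mul_smul, one_mul,
          mul_one, hQQ, hQJ, hJQ, hJJ]
        ext i j
        simp only [Matrix.sub_apply, Matrix.add_apply, Matrix.smul_apply, smul_eq_mul]
        field_simp
        ring)
      (by
        simp only [sub_mul, mul_sub, add_mul, mul_add, Matrix.smul_mul, Matrix.mul_smul, one_mul,
          mul_one, hAQ, hAJ, hJA])
      (by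
        simp only [sub_mul, add_mul, Matrix.smul_mul, one_mul, mul_assoc, hAA, mul_add, mul_sub,
          Matrix.mul_smul, mul_one, hQQ, hQJ, hJA]
        ext i j
        simp only [Matrix.sub_apply, Matrix.add_apply, Matrix.smul_apply, smul_eq_mul]
        field_simp
        ring)
    simp only [sub_mul, add_mul, Matrix.smul_mul, one_mul, Matrix.trace_sub, Matrix.trace_add,
      Matrix.trace_smul, htQ, htQA, htA, htJ, htJA, Matrix.trace_one, hn, smul_eq_mul] at hb
    obtain ⟨y, hy, -⟩ := exists_eq_sq_of_mul_sqrt (D := 4 * d + 1) (r := r) (z := 4 * b - d ^ 2 + 2)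
      (w := d ^ 2 - 4 * d - 2) (by
        rw [hr2]
        push_cast
        ring) (by
        intro h0
        have h6 : ((d : ℤ) - 2) ^ 2 = 6 := by linarith
        have h7 : (d : ℤ) - 2 < 3 := by nlinarith
        have h8 : (d : ℤ) ≤ 4 := by omega
        have h9 : d ≤ 4 := by exact_mod_cast h8
        interval_cases d <;> norm_num at h6) (by
        push_cast
        field_simp at hb
        linarith)
    exact ⟨y, hy⟩
  have hxy : y ^ 2 = x ^ 2 + 8 := by omega
  have hy3 : y ≤ 4 := by
    by_contra hcon
    have : x < y := lt_of_pow_lt_pow_left₀ 2 (by omega) (by omega)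
    nlinarith
  interval_cases y <;> omega
end

/-! ### Pentagons in Moore graphs -/

/-- Two regular graphs with equally many vertices and equal degree are isomorphic as soon as there
is an injective homomorphism between them. -/
theorem nonempty_iso_of_injective {α V : Type*} [Fintype α] [Fintype V] {H : SimpleGraph α}
    {G : SimpleGraph V} {d : ℕ} (hH : ∀ a, (nbrs H a).card = d) (hG : ∀ v, (nbrs G v).card = d)
    (hcard : Fintype.card V = Fintype.card α) (f : α → V) (hf : Function.Injective f)
    (hadj : ∀ a b, H.Adj a b → G.Adj (f a) (f b)) : Nonempty (G ≃g H) := by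
  classical
  have hb : Function.Bijective f := (Fintype.bijective_iff_injective_and_card f).2 ⟨hf, hcard.symm⟩
  refine ⟨RelIso.symm ⟨Equiv.ofBijective f hb, fun {a b} => ⟨fun h => ?_, fun h => hadj a b h⟩⟩⟩
  have hsub : (nbrs H a).image f ⊆ nbrs G (f a) := by
    intro x hx
    obtain ⟨c, hc, rfl⟩ := Finset.mem_image.1 hx
    rw [mem_nbrs] at hc ⊢
    exact hadj a c hc
  have heq := Finset.eq_of_subset_of_card_le hsub (by
    rw [Finset.card_image_of_injective _ hf, hH, hG])
  have h1 : f b ∈ nbrs G (f a) := (mem_nbrs ..).2 h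
  rw [← heq] at h1
  obtain ⟨c, hc, hcb⟩ := Finset.mem_image.1 h1
  rw [← hf hcb]
  exact (mem_nbrs ..).1 hc

/-- `p` runs through a pentagon. -/
def Pent {V : Type*} (G : SimpleGraph V) (p : ZMod 5 → V) : Prop := ∀ i, G.Adj (p i) (p (i + 1))

/-- `x` is a neighbour of `p i` outside the pentagon `p`. -/
def Pend {V : Type*} (G : SimpleGraph V) (p : ZMod 5 → V) (i : ZMod 5) (x : V) : Prop :=
  G.Adj (p i) x ∧ ∀ j, x ≠ p j

section
variable {V : Type*} {G : SimpleGraph V} {p : ZMod 5 → V}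

theorem zmod_five_cases : ∀ i j : ZMod 5,
    j = i ∨ j = i + 1 ∨ i = j + 1 ∨ j = i + 2 ∨ i = j + 2 := by decide

theorem Pent.ne_add_two (hp : Pent G p) (hG : GirthFive G) (i : ZMod 5) : p i ≠ p (i + 2) := by
  intro h
  have h1 := hp (i + 2)
  have h2 := hp (i + 3)
  have h3 := hp (i + 4)
  rw [show i + 2 + 1 = i + 3 by ring, ← h] at h1
  rw [show i + 3 + 1 = i + 4 by ring] at h2
  rw [show i + 4 + 1 = i by linear_combination (by decide : (5 : ZMod 5) = 0)] at h3
  exact hG.no_triangle h1 h2 h3.symm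

theorem Pent.injective (hp : Pent G p) (hG : GirthFive G) : Function.Injective p := by
  intro i j h
  rcases zmod_five_cases i j with rfl | rfl | rfl | rfl | rfl
  · rfl
  · exact absurd h (hp i).ne
  · exact absurd h (hp j).ne'
  · exact absurd h (hp.ne_add_two hG i)
  · exact absurd h.symm (hp.ne_add_two hG j)

theorem Pent.not_adj_add_two (hp : Pent G p) (hG : GirthFive G) (i : ZMod 5) :
    ¬ G.Adj (p i) (p (i + 2)) := by
  have h1 := hp (i + 1)
  rw [show i + 1 + 1 = i + 2 by ring] at h1
  exact hG.no_triangle (hp i) h1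

/-- A vertex outside a pentagon has at most one neighbour on it. -/
theorem Pend.eq_of_adj {i j : ZMod 5} {x : V} (hx : Pend G p i x) (hp : Pent G p)
    (hG : GirthFive G) (h : G.Adj (p j) x) : j = i := by
  have key : ∀ i j, G.Adj (p i) x → G.Adj (p j) x → j = i + 2 → False := by
    rintro i _ h1 h2 rfl
    have h3 := hp (i + 1)
    rw [show i + 1 + 1 = i + 2 by ring] at h3
    exact hx.2 _ (hG.eq_of_common (hp.ne_add_two hG i) h1 h2.symm (hp i) h3)
  rcases zmod_five_cases i j with h1 | rfl | rfl | h1 | h1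
  · exact h1
  · exact absurd hx.1 (hG.no_triangle (hp i) h)
  · exact absurd h (hG.no_triangle (hp j) hx.1)
  · exact (key i j hx.1 h h1).elim
  · exact (key j i h hx.1 h1).elim

theorem Pend.not_adj_add_one {i : ZMod 5} {x y : V} (hx : Pend G p i x) (hy : Pend G p (i + 1) y)
    (hp : Pent G p) (hG : GirthFive G) : ¬ G.Adj x y := fun h =>
  hy.2 i (hG.eq_of_common (hx.2 (i + 1)) h hy.1.symm hx.1.symm (hp i))

theorem Pend.not_adj {i : ZMod 5} {x y : V} (hx : Pend G p i x) (hy : Pend G p i y)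
    (hG : GirthFive G) : ¬ G.Adj x y := fun h => hG.no_triangle hx.1 h hy.1

theorem Pend.unique {i : ZMod 5} {x y z : V} (hx : Pend G p i x) (hy : Pend G p i y)
    (hG : GirthFive G) (hz : z ≠ p i) (hzx : G.Adj z x) (hzy : G.Adj z y) : x = y :=
  hG.eq_of_common hz hzx hx.1.symm hzy hy.1.symm

theorem exists_common (hS : ∀ u v, u ≠ v → G.square.Adj u v) {x y : V} (hxy : x ≠ y)
    (h : ¬ G.Adj x y) : ∃ z, G.Adj x z ∧ G.Adj z y :=
  (square_adj.1 (hS x y hxy)).2.resolve_left h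

/-- The common neighbour of `x` and `p j` is a pendant vertex, unless `x` has neighbours on the
pentagon next to `p j`. -/
theorem exists_pend (hG : GirthFive G) (hS : ∀ u v, u ≠ v → G.square.Adj u v) (hp : Pent G p)
    {x : V} {j : ZMod 5} (hx : ∀ k, x ≠ p k) (hk : ∀ k, G.Adj (p k) x → j = k + 2 ∨ k = j + 2) :
    ∃ y, Pend G p j y ∧ G.Adj x y := by
  obtain ⟨y, h1, h2⟩ := exists_common hS (hx j) (fun h => by
    have h1 : ∀ j : ZMod 5, j ≠ j + 2 := by decide
    rcases hk j h.symm with h | h <;> exact h1 j h)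
  refine ⟨y, ⟨h2.symm, ?_⟩, h1⟩
  rintro k rfl
  rcases hk k h1.symm with rfl | rfl
  · exact hp.not_adj_add_two hG _ h2
  · exact hp.not_adj_add_two hG _ h2.symm

theorem Pend.exists_add_two (hG : GirthFive G) (hS : ∀ u v, u ≠ v → G.square.Adj u v)
    (hp : Pent G p) {x : V} {j : ZMod 5} (hx : Pend G p j x) :
    ∃ y, Pend G p (j + 2) y ∧ G.Adj x y :=
  exists_pend hG hS hp hx.2 fun _ hk => Or.inl (by rw [hx.eq_of_adj hp hG hk])

theorem Pend.exists_sub_two (hG : GirthFive G) (hS : ∀ u v, u ≠ v → G.square.Adj u v)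
    (hp : Pent G p) {x : V} {j : ZMod 5} (hx : Pend G p (j + 2) x) :
    ∃ y, Pend G p j y ∧ G.Adj x y :=
  exists_pend hG hS hp hx.2 fun _ hk => Or.inr (hx.eq_of_adj hp hG hk)

end

/-! ### The Petersen graph -/

section
variable {V : Type*} [Fintype V] {G : SimpleGraph V} {p : ZMod 5 → V}

theorem Pent.exists_pend_of_card (hp : Pent G p) (i : ZMod 5)
    (hi : 3 ≤ (nbrs G (p i)).card) (hG : GirthFive G) : ∃ x, Pend G p i x := by
  classical
  obtain ⟨x, hx, hx'⟩ : ∃ z ∈ nbrs G (p i), z ∉ ({p (i + 1), p (i - 1)} : Finset V) := by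
    by_contra hcon
    push Not at hcon
    have := Finset.card_le_card (show nbrs G (p i) ⊆ {p (i + 1), p (i - 1)} from hcon)
    have h2 := Finset.card_le_two (a := p (i + 1)) (b := p (i - 1))
    omega
  rw [mem_nbrs] at hx
  simp only [Finset.mem_insert, Finset.mem_singleton, not_or] at hx'
  refine ⟨x, hx, ?_⟩
  rintro j rfl
  rcases zmod_five_cases i j with rfl | rfl | rfl | rfl | rfl
  · exact G.irrefl hx
  · exact hx'.1 rfl
  · exact hx'.2 (by rw [add_sub_cancel_right])
  · exact hp.not_adj_add_two hG _ hx
  · exact hp.not_adj_add_two hG _ hx.symm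

/-- The outer and the inner pentagon of the Petersen graph. The arithmetic is that of `ZMod 5`, which
is definitionally equal to `Fin 5`. -/
def petersenVertex : ZMod 5 ⊕ ZMod 5 → {s : Finset (Fin 5) // s.card = 2}
  | .inl i => ⟨{(2 * i : ZMod 5), (2 * i + 1 : ZMod 5)}, by revert i; decide⟩
  | .inr i => ⟨{(2 * i + 2 : ZMod 5), (2 * i + 4 : ZMod 5)}, by revert i; decide⟩

theorem bijective_petersenVertex : Function.Bijective petersenVertex := by decide +kernel

theorem card_filter_disjoint : ∀ a : {s : Finset (Fin 5) // s.card = 2},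
    (Finset.univ.filter fun b : {s : Finset (Fin 5) // s.card = 2} =>
      Disjoint a.1 b.1).card = 3 := by decide +kernel

theorem petersenVertex_inl_inl : ∀ i j, Disjoint (petersenVertex (.inl i)).1
    (petersenVertex (.inl j)).1 → j = i + 1 ∨ i = j + 1 := by decide +kernel

theorem petersenVertex_inl_inr : ∀ i j, Disjoint (petersenVertex (.inl i)).1
    (petersenVertex (.inr j)).1 → i = j := by decide +kernel

theorem petersenVertex_inr_inr : ∀ i j, Disjoint (petersenVertex (.inr i)).1
    (petersenVertex (.inr j)).1 → j = i + 2 ∨ i = j + 2 := by decide +kernel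

/-- A Moore graph of degree three: every vertex `p i` of a pentagon has one further neighbour `q i`, and
`q i` reaches `p (i + 2)` in two steps only through `q (i + 2)`. -/
theorem nonempty_iso_petersen (hG : GirthFive G) (hS : ∀ u v, u ≠ v → G.square.Adj u v)
    (hreg : ∀ v, (nbrs G v).card = 3) (hcard : Fintype.card V = 10) (hp : Pent G p) :
    Nonempty (G ≃g petersenGraph) := by
  classical
  choose q hq using fun i => hp.exists_pend_of_card i (hreg _).ge hG
  have hq2 : ∀ i x, Pend G p i x → x = q i := by
    intro i x hx
    by_contra hne
    have hsub : ({p (i + 1), p (i - 1), x, q i} : Finset V) ⊆ nbrs G (p i) := by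
      intro y hy
      simp only [Finset.mem_insert, Finset.mem_singleton] at hy
      rw [mem_nbrs]
      rcases hy with rfl | rfl | rfl | rfl
      · exact hp i
      · simpa using (hp (i - 1)).symm
      · exact hx.1
      · exact (hq i).1
    have := Finset.card_le_card hsub
    rw [hreg, Finset.card_insert_of_notMem, Finset.card_insert_of_notMem, Finset.card_pair hne]
      at this
    · omega
    · simp [(hx.2 _).symm, ((hq i).2 _).symm]
    · have : p (i + 1) ≠ p (i - 1) := fun h => by
        have h1 : ∀ i : ZMod 5, i + 1 ≠ i - 1 := by decide
        exact h1 i (hp.injective hG h)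
      simp [(hx.2 _).symm, ((hq i).2 _).symm, this]
  have hqq : ∀ i, G.Adj (q i) (q (i + 2)) := by
    intro i
    obtain ⟨y, hy, hy'⟩ := (hq i).exists_add_two hG hS hp
    rwa [← hq2 _ y hy]
  have hqinj : Function.Injective q := fun i j h => by
    have := (hq i).1
    rw [h] at this
    exact (hq j).eq_of_adj hp hG this
  set e := Equiv.ofBijective _ bijective_petersenVertex with he
  refine nonempty_iso_of_injective (d := 3) (fun a => ?_) hreg (by rw [hcard]; rfl)
    (fun s => Sum.elim p q (e.symm s)) ?_ ?_
  · rw [← card_filter_disjoint a]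
    congr 1
    ext b
    simp [petersenGraph]
  · refine Function.Injective.comp ?_ e.symm.injective
    exact (hp.injective hG).sumElim hqinj fun i j => ((hq j).2 i).symm
  · intro a b
    obtain ⟨a, rfl⟩ := e.surjective a
    obtain ⟨b, rfl⟩ := e.surjective b
    rw [e.symm_apply_apply, e.symm_apply_apply]
    intro hab
    rcases a with i | i <;> rcases b with j | j
    · rcases petersenVertex_inl_inl i j hab with rfl | rfl
      · exact hp i
      · exact (hp j).symm
    · rw [petersenVertex_inl_inr i j hab]
      exact (hq j).1
    · rw [← petersenVertex_inl_inr j i hab.symm]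
      exact (hq j).1.symm
    · rcases petersenVertex_inr_inr i j hab with rfl | rfl
      · exact hqq i
      · exact (hqq j).symm
end

/-! ### Every pentagon with a pendant vertex extends to a Petersen graph -/

/-- The vertex `z` is neither on the pentagon `p` nor adjacent to it. -/
def Far {V : Type*} (G : SimpleGraph V) (p : ZMod 5 → V) (z : V) : Prop :=
  ∀ i, z ≠ p i ∧ ¬ G.Adj (p i) z

/-- `q` is a labelling of the pendant vertices at `p i`. -/
def Labels {V L : Type*} (G : SimpleGraph V) (p : ZMod 5 → V) (i : ZMod 5) (q : L → V) : Prop :=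
  (∀ σ, Pend G p i (q σ)) ∧ ∀ x, Pend G p i x → ∃ σ, q σ = x

theorem zmod_five_eq : ∀ i : ZMod 5, i = 0 ∨ i = 1 ∨ i = 2 ∨ i = 3 ∨ i = 4 := by decide

section
variable {V L : Type*} {G : SimpleGraph V} {p : ZMod 5 → V}

/-- The pendant vertices at `p i` and at `p (i + 2)` are matched, so labels can be carried over. -/
theorem Labels.exists_add_two (hG : GirthFive G) (hS : ∀ u v, u ≠ v → G.square.Adj u v)
    (hp : Pent G p) {i : ZMod 5} {q : L → V} (hq : Labels G p i q) :
    ∃ q' : L → V, Labels G p (i + 2) q' ∧ ∀ σ, G.Adj (q σ) (q' σ) := by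
  choose q' h1 h2 using fun σ => (hq.1 σ).exists_add_two hG hS hp
  refine ⟨q', ⟨h1, fun x hx => ?_⟩, h2⟩
  obtain ⟨y, hy, hxy⟩ := hx.exists_sub_two hG hS hp
  obtain ⟨σ, rfl⟩ := hq.2 y hy
  exact ⟨σ, (h1 σ).unique hx hG ((hq.1 σ).2 _) (h2 σ) hxy.symm⟩

theorem Far.exists_label (hG : GirthFive G) (hS : ∀ u v, u ≠ v → G.square.Adj u v)
    (hp : Pent G p) {z : V} (hz : Far G p z) {i : ZMod 5} {q : L → V} (hq : Labels G p i q) :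
    ∃ σ, G.Adj z (q σ) := by
  obtain ⟨y, hy, hzy⟩ := exists_pend (j := i) hG hS hp (fun k => (hz k).1)
    (fun k hk => absurd hk (hz k).2)
  obtain ⟨σ, rfl⟩ := hq.2 y hy
  exact ⟨σ, hzy⟩

theorem Far.ne_pend {z x : V} {i : ZMod 5} (hz : Far G p z) (hx : Pend G p i x) : z ≠ x := by
  rintro rfl
  exact (hz i).2 hx.1

/-- Adjacent vertices have no common neighbour. -/
theorem Far.label_ne (hG : GirthFive G) {z z' : V} {σ τ : L} {q : L → V}
    (hzz : G.Adj z z') (h : G.Adj z (q σ)) (h' : G.Adj z' (q τ)) : σ ≠ τ := by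
  rintro rfl
  exact hG.no_triangle hzz h' h

/-- Neighbours of adjacent far vertices are not matched, because of the resulting 4-cycle. -/
theorem Far.label_ne_step (hG : GirthFive G) {z z' : V} {i : ZMod 5} {σ τ : L} {q q' : L → V}
    (hz : Far G p z) (hz' : Far G p z') (hq : ∀ σ, Pend G p i (q σ)) {j : ZMod 5}
    (hq' : ∀ σ, Pend G p j (q' σ)) (hqq : ∀ σ, G.Adj (q σ) (q' σ))
    (hzz : G.Adj z z') (h : G.Adj z (q σ)) (h' : G.Adj z' (q' τ)) : σ ≠ τ := by
  rintro rfl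
  exact hz'.ne_pend (hq σ) (hG.eq_of_common (hz.ne_pend (hq' σ)) hzz h' h (hqq σ))

/-- Arithmetic of five labels: the label different from four distinct ones is determined. -/
theorem eq_fifth {a b c x y u : Fin 5} (hab : a ≠ b) (hac : a ≠ c) (hbc : b ≠ c) (hxa : x ≠ a)
    (hxb : x ≠ b) (hxc : x ≠ c) (hya : y ≠ a) (hyb : y ≠ b) (hyc : y ≠ c) (hxy : x ≠ y)
    (hua : u ≠ a) (huc : u ≠ c) (hux : u ≠ x) (huy : u ≠ y) : u = b := by
  have hcard : ({a, b, c, x, y} : Finset (Fin 5)).card = 5 := by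
    rw [Finset.card_insert_of_notMem, Finset.card_insert_of_notMem, Finset.card_insert_of_notMem,
      Finset.card_pair hxy]
    · simp [hxc.symm, hyc.symm]
    · simp [hbc, hxb.symm, hyb.symm]
    · simp [hab, hac, hxa.symm, hya.symm]
  have huniv : ({a, b, c, x, y} : Finset (Fin 5)) = Finset.univ :=
    Finset.eq_univ_of_card _ (by rw [hcard, Fintype.card_fin])
  have hu : u ∈ ({a, b, c, x, y} : Finset (Fin 5)) := huniv ▸ Finset.mem_univ u
  simp only [Finset.mem_insert, Finset.mem_singleton] at hu
  tauto

end

section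
variable {V : Type*} [Fintype V] {G : SimpleGraph V} {p : ZMod 5 → V}

theorem Pent.exists_labels (hp : Pent G p) (hG : GirthFive G) (i : ZMod 5)
    (hreg : (nbrs G (p i)).card = 7) : ∃ q : Fin 5 → V, Labels G p i q ∧ Function.Injective q := by
  classical
  set P := (nbrs G (p i)) \ {p (i + 1), p (i - 1)} with hP
  have hmem : ∀ x, x ∈ P ↔ Pend G p i x := by
    intro x
    rw [hP, Finset.mem_sdiff, mem_nbrs, Finset.mem_insert, Finset.mem_singleton, not_or]
    constructor
    · rintro ⟨hx, h1, h2⟩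
      refine ⟨hx, ?_⟩
      rintro j rfl
      rcases zmod_five_cases i j with rfl | rfl | rfl | rfl | rfl
      · exact G.irrefl hx
      · exact h1 rfl
      · exact h2 (by rw [add_sub_cancel_right])
      · exact hp.not_adj_add_two hG _ hx
      · exact hp.not_adj_add_two hG _ hx.symm
    · exact fun hx => ⟨hx.1, hx.2 _, hx.2 _⟩
  have hcard : P.card = 5 := by
    have hsub : ({p (i + 1), p (i - 1)} : Finset V) ⊆ nbrs G (p i) := by
      intro y hy
      rw [mem_nbrs]
      rcases Finset.mem_insert.1 hy with rfl | hy
      · exact hp i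
      · rw [Finset.mem_singleton.1 hy]
        simpa using (hp (i - 1)).symm
    have hne : p (i + 1) ≠ p (i - 1) := fun h => by
      have h1 : ∀ i : ZMod 5, i + 1 ≠ i - 1 := by decide
      exact h1 i (hp.injective hG h)
    rw [hP, Finset.card_sdiff_of_subset hsub, Finset.card_pair hne, hreg]
  refine ⟨fun σ => (P.equivFinOfCardEq hcard).symm σ, ⟨fun σ => (hmem _).1 (Subtype.prop _),
    fun x hx => ?_⟩, fun σ τ h => (P.equivFinOfCardEq hcard).symm.injective (Subtype.ext h)⟩
  exact ⟨P.equivFinOfCardEq hcard ⟨x, (hmem x).2 hx⟩, by simp⟩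

/-- A far vertex has at least two far neighbours. -/
theorem Far.exists_far (hG : GirthFive G) (hS : ∀ u v, u ≠ v → G.square.Adj u v)
    (hreg : ∀ v, (nbrs G v).card = 7) (hp : Pent G p) {z : V} (hz : Far G p z) :
    ∃ x y, G.Adj z x ∧ G.Adj z y ∧ x ≠ y ∧ Far G p x ∧ Far G p y := by
  classical
  choose w hw hzw using fun i => exists_pend (j := i) hG hS hp (fun k => (hz k).1)
    (fun k hk => absurd hk (hz k).2)
  have hcard : 1 < (nbrs G z \ Finset.univ.image w).card := by
    have h1 := Finset.le_card_sdiff (Finset.univ.image w) (nbrs G z)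
    have h2 : (Finset.univ.image w).card ≤ 5 := Finset.card_image_le
    rw [hreg] at h1
    omega
  have hfar : ∀ x ∈ nbrs G z \ Finset.univ.image w, G.Adj z x ∧ Far G p x := by
    intro x hx
    rw [Finset.mem_sdiff, mem_nbrs] at hx
    have hne : ∀ i, x ≠ p i := by
      rintro i rfl
      exact (hz i).2 hx.1.symm
    refine ⟨hx.1, fun i => ⟨hne i, fun h => hx.2 ?_⟩⟩
    rw [Pend.unique (G := G) ⟨h, hne⟩ (hw i) hG (hz i).1 hx.1 (hzw i)]
    exact Finset.mem_image_of_mem _ (Finset.mem_univ i)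
  obtain ⟨x, hx, y, hy, hxy⟩ := Finset.one_lt_card.1 hcard
  exact ⟨x, y, (hfar x hx).1, (hfar y hy).1, hxy, (hfar x hx).2, (hfar y hy).2⟩

/-- In a Moore graph of degree seven, the path that starts in a pendant vertex at `p 0` and runs
through pendant vertices at `p 2`, `p 4`, `p 1` and `p 3` closes to a pentagon.

Otherwise the vertices `s0` and `s3` of the path have a common neighbour `z` far from the pentagon.
Label the five paths that start at `p 0`, and let `σ` be the path through `s0`. Every far vertex has
one neighbour among the pendant vertices at each `p i`; those of `z` at `p 0`, `p 2`, `p 4`, `p 1` lie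
on the paths `σ, b, c, σ`. The vertex `z` has two more neighbours, both of them far. Avoiding
triangles and 4-cycles, each of these has its neighbours at `p 2` and `p 4` on the two paths other
than `σ, b, c`, hence its neighbour at `p 1` on the path `b`. This closes a 4-cycle. -/
theorem Pent.strand_closes (hG : GirthFive G) (hS : ∀ u v, u ≠ v → G.square.Adj u v)
    (hreg : ∀ v, (nbrs G v).card = 7) (hp : Pent G p) {s0 s1 s2 s3 s4 : V} (h0 : Pend G p 0 s0)
    (h1 : Pend G p 2 s1) (h2 : Pend G p 4 s2) (h3 : Pend G p 1 s3) (h4 : Pend G p 3 s4)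
    (h01 : G.Adj s0 s1) (h12 : G.Adj s1 s2) (h23 : G.Adj s2 s3) (h34 : G.Adj s3 s4) :
    G.Adj s4 s0 := by
  by_contra hcon
  have hne03 : s0 ≠ s3 := fun h => 
    absurd (h3.eq_of_adj hp hG (h ▸ h0.1)) (by decide)
  obtain ⟨z, hz0, hz3⟩ := exists_common hS hne03 (h0.not_adj_add_one (i := 0) h3 hp hG)
  have hzp : ∀ k, z ≠ p k := by
    rintro k rfl
    have e1 := h0.eq_of_adj hp hG hz0.symm
    have e2 := h3.eq_of_adj hp hG hz3
    exact absurd (e1.symm.trans e2) (by decide)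
  have hz : Far G p z := by
    refine fun k => ⟨hzp k, fun hk => ?_⟩
    have hzk : Pend G p k z := ⟨hk, hzp⟩
    rcases zmod_five_eq k with rfl | rfl | rfl | rfl | rfl
    · exact h0.not_adj hzk hG hz0
    · exact hzk.not_adj h3 hG hz3
    · have := hzk.unique h1 hG (h0.2 2) hz0 h01
      subst this
      exact h3.not_adj_add_one (i := 1) hzk hp hG hz3.symm
    · have := hzk.unique h4 hG (h3.2 3) hz3.symm h34
      subst this
      exact hcon hz0.symm
    · have := hzk.unique h2 hG (h3.2 4) hz3.symm h23.symm
      subst this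
      exact hzk.not_adj_add_one (i := 4) h0 hp hG hz0.symm
  -- The four strands, labelled along the path.
  obtain ⟨q0, hq0, -⟩ := hp.exists_labels hG 0 (hreg _)
  obtain ⟨q1, hq1, a01⟩ := hq0.exists_add_two hG hS hp
  obtain ⟨q2, hq2, a12⟩ := hq1.exists_add_two hG hS hp
  obtain ⟨q3, hq3, a23⟩ := hq2.exists_add_two hG hS hp
  obtain ⟨σ, rfl⟩ := hq0.2 s0 h0
  have e1 : q1 σ = s1 := (hq1.1 σ).unique (i := 2) h1 hG (h0.2 2) (a01 σ) h01
  have e2 : q2 σ = s2 := (hq2.1 σ).unique (i := 4) h2 hG (h1.2 4) (e1 ▸ a12 σ) h12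
  have e3 : q3 σ = s3 := (hq3.1 σ).unique (i := 1) h3 hG (h2.2 1) (e2 ▸ a23 σ) h23
  have hz3' : G.Adj z (q3 σ) := e3 ▸ hz3
  obtain ⟨b, hzb⟩ := hz.exists_label hG hS hp hq1
  obtain ⟨c, hzc⟩ := hz.exists_label hG hS hp hq2
  have hself : ∀ {q q' : Fin 5 → V} {τ τ' : Fin 5}, (∀ σ, G.Adj (q σ) (q' σ)) →
      ∀ {w : V}, G.Adj w (q τ) → G.Adj w (q' τ') → τ ≠ τ' := by
    intro q q' τ τ' hqq w hw hw' h
    subst h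
    exact hG.no_triangle hw (hqq τ) hw'
  have hskip : ∀ {i j k : ZMod 5} {q q' q'' : Fin 5 → V} {τ τ' : Fin 5}, k ≠ i →
      (∀ σ, Pend G p i (q σ)) → (∀ σ, Pend G p j (q' σ)) → (∀ σ, Pend G p k (q'' σ)) →
      (∀ σ, G.Adj (q σ) (q' σ)) → (∀ σ, G.Adj (q' σ) (q'' σ)) →
      ∀ {w : V}, Far G p w → G.Adj w (q τ) → G.Adj w (q'' τ') → τ ≠ τ' := by
    intro i j k q q' q'' τ τ' hki hq hq' hq'' hqq hqq' w hw hw1 hw2 h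
    subst h
    refine hw.ne_pend (hq' τ) (hG.eq_of_common ?_ hw1.symm hw2 (hqq τ) (hqq' τ))
    intro h
    exact hki ((hq τ).eq_of_adj hp hG (h ▸ (hq'' τ).1))
  have hσb : σ ≠ b := hself a01 hz0.symm hzb
  have hbc : b ≠ c := hself a12 hzb hzc
  have hσc : σ ≠ c := hskip (by decide) hq0.1 hq1.1 hq2.1 a01 a12 hz hz0.symm hzc
  -- A far neighbour of `z` has the label `b` at the end of the strands.
  have key : ∀ w, Far G p w → G.Adj z w → ∃ x y, G.Adj w (q1 x) ∧ G.Adj w (q2 y) ∧ x ≠ y ∧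
      (x ≠ σ ∧ x ≠ b ∧ x ≠ c) ∧ (y ≠ σ ∧ y ≠ b ∧ y ≠ c) ∧ G.Adj w (q3 b) := by
    intro w hw hzw
    obtain ⟨x, hx⟩ := hw.exists_label hG hS hp hq1
    obtain ⟨y, hy⟩ := hw.exists_label hG hS hp hq2
    obtain ⟨u, hu⟩ := hw.exists_label hG hS hp hq3
    have hxy : x ≠ y := hself a12 hx hy
    have hx' : x ≠ σ ∧ x ≠ b ∧ x ≠ c :=
      ⟨(hz.label_ne_step hG hw hq0.1 hq1.1 a01 hzw hz0.symm hx).symm,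
        (Far.label_ne hG hzw hzb hx).symm,
        hw.label_ne_step hG hz hq1.1 hq2.1 a12 hzw.symm hx hzc⟩
    have hy' : y ≠ σ ∧ y ≠ b ∧ y ≠ c :=
      ⟨hw.label_ne_step hG hz hq2.1 hq3.1 a23 hzw.symm hy hz3',
        (hz.label_ne_step hG hw hq1.1 hq2.1 a12 hzw hzb hy).symm,
        (Far.label_ne hG hzw hzc hy).symm⟩
    refine ⟨x, y, hx, hy, hxy, hx', hy', ?_⟩
    have hu' : u = b := eq_fifth hσb hσc hbc hx'.1 hx'.2.1 hx'.2.2 hy'.1 hy'.2.1 hy'.2.2 hxy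
      (Far.label_ne hG hzw hz3' hu).symm
      (hz.label_ne_step hG hw hq2.1 hq3.1 a23 hzw hzc hu).symm
      (hskip (by decide) hq1.1 hq2.1 hq3.1 a12 a23 hw hx hu).symm
      (hself a23 hy hu).symm
    rwa [← hu']
  obtain ⟨x, y, hzx, hzy, hxy, hx, hy⟩ := hz.exists_far hG hS hreg hp
  obtain ⟨-, -, -, -, -, -, -, hxb⟩ := key x hx hzx
  obtain ⟨-, -, -, -, -, -, -, hyb⟩ := key y hy hzy
  exact hxy (hG.eq_of_common (hz.ne_pend (hq3.1 b)) hzx hxb hzy hyb)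

/-- In a Moore graph of degree seven, a pentagon with a pendant vertex extends to a Petersen
graph. -/
theorem Pent.exists_pentagram (hG : GirthFive G) (hS : ∀ u v, u ≠ v → G.square.Adj u v)
    (hreg : ∀ v, (nbrs G v).card = 7) (hp : Pent G p) {y : V} (hy : Pend G p 0 y) :
    ∃ q : ZMod 5 → V, q 0 = y ∧ (∀ i, Pend G p i (q i)) ∧ ∀ i, G.Adj (q i) (q (i + 2)) := by
  obtain ⟨s1, h1, h01⟩ := hy.exists_add_two hG hS hp
  obtain ⟨s2, h2, h12⟩ := h1.exists_add_two hG hS hp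
  obtain ⟨s3, h3, h23⟩ := h2.exists_add_two hG hS hp
  obtain ⟨s4, h4, h34⟩ := h3.exists_add_two hG hS hp
  have h40 := hp.strand_closes hG hS hreg hy h1 h2 h3 h4 h01 h12 h23 h34
  refine ⟨![y, s3, s1, s4, s2], rfl, fun i => ?_, fun i => ?_⟩
  · rcases zmod_five_eq i with rfl | rfl | rfl | rfl | rfl
    exacts [hy, h3, h1, h4, h2]
  · rcases zmod_five_eq i with rfl | rfl | rfl | rfl | rfl
    exacts [h01, h34, h12, h40, h23]

end

/-! ### The Hoffman–Singleton graph -/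

section
variable {V : Type*} {G : SimpleGraph V} {p : ZMod 5 → V}

/-- A pentagram of pendant vertices is determined by one of its vertices. -/
theorem pentagram_unique (hG : GirthFive G) {q q' : ZMod 5 → V}
    (hq : ∀ i, Pend G p i (q i)) (hq' : ∀ i, Pend G p i (q' i)) (h : ∀ i, G.Adj (q i) (q (i + 2)))
    (h' : ∀ i, G.Adj (q' i) (q' (i + 2))) (h0 : q 0 = q' 0) (i : ZMod 5) : q i = q' i := by
  have step : ∀ i, q i = q' i → q (i + 2) = q' (i + 2) := fun i hi =>
    (hq (i + 2)).unique (hq' (i + 2)) hG ((hq i).2 _) (h i) (hi ▸ h' i)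
  have h2 := step 0 h0
  have h4 := step _ h2
  have h1 := step _ h4
  have h3 := step _ h1
  rcases zmod_five_eq i with rfl | rfl | rfl | rfl | rfl
  exacts [h0, h1, h2, h3, h4]

theorem Labels.step {L : Type*} (hG : GirthFive G) (hS : ∀ u v, u ≠ v → G.square.Adj u v)
    (hp : Pent G p) {i : ZMod 5} {q q' : L → V} (hq : Labels G p i q ∧ Function.Injective q)
    (hq' : ∀ σ, Pend G p (i + 2) (q' σ)) (h : ∀ σ, G.Adj (q σ) (q' σ)) :
    Labels G p (i + 2) q' ∧ Function.Injective q' := by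
  refine ⟨⟨hq', fun x hx => ?_⟩, fun σ τ hστ => hq.2 ?_⟩
  · obtain ⟨y, hy, hxy⟩ := hx.exists_sub_two hG hS hp
    obtain ⟨σ, rfl⟩ := hq.1.2 y hy
    exact ⟨σ, (hq' σ).unique hx hG ((hq.1.1 σ).2 _) (h σ) hxy.symm⟩
  · exact (hq.1.1 σ).unique (hq.1.1 τ) hG ((hq' σ).2 i) (h σ).symm (hστ ▸ (h τ).symm)

/-- The pendant vertices of a pentagon form five pentagrams. -/
theorem Pent.exists_family [Fintype V] (hG : GirthFive G)
    (hS : ∀ u v, u ≠ v → G.square.Adj u v) (hreg : ∀ v, (nbrs G v).card = 7) (hp : Pent G p) :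
    ∃ Q : ZMod 5 → ZMod 5 → V, (∀ i j, G.Adj (Q i j) (Q i (j + 2))) ∧
      ∀ j, Labels G p j (fun i => Q i j) ∧ Function.Injective fun i => Q i j := by
  obtain ⟨y, hy, hinj⟩ := hp.exists_labels hG 0 (hreg _)
  choose Q hQ0 hQp hQ using fun σ => hp.exists_pentagram hG hS hreg (hy.1 σ)
  refine ⟨Q, hQ, ?_⟩
  have h0 : Labels G p 0 (fun i => Q i 0) ∧ Function.Injective fun i => Q i 0 := by
    simp only [hQ0]
    exact ⟨hy, hinj⟩
  have step : ∀ j, (Labels G p j (fun i => Q i j) ∧ Function.Injective fun i => Q i j) →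
      (Labels G p (j + 2) (fun i => Q i (j + 2)) ∧ Function.Injective fun i => Q i (j + 2)) :=
    fun j hj => Labels.step hG hS hp hj (fun i => hQp i _) (fun i => hQ i j)
  have h2 := step 0 h0
  have h4 := step _ h2
  have h1 := step _ h4
  have h3 := step _ h1
  intro j
  rcases zmod_five_eq j with rfl | rfl | rfl | rfl | rfl
  exacts [h0, h1, h2, h3, h4]

/-- Five pentagons `R h` and five pentagrams `Q i`, all disjoint, such that every vertex of `R h`
has a neighbour in every `Q i`. -/
structure Robertson {V : Type*} (G : SimpleGraph V) (R Q : ZMod 5 → ZMod 5 → V) : Prop where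
  adjR : ∀ h j, G.Adj (R h j) (R h (j + 1))
  adjQ : ∀ i j, G.Adj (Q i j) (Q i (j + 2))
  injR : ∀ h j h' j', R h j = R h' j' → h = h' ∧ j = j'
  injQ : ∀ i j i' j', Q i j = Q i' j' → i = i' ∧ j = j'
  ne : ∀ h j i j', R h j ≠ Q i j'
  exists_adj : ∀ h j i, ∃ k, G.Adj (R h j) (Q i k)
  zeroR : ∀ i j, G.Adj (R 0 j) (Q i j)
  zeroQ : ∀ h j, G.Adj (R h j) (Q 0 j)

theorem pent_of_pentagram {q : ZMod 5 → V} (hq : ∀ j, G.Adj (q j) (q (j + 2))) :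
    Pent G fun j => q (2 * j) := fun i => by
  have := hq (2 * i)
  rwa [show 2 * i + 2 = 2 * (i + 1) by ring] at this

theorem two_mul_three (j : ZMod 5) : 2 * (3 * j) = j := by
  revert j
  decide

/-- A vertex outside a pentagram has at most one neighbour on it. -/
theorem pentagram_adj_unique (hG : GirthFive G) {q : ZMod 5 → V}
    (hq : ∀ j, G.Adj (q j) (q (j + 2))) {x : V} (hx : ∀ j, x ≠ q j) {a b : ZMod 5}
    (ha : G.Adj x (q a)) (hb : G.Adj x (q b)) : a = b := by
  have h1 : Pend G (fun j => q (2 * j)) (3 * a) x :=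
    ⟨by simpa only [two_mul_three] using ha.symm, fun j => hx _⟩
  have h2 := h1.eq_of_adj (pent_of_pentagram hq) hG (j := 3 * b)
    (by simpa only [two_mul_three] using hb.symm)
  rw [← two_mul_three a, ← two_mul_three b, h2]

/-- The pentagrams `Q i` are formed by the pendant vertices of a pentagon `R 0`, and the pentagons `R h`
by those of the pentagram `Q 0`. -/
theorem exists_robertson [Fintype V] (hG : GirthFive G)
    (hS : ∀ u v, u ≠ v → G.square.Adj u v) (hreg : ∀ v, (nbrs G v).card = 7) (hp : Pent G p) :
    ∃ R Q, Robertson G R Q := by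
  obtain ⟨Q, hQ, hQl⟩ := hp.exists_family hG hS hreg
  have hQp : ∀ i j, Pend G p j (Q i j) := fun i j => (hQl j).1.1 i
  have hQinj : ∀ i j i' j', Q i j = Q i' j' → i = i' ∧ j = j' := by
    intro i j i' j' h
    have hj : j = j' := (hQp i' j').eq_of_adj hp hG (h ▸ (hQp i j).1)
    subst hj
    exact ⟨(hQl j).2 h, rfl⟩
  have hp' := pent_of_pentagram (hQ 0)
  obtain ⟨R', hR', hRl⟩ := hp'.exists_family hG hS hreg
  obtain ⟨h0, hh0⟩ := (hRl 0).1.2 (p 0)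
    ⟨by simpa using (hQp 0 0).1.symm, fun j => ((hQp 0 _).2 0).symm⟩
  have hRp : ∀ h j, Pend G (fun j => Q 0 (2 * j)) j (R' h j) := fun h j => (hRl j).1.1 h
  have hR0 : ∀ j, R' h0 j = p (2 * j) := by
    refine pentagram_unique (q' := fun j => p (2 * j)) hG (hRp h0)
      (fun i => ⟨(hQp 0 _).1.symm, fun j => ((hQp 0 _).2 _).symm⟩) (hR' h0) (fun i => ?_) (by simpa using hh0)
    have h1 := hp (2 * (i + 2))
    rw [show 2 * (i + 2) + 1 = 2 * i by linear_combination (by decide : (5 : ZMod 5) = 0)] at h1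
    exact h1.symm
  set R : ZMod 5 → ZMod 5 → V := fun h j => R' (h + h0) (3 * j) with hR
  -- The shift by `h0` makes `p` the pentagon `R 0`, and the factor `3` turns the pentagrams over
  -- `Q 0`, read as a pentagon, into pentagons.
  have hRz : ∀ j, R 0 j = p j := by
    intro j
    rw [hR]
    simp only
    rw [zero_add, hR0, two_mul_three]
  have hRQ : ∀ h j, G.Adj (Q 0 j) (R h j) := by
    intro h j
    have := (hRp (h + h0) (3 * j)).1
    simp only [two_mul_three] at this
    exact this
  have hRne : ∀ h j j', R h j ≠ Q 0 j' := by
    intro h j j' h1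
    have := (hRp (h + h0) (3 * j)).2 (3 * j')
    simp only [two_mul_three] at this
    exact this h1
  have hRinj : ∀ h j h' j', R h j = R h' j' → h = h' ∧ j = j' := by
    intro h j h' j' e
    have hj : 3 * j = 3 * j' := (hRp (h' + h0) (3 * j')).eq_of_adj hp' hG
      ((show R' (h + h0) (3 * j) = R' (h' + h0) (3 * j') from e) ▸ (hRp (h + h0) (3 * j)).1)
    have hj2 : j = j' := by rw [← two_mul_three j, ← two_mul_three j', hj]
    subst hj2
    exact ⟨add_right_cancel ((hRl (3 * j)).2 e), rfl⟩
  have hRQne : ∀ h j i j', R h j ≠ Q i j' := by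
    intro h j i j' e
    by_cases hi : i = 0
    · exact hRne h j j' (hi ▸ e)
    have hadj : G.Adj (Q 0 j) (Q i j') := e ▸ hRQ h j
    rcases zmod_five_cases j j' with rfl | rfl | rfl | rfl | rfl
    · exact (hQp 0 _).not_adj (hQp i _) hG hadj
    · exact (hQp 0 _).not_adj_add_one (hQp i _) hp hG hadj
    · exact (hQp i _).not_adj_add_one (hQp 0 _) hp hG hadj.symm
    · exact hi ((hQl j).2 ((hQp i j).unique (hQp 0 j) hG ((hQp i _).2 _) (hQ i j).symm hadj.symm))
    · exact hi ((hQl _).2 ((hQp i _).unique (hQp 0 _) hG ((hQp i _).2 _) (hQ i j') hadj.symm))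
  refine ⟨R, Q, ⟨fun h j => ?_, hQ, hRinj, hQinj, hRQne, fun h j i => ?_, fun i j => ?_,
    fun h j => (hRQ h j).symm⟩⟩
  · have h1 := hR' (h + h0) (3 * (j + 1))
    rw [show 3 * (j + 1) + 2 = 3 * j by linear_combination (by decide : (5 : ZMod 5) = 0)] at h1
    exact h1.symm
  · by_cases hh : h = 0
    · exact ⟨j, by rw [hh, hRz]; exact (hQp i j).1⟩
    have hfar : Far G p (R h j) := by
      refine fun k => ⟨fun e => hh (hRinj h j 0 k (by rw [hRz, e])).1, fun hadj => ?_⟩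
      obtain ⟨i', hi'⟩ := (hQl k).1.2 (R h j)
        ⟨hadj, fun l e => hh (hRinj h j 0 l (by rw [hRz, e])).1⟩
      exact hRQne h j i' k hi'.symm
    choose f hf using fun k => hfar.exists_label hG hS hp (hQl k).1
    have hfinj : Function.Injective f := by
      intro a b hab
      refine pentagram_adj_unique hG (hQ (f a)) (fun l => hRQne h j _ l) (hf a) ?_
      rw [hab]
      exact hf b
    obtain ⟨k, rfl⟩ := (Finite.injective_iff_surjective.1 hfinj) i
    exact ⟨k, hf k⟩
  · rw [hRz]
    exact (hQp i j).1

set_option synthInstance.maxHeartbeats 400000 in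
set_option synthInstance.maxSize 2000 in
theorem rotation_or_fixed_aux : ∀ a b : ZMod 5, (b = a + 1 ∨ a = b + 1) →
    ∀ c, c ≠ a → (c = b + 1 ∨ b = c + 1) → ∀ d, d ≠ b → (d = c + 1 ∨ c = d + 1) →
    ∀ e, e ≠ c → (e = d + 1 ∨ d = e + 1) →
    (b = 1 + a ∧ c = 2 + a ∧ d = 3 + a ∧ e = 4 + a) ∨
      (a = 0 ∨ b = 1 ∨ c = 2 ∨ d = 3 ∨ e = 4) := by decide +kernel

/-- An injective map of `ZMod 5` that changes neighbours into neighbours is a rotation, or a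
reflection, which has a fixed point. -/
theorem rotation_or_fixed (m : ZMod 5 → ZMod 5) (hm : Function.Injective m)
    (h : ∀ j, m (j + 1) = m j + 1 ∨ m j = m (j + 1) + 1) :
    (∀ j, m j = j + m 0) ∨ ∃ j, m j = j := by
  have hne : ∀ {i j : ZMod 5}, i ≠ j → m i ≠ m j := fun h h' => h (hm h')
  rcases rotation_or_fixed_aux (m 0) (m 1) (h 0) (m 2) (hne (by decide)) (h 1) (m 3)
    (hne (by decide)) (h 2) (m 4) (hne (by decide)) (h 3) with ⟨h1, h2, h3, h4⟩ | h1
  · refine Or.inl fun j => ?_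
    rcases zmod_five_eq j with rfl | rfl | rfl | rfl | rfl
    exacts [(zero_add _).symm, h1, h2, h3, h4]
  · rcases h1 with h1 | h1 | h1 | h1 | h1
    exacts [Or.inr ⟨_, h1⟩, Or.inr ⟨_, h1⟩, Or.inr ⟨_, h1⟩, Or.inr ⟨_, h1⟩, Or.inr ⟨_, h1⟩]

theorem Robertson.adj_unique (hG : GirthFive G) {R Q : ZMod 5 → ZMod 5 → V} (D : Robertson G R Q)
    {h j i a b : ZMod 5} (ha : G.Adj (R h j) (Q i a)) (hb : G.Adj (R h j) (Q i b)) : a = b :=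
  pentagram_adj_unique hG (D.adjQ i) (fun l => D.ne h j i l) ha hb

/-- The pentagon `R h` is joined to the pentagram `Q i` by a rotation; a reflection would have a fixed
point `j`, and `R h j`, `Q i j`, `R 0 j`, `Q 0 j` would be a 4-cycle. -/
theorem Robertson.exists_rotation (hG : GirthFive G) {R Q : ZMod 5 → ZMod 5 → V}
    (D : Robertson G R Q) (h i : ZMod 5) : ∃ c, ∀ j, G.Adj (R h j) (Q i (j + c)) := by
  by_cases hh : h = 0
  · exact ⟨0, fun j => by rw [hh, add_zero]; exact D.zeroR i j⟩
  by_cases hi : i = 0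
  · exact ⟨0, fun j => by rw [hi, add_zero]; exact D.zeroQ h j⟩
  choose m hm using fun j => D.exists_adj h j i
  have hinj : Function.Injective m := by
    intro a b hab
    have h1 : Pend G (R h) a (Q i (m a)) := ⟨hm a, fun j => (D.ne h j i _).symm⟩
    exact (h1.eq_of_adj (D.adjR h) hG (hab ▸ hm b)).symm
  have hstep : ∀ j, m (j + 1) = m j + 1 ∨ m j = m (j + 1) + 1 := by
    intro j
    rcases zmod_five_cases (m j) (m (j + 1)) with e | e | e | e | e
    · have h1 : ∀ j : ZMod 5, j + 1 ≠ j := by decide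
      exact absurd (hinj e) (h1 j)
    · exact Or.inl e
    · exact Or.inr e
    · exact absurd (hG.eq_of_common (D.ne h j i _) (D.adjR h j) (hm (j + 1)) (hm j)
        (e ▸ D.adjQ i (m j))) (D.ne _ _ _ _)
    · have h1 := D.adjQ i (m (j + 1))
      rw [← e] at h1
      exact absurd (hG.eq_of_common (D.ne h j i _) (D.adjR h j) (hm (j + 1)) (hm j)
        h1.symm) (D.ne _ _ _ _)
  rcases rotation_or_fixed m hinj hstep with h1 | ⟨j, hj⟩
  · exact ⟨m 0, fun j => h1 j ▸ hm j⟩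
  · have h2 := hm j
    rw [hj] at h2
    refine absurd (hG.eq_of_common (fun e => hh (D.injR h j 0 j e).1) h2 (D.zeroR i j).symm
      (D.zeroQ h j) (D.zeroR 0 j).symm) fun e => hi (D.injQ _ _ _ _ e).1

set_option synthInstance.maxHeartbeats 400000 in
set_option synthInstance.maxSize 2000 in
theorem mul_of_injective_aux : ∀ a : ZMod 5, a ≠ 0 → ∀ b, b ≠ 0 → b ≠ a → b - 2 ≠ a - 1 → b ≠ 2 →
    ∀ c, c ≠ 0 → c ≠ a → c ≠ b → c ≠ 3 → c - 3 ≠ a - 1 → c - 3 ≠ b - 2 →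
    ∀ d, d ≠ 0 → d ≠ a → d ≠ b → d ≠ c → d ≠ 4 → d - 4 ≠ a - 1 → d - 4 ≠ b - 2 → d - 4 ≠ c - 3 →
    b = a * 2 ∧ c = a * 3 ∧ d = a * 4 := by decide +kernel

/-- A function `f` on `ZMod 5` with `f 0 = 0` for which `f` and `f - id` are injective is linear. -/
theorem mul_of_injective (f : ZMod 5 → ZMod 5) (h0 : f 0 = 0) (hf : Function.Injective f)
    (hf' : Function.Injective fun i => f i - i) (i : ZMod 5) : f i = f 1 * i := by
  have hne : ∀ {i j : ZMod 5}, i ≠ j → f i ≠ f j := fun h h' => h (hf h')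
  have hz : ∀ {i : ZMod 5}, i ≠ 0 → f i ≠ 0 := fun h h' => h (hf (h'.trans h0.symm))
  have hne' : ∀ {i j : ZMod 5}, i ≠ j → f i - i ≠ f j - j := fun h h' => h (hf' h')
  have hz' : ∀ {i : ZMod 5}, i ≠ 0 → f i ≠ i := fun h h' => h (hf' (by simp [h', h0]))
  obtain ⟨h2, h3, h4⟩ := mul_of_injective_aux (f 1) (hz (by decide)) (f 2) (hz (by decide))
    (hne (by decide)) (hne' (by decide)) (hz' (by decide)) (f 3) (hz (by decide)) (hne (by decide))
    (hne (by decide)) (hz' (by decide)) (hne' (by decide)) (hne' (by decide)) (f 4) (hz (by decide))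
    (hne (by decide)) (hne (by decide)) (hne (by decide)) (hz' (by decide)) (hne' (by decide))
    (hne' (by decide)) (hne' (by decide))
  rcases zmod_five_eq i with rfl | rfl | rfl | rfl | rfl
  · rw [h0, mul_zero]
  · rw [mul_one]
  exacts [h2, h3, h4]

/-- After relabelling, the rotations between pentagons and pentagrams are those in Robertson's
description of the Hoffman–Singleton graph. The rotations `c h i` vanish if `h = 0` or `i = 0`, and as
there are no 4-cycles, `c h - c h'` is injective for `h ≠ h'`, and likewise in the other variable.
The relabelling achieves `c 1 i = i` and `c h 1 = h`. -/
theorem Robertson.exists_normal (hG : GirthFive G) {R Q : ZMod 5 → ZMod 5 → V}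
    (D : Robertson G R Q) : ∃ σ τ : Equiv.Perm (ZMod 5),
      ∀ h i j, G.Adj (R (τ h) j) (Q (σ i) (h * i + j)) := by
  choose c hc using fun h i => D.exists_rotation hG h i
  have hc0 : ∀ i, c 0 i = 0 := fun i => by
    simpa using D.adj_unique hG (hc 0 i 0) (D.zeroR i 0)
  have hc0' : ∀ h, c h 0 = 0 := fun h => by
    simpa using D.adj_unique hG (hc h 0 0) (D.zeroQ h 0)
  have hne : ∀ h h' i i', h ≠ h' → i ≠ i' → c h i - c h' i ≠ c h i' - c h' i' := by
    intro h h' i i' hh hi e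
    have h1 := hc h' i (c h i - c h' i)
    have h2 := hc h' i' (c h i - c h' i)
    rw [sub_add_cancel] at h1
    rw [e, sub_add_cancel, ← e] at h2
    have h3 := hc h i 0
    have h4 := hc h i' 0
    rw [zero_add] at h3 h4
    exact hi (D.injQ _ _ _ _ (hG.eq_of_common (fun e => hh (D.injR _ _ _ _ e).1) h3 h1.symm h4
      h2.symm)).1
  have hσ : Function.Injective (c 1) := fun i i' e => by
    by_contra hi
    exact hne 1 0 i i' (by decide) hi (by rw [hc0, hc0, e])
  set σ := Equiv.ofBijective (c 1) (Finite.injective_iff_bijective.1 hσ) with hσdef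
  have hσc : ∀ i, c 1 (σ.symm i) = i := fun i => σ.apply_symm_apply i
  set i1 := σ.symm 1 with hi1
  have hi10 : i1 ≠ 0 := fun h => by
    have := hσc 1
    rw [← hi1, h, hc0'] at this
    exact absurd this (by decide)
  have hτ : Function.Injective fun h => c h i1 := fun h h' e => by
    by_contra hh
    refine hne h h' i1 0 hh hi10 ?_
    rw [hc0', hc0', sub_self, sub_eq_zero]
    exact e
  set τ := Equiv.ofBijective (fun h => c h i1) (Finite.injective_iff_bijective.1 hτ) with hτdef
  have hτc : ∀ h, c (τ.symm h) i1 = h := fun h => τ.apply_symm_apply h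
  have hτ0 : τ.symm 0 = 0 := by
    rw [Equiv.symm_apply_eq]
    exact (hc0 i1).symm
  have hτ1 : τ.symm 1 = 1 := by
    rw [Equiv.symm_apply_eq]
    exact (hσc 1).symm
  have hσ0 : σ.symm 0 = 0 := by
    rw [Equiv.symm_apply_eq]
    exact (hc0' 1).symm
  refine ⟨σ.symm, τ.symm, fun h i j => ?_⟩
  suffices hcm : c (τ.symm h) (σ.symm i) = h * i by
    rw [add_comm, ← hcm]
    exact hc _ _ j
  by_cases hh0 : h = 0
  · rw [hh0, hτ0, hc0, zero_mul]
  by_cases hh1 : h = 1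
  · rw [hh1, hτ1, hσc, one_mul]
  have h0 : τ.symm h ≠ 0 := fun e => hh0 (τ.symm.injective (e.trans hτ0.symm))
  have h1 : τ.symm h ≠ 1 := fun e => hh1 (τ.symm.injective (e.trans hτ1.symm))
  rw [mul_of_injective (fun i => c (τ.symm h) (σ.symm i)) (by rw [hσ0, hc0']) ?_ ?_ i]
  · rw [← hi1, hτc]
  · intro a b e
    by_contra hab
    refine hne _ 0 (σ.symm a) (σ.symm b) h0 (fun e => hab (σ.symm.injective e)) ?_
    rw [hc0, hc0]
    simpa using e
  · intro a b e
    by_contra hab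
    refine hne _ 1 (σ.symm a) (σ.symm b) h1 (fun e => hab (σ.symm.injective e)) ?_
    rw [hσc, hσc]
    exact e

end

instance : DecidableRel hoffmanSingletonRel
  | .inl (h, j), .inl (h', j') => inferInstanceAs (Decidable (h = h' ∧ j' = j + 1))
  | .inr (i, j), .inr (i', j') => inferInstanceAs (Decidable (i = i' ∧ j' = j + 2))
  | .inl (h, j), .inr (i, j') => inferInstanceAs (Decidable (j' = h * i + j))
  | .inr _, .inl _ => inferInstanceAs (Decidable False)

theorem card_filter_hoffmanSingletonRel : ∀ a, (Finset.univ.filter fun b =>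
    a ≠ b ∧ (hoffmanSingletonRel a b ∨ hoffmanSingletonRel b a)).card = 7 := by decide +kernel

/-- A Moore graph of degree seven. -/
theorem nonempty_iso_hoffmanSingleton {V : Type*} [Fintype V] {G : SimpleGraph V}
    {p : ZMod 5 → V} (hG : GirthFive G) (hS : ∀ u v, u ≠ v → G.square.Adj u v)
    (hreg : ∀ v, (nbrs G v).card = 7) (hcard : Fintype.card V = 50) (hp : Pent G p) :
    Nonempty (G ≃g hoffmanSingletonGraph) := by
  obtain ⟨R, Q, D⟩ := exists_robertson hG hS hreg hp
  obtain ⟨σ, τ, hadj⟩ := D.exists_normal hG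
  refine nonempty_iso_of_injective (d := 7) (fun a => ?_) hreg (by rw [hcard]; rfl)
    (Sum.elim (fun x => R (τ x.1) x.2) (fun x => Q (σ x.1) x.2)) ?_ ?_
  · rw [← card_filter_hoffmanSingletonRel a]
    congr 1
    ext b
    simp [hoffmanSingletonGraph, SimpleGraph.fromRel_adj]
  · refine Function.Injective.sumElim ?_ ?_ fun x y => D.ne _ _ _ _
    · rintro ⟨h, j⟩ ⟨h', j'⟩ e
      obtain ⟨h1, h2⟩ := D.injR _ _ _ _ e
      exact Prod.ext (τ.injective h1) h2
    · rintro ⟨h, j⟩ ⟨h', j'⟩ e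
      obtain ⟨h1, h2⟩ := D.injQ _ _ _ _ e
      exact Prod.ext (σ.injective h1) h2
  · have key : ∀ a b, hoffmanSingletonRel a b →
        G.Adj (Sum.elim (fun x => R (τ x.1) x.2) (fun x => Q (σ x.1) x.2) a)
          (Sum.elim (fun x => R (τ x.1) x.2) (fun x => Q (σ x.1) x.2) b) := by
      rintro (⟨h, j⟩ | ⟨i, j⟩) (⟨h', j'⟩ | ⟨i', j'⟩) hab
      · obtain ⟨rfl, rfl⟩ := hab
        exact D.adjR _ _
      · have hab : j' = h * i' + j := hab
        subst hab
        exact hadj h i' j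
      · exact hab.elim
      · obtain ⟨rfl, rfl⟩ := hab
        exact D.adjQ _ _
    intro a b hab
    rcases ((SimpleGraph.fromRel_adj ..).1 hab).2 with h | h
    · exact key a b h
    · exact (key b a h).symm

/-! ### The bound on the Alon–Tarsi number -/

/-- A regular graph that satisfies `Bad` is a Moore graph of degree `3`, `7` or `57`. -/
theorem Bad.moore {V : Type*} [Fintype V] {G : SimpleGraph V} {Δ m : ℕ} (h : Bad G Δ m)
    (hreg : ∀ v, (nbrs G v).card = Δ) : (Δ = 3 ∨ Δ = 7 ∨ Δ = 57) ∧ GirthFive G ∧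
      Fintype.card V = Δ ^ 2 + 1 ∧ (∀ u v, u ≠ v → G.square.Adj u v) ∧
      ∃ p : ZMod 5 → V, Pent G p := by
  have htri : ∀ a b c, G.Adj a b → G.Adj b c → ¬ G.Adj a c := fun a b c h1 h2 h3 =>
    h.triangle_free h1 h2 h3
  have hG : GirthFive G := by
    refine ⟨fun h1 h2 => htri _ _ _ h1 h2, fun {a b x y} hab hax hxb hay hyb => ?_⟩
    by_contra hxy
    obtain ⟨h1, h2⟩ := h.eq_top_of_square hreg hax hxb hyb.symm hay.symm hab hxy
    exact not_card_eq_sq hreg h.three_le h1 h2 htri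
  obtain ⟨a, b, c, d, e, p⟩ := h.exists_short_cycle hreg hG
  obtain ⟨h1, h2⟩ := h.eq_top_of_pentagon p hG hreg
  refine ⟨moore_degree hreg h.three_le h1 h2, hG, h1, h2, ![a, b, c, d, e], fun i => ?_⟩
  rcases zmod_five_eq i with rfl | rfl | rfl | rfl | rfl
  exacts [p.ab, p.bc, p.cd, p.de, p.ea]

theorem mainTheorem2 {V : Type*} [Fintype V] (G : SimpleGraph V) [DecidableRel G.Adj]
    (hconn : G.Connected) (hdeg : 3 ≤ G.maxDegree)
    (hP : ¬ Nonempty (G ≃g petersenGraph))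
    (hHS : ¬ Nonempty (G ≃g hoffmanSingletonGraph))
    (hM : ¬ G.IsMooreGraph 57) :
    G.square.alonTarsiNumber ≤ ((G.maxDegree ^ 2 - 1 : ℕ) : ℕ∞) ∧
      ∃ D : Digraph V, D.IsOrientation G.square ∧ (∀ v, D.outdegree v ≤ G.maxDegree ^ 2 - 2) ∧
        D.evenCirculations.card ≠ D.oddCirculations.card := by
  have hnd : ∀ v, (nbrs G v).card = G.degree v := by
    intro v
    rw [← SimpleGraph.card_neighborFinset_eq_degree]
    congr 1
    ext w
    simp
  have h9 : 9 ≤ G.maxDegree ^ 2 := Nat.pow_le_pow_left hdeg 2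
  have key : HasATOrientation G.square (G.maxDegree ^ 2 - 2) := by
    by_contra hcon
    have h : Bad G G.maxDegree (G.maxDegree ^ 2 - 2) :=
      ⟨hconn, fun v => (hnd v).trans_le (G.degree_le_maxDegree v), hdeg, by omega, hcon⟩
    have := hconn.nonempty
    obtain ⟨x, hx⟩ := G.exists_maximal_degree_vertex
    have hreg := h.regular x ((hnd x).trans hx.symm)
    obtain ⟨hd, hG, hcard, hS, p, hp⟩ := h.moore hreg
    rcases hd with hd | hd | hd
    all_goals rw [hd] at hreg hcard
    · exact hP (nonempty_iso_petersen hG hS hreg hcard hp)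
    · exact hHS (nonempty_iso_hoffmanSingleton hG hS hreg hcard hp)
    · refine hM ⟨fun v => (hnd v).symm.trans (hreg v), hcard, ?_⟩
      ext u v
      rw [SimpleGraph.top_adj]
      exact ⟨fun huv => huv.ne, hS u v⟩
  obtain ⟨D, hD, hout, hne⟩ := key
  refine ⟨iInf₂_le _ ⟨D, hD, fun v => ?_, hne⟩, D, hD, hout, hne⟩
  have := hout v
  omega
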